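/- Let $C\ge 0$ be any constant. There are a randomized algorithm and constants $c,k$ (depending only on $C$) with the following property. The input is an undirected graph $G$ with $n$ vertices, a list of $m$ edges (parallel edges and loops are allowed) and non-negative real edge weights, together with a vertex $s$ and a real threshold $\lambda\ge 0$. For $v\ne s$ let $\mathsf{mincut}(s,v)$ be the minimum, over all vertex sets $S$ with $v\in S$ and $s\notin S$, of the total weight $w(\partial S)$ of the edges with exactly one endpoint in $S$. With probability at least $1-n^{-C}$, the algorithm outputs exactly the set $$\{v\in V\setminus\{s\} : \mathsf{mincut}(s,v)\le\lambda\}.$$ On every input and for every outcome of its coin tosses, the algorithm * takes at most $c\,(n+m)\,(\lfloor\log_2(n+m)\rfloor+1)^k=\tilde O(n+m)$ steps outside of the max-flow calls (this is $\tilde O(m)$ if $n=O(m)$, in particular if $G$ is connected and $n\ge 2$), and * makes at most $c\,(\lfloor\log_2 n\rfloor+1)^k=\mathrm{polylog}(n)$ calls to a black box for exact $s'$-$t'$ max-flow on undirected weighted graphs, each on an instance with at most $c\,n$ vertices and at most $c\,m$ edges. The black box may return any maximum flow. The model of computation is a random-access machine with fair coin tosses. It has unit-cost operations on integers of logarithmic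 length (increment, truncated subtraction, halving, parity, comparison, indirect addressing) and on real numbers (addition, subtraction, comparison). -/

import Mathlib

/-! ## Weighted undirected graphs, cuts and flows -/

/-- A weighted undirected (multi)graph, given by its list of edges: the vertices are `0, …, n - 1`,
and the `i`-th edge joins `src i` and `dst i` and has weight `wt i`.
(The order of the two endpoints carries no meaning, except as a reference direction for flows.) -/
structure WGraph where
  n : ℕ
  m : ℕ
  src : Fin m → ℕ
  dst : Fin m → ℕ
  wt : Fin m → ℝ

namespace WGraph

/-- The endpoints of all edges are vertices, and all weights are non-negative. -/
def WF (G : WGraph) : Prop :=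
  ∀ e, G.src e < G.n ∧ G.dst e < G.n ∧ 0 ≤ G.wt e

/-- The weight `w(∂S)` of the set of edges with exactly one endpoint in `S`. -/
noncomputable def cutWeight (G : WGraph) (S : Finset ℕ) : ℝ :=
  ∑ e, if (G.src e ∈ S ∧ G.dst e ∉ S) ∨ (G.src e ∉ S ∧ G.dst e ∈ S) then G.wt e else 0

/-- The weight of a minimum `(s,v)`-cut. It is only used for distinct vertices `s` and `v`, where
the set below is finite and non-empty, so that the infimum is a minimum. -/
noncomputable def mincut (G : WGraph) (s v : ℕ) : ℝ :=
  sInf {x | ∃ S : Finset ℕ, S ⊆ Finset.range G.n ∧ v ∈ S ∧ s ∉ S ∧ x = G.cutWeight S}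

/-- The vertices `v ≠ s` with `mincut(s,v) ≤ lam`. -/
def cutThresholdSet (G : WGraph) (s : ℕ) (lam : ℝ) : Set ℕ :=
  {v | v < G.n ∧ v ≠ s ∧ G.mincut s v ≤ lam}

end WGraph

/-- An instance of the (undirected) `s`-`t` max-flow problem. -/
structure FlowInstance extends WGraph where
  s : ℕ
  t : ℕ

namespace FlowInstance

def Valid (I : FlowInstance) : Prop :=
  I.toWGraph.WF ∧ I.s < I.n ∧ I.t < I.n ∧ I.s ≠ I.t

/-- Net flow out of the vertex `x`; `f e > 0` means flow from `src e` to `dst e`, and `f e < 0`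
means flow from `dst e` to `src e`. -/
noncomputable def netOut (I : FlowInstance) (f : Fin I.m → ℝ) (x : ℕ) : ℝ :=
  ∑ e, ((if I.src e = x then f e else 0) - (if I.dst e = x then f e else 0))

/-- `f` respects the capacities and is conserved at all vertices other than `s` and `t`. -/
def IsFlow (I : FlowInstance) (f : Fin I.m → ℝ) : Prop :=
  (∀ e, |f e| ≤ I.wt e) ∧ ∀ x, x < I.n → x ≠ I.s → x ≠ I.t → I.netOut f x = 0

/-- `f` is a flow whose value, the net flow out of `s`, is maximum. -/
def IsMaxFlow (I : FlowInstance) (f : Fin I.m → ℝ) : Prop :=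
  I.IsFlow f ∧ ∀ g, I.IsFlow g → I.netOut g I.s ≤ I.netOut f I.s

end FlowInstance

/-- A black box that may be asked for a flow on any instance. -/
def FlowOracle : Type := (I : FlowInstance) → Fin I.m → ℝ

/-- The black box solves the exact max-flow problem: it answers every valid instance by some
maximum flow (which one is not specified). -/
def FlowOracle.Correct (O : FlowOracle) : Prop :=
  ∀ I : FlowInstance, I.Valid → I.IsMaxFlow (O I)

/-! ## The machine model

A randomized random-access machine with max-flow calls. Its memory consists of integer variables,
real variables, integer arrays and real arrays; programs are structured (sequence, branching,
loops). All instructions and all tests have unit cost, so a fixed program does a bounded number of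
elementary operations per unit of time.

* Integers admit only increment, truncated subtraction, halving, parity and comparison. These are
  word-RAM operations. A single instruction of a fixed program increases the largest integer in
  memory by at most a constant, so that integers and addresses fit in words of logarithmic length
  and no large integers can be abused.
* Reals (weights, the threshold, flow values) admit only addition, subtraction and comparison, and
  the constant `0`; they cannot be rounded or used as addresses. -/

namespace RAM

/-- `iv x` and `rv x` are the integer and real variables, `ia a i` and `ra a i` the cells of the
integer and real arrays. `coins` counts the coins tossed so far, and `calls` is the list of the
max-flow instances solved so far. -/
structure State where
  iv : ℕ → ℕ
  rv : ℕ → ℝ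
  ia : ℕ → ℕ → ℕ
  ra : ℕ → ℕ → ℝ
  coins : ℕ
  calls : List FlowInstance

/-- Integer expressions. -/
inductive IExp where
  | lit (k : ℕ)
  | var (x : ℕ)
  | arr (a : ℕ) (i : IExp)
  | succ (e : IExp)
  | sub (e₁ e₂ : IExp)
  | half (e : IExp)
  | parity (e : IExp)

def IExp.eval (σ : State) : IExp → ℕ
  | .lit k => k
  | .var x => σ.iv x
  | .arr a i => σ.ia a (i.eval σ)
  | .succ e => e.eval σ + 1
  | .sub e₁ e₂ => e₁.eval σ - e₂.eval σ
  | .half e => e.eval σ / 2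
  | .parity e => e.eval σ % 2

/-- Real expressions. -/
inductive RExp where
  | zero
  | var (x : ℕ)
  | arr (a : ℕ) (i : IExp)
  | add (e₁ e₂ : RExp)
  | sub (e₁ e₂ : RExp)

noncomputable def RExp.eval (σ : State) : RExp → ℝ
  | .zero => 0
  | .var x => σ.rv x
  | .arr a i => σ.ra a (i.eval σ)
  | .add e₁ e₂ => e₁.eval σ + e₂.eval σ
  | .sub e₁ e₂ => e₁.eval σ - e₂.eval σ

/-- Tests. -/
inductive BExp where
  | ilt (e₁ e₂ : IExp)
  | ieq (e₁ e₂ : IExp)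
  | rle (e₁ e₂ : RExp)
  | not (b : BExp)
  | and (b₁ b₂ : BExp)

def BExp.Holds (σ : State) : BExp → Prop
  | .ilt e₁ e₂ => e₁.eval σ < e₂.eval σ
  | .ieq e₁ e₂ => e₁.eval σ = e₂.eval σ
  | .rle e₁ e₂ => e₁.eval σ ≤ e₂.eval σ
  | .not b => ¬ b.Holds σ
  | .and b₁ b₂ => b₁.Holds σ ∧ b₂.Holds σ

/-- Programs. The command `maxflow N M a b c s t f` asks for a maximum flow from `s` to `t` in the
graph with `N` vertices and `M` edges whose `i`-th edge joins `a[i]` and `b[i]` with capacity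
`c[i]`; the answer is written to the cells `f[0], …, f[M-1]`. -/
inductive Prog where
  | skip
  | iset (x : ℕ) (e : IExp)
  | rset (x : ℕ) (e : RExp)
  | istore (a : ℕ) (i : IExp) (e : IExp)
  | rstore (a : ℕ) (i : IExp) (e : RExp)
  | coin (x : ℕ)
  | maxflow (N M : IExp) (a b c : ℕ) (s t : IExp) (f : ℕ)
  | seq (p q : Prog)
  | branch (b : BExp) (p q : Prog)
  | loop (b : BExp) (p : Prog)

namespace State

def setI (σ : State) (x : ℕ) (k : ℕ) : State :=
  { σ with iv := Function.update σ.iv x k }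

def setR (σ : State) (x : ℕ) (r : ℝ) : State :=
  { σ with rv := Function.update σ.rv x r }

def storeI (σ : State) (a i : ℕ) (k : ℕ) : State :=
  { σ with ia := Function.update σ.ia a (Function.update (σ.ia a) i k) }

def storeR (σ : State) (a i : ℕ) (r : ℝ) : State :=
  { σ with ra := Function.update σ.ra a (Function.update (σ.ra a) i r) }

/-- Store the next bit of the random tape `ω` in the variable `x`. -/
def toss (σ : State) (ω : ℕ → Bool) (x : ℕ) : State :=
  { σ with iv := Function.update σ.iv x (if ω σ.coins then 1 else 0), coins := σ.coins + 1 }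

/-- The max-flow instance described by the memory. -/
def readInstance (σ : State) (N M : ℕ) (a b c : ℕ) (s t : ℕ) : FlowInstance where
  n := N
  m := M
  src := fun i => σ.ia a i
  dst := fun i => σ.ia b i
  wt := fun i => σ.ra c i
  s := s
  t := t

/-- Write the answer of the black box for the instance `I` to the array `f` and record the call. -/
def callFlow (σ : State) (O : FlowOracle) (I : FlowInstance) (f : ℕ) : State :=
  { σ with
    ra := Function.update σ.ra f (fun i => if h : i < I.m then O I ⟨i, h⟩ else σ.ra f i)
    calls := σ.calls ++ [I] }

end State

/-- `Exec O ω p σ T τ`: with max-flow black box `O` and random tape `ω`, the program `p` started in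
the state `σ` halts in the state `τ` after `T` steps (a max-flow call counts as one step). -/
inductive Exec (O : FlowOracle) (ω : ℕ → Bool) : Prog → State → ℕ → State → Prop where
  | skip (σ : State) : Exec O ω .skip σ 1 σ
  | iset (σ : State) (x : ℕ) (e : IExp) :
      Exec O ω (.iset x e) σ 1 (σ.setI x (e.eval σ))
  | rset (σ : State) (x : ℕ) (e : RExp) :
      Exec O ω (.rset x e) σ 1 (σ.setR x (e.eval σ))
  | istore (σ : State) (a : ℕ) (i e : IExp) :
      Exec O ω (.istore a i e) σ 1 (σ.storeI a (i.eval σ) (e.eval σ))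
  | rstore (σ : State) (a : ℕ) (i : IExp) (e : RExp) :
      Exec O ω (.rstore a i e) σ 1 (σ.storeR a (i.eval σ) (e.eval σ))
  | coin (σ : State) (x : ℕ) :
      Exec O ω (.coin x) σ 1 (σ.toss ω x)
  | maxflow (σ : State) (N M : IExp) (a b c : ℕ) (s t : IExp) (f : ℕ) :
      Exec O ω (.maxflow N M a b c s t f) σ 1
        (σ.callFlow O
          (σ.readInstance (N.eval σ) (M.eval σ) a b c (s.eval σ) (t.eval σ)) f)
  | seq {p q : Prog} {σ τ ρ : State} {T U : ℕ} (hp : Exec O ω p σ T τ) (hq : Exec O ω q τ U ρ) :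
      Exec O ω (.seq p q) σ (T + U) ρ
  | branch_true {b : BExp} {p q : Prog} {σ τ : State} {T : ℕ} (hb : b.Holds σ)
      (hp : Exec O ω p σ T τ) : Exec O ω (.branch b p q) σ (T + 1) τ
  | branch_false {b : BExp} {p q : Prog} {σ τ : State} {T : ℕ} (hb : ¬ b.Holds σ)
      (hq : Exec O ω q σ T τ) : Exec O ω (.branch b p q) σ (T + 1) τ
  | loop_done {b : BExp} {p : Prog} {σ : State} (hb : ¬ b.Holds σ) :
      Exec O ω (.loop b p) σ 1 σ
  | loop_step {b : BExp} {p : Prog} {σ τ ρ : State} {T U : ℕ} (hb : b.Holds σ)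
      (hp : Exec O ω p σ T τ) (hl : Exec O ω (.loop b p) τ U ρ) :
      Exec O ω (.loop b p) σ (T + U + 1) ρ

/-- Executions are deterministic once the random tape and the black box are fixed. -/
theorem Exec.det {O : FlowOracle} {ω : ℕ → Bool} {p : Prog} {σ τ : State} {T : ℕ}
    (h : Exec O ω p σ T τ) : ∀ {T' : ℕ} {τ' : State}, Exec O ω p σ T' τ' → T' = T ∧ τ' = τ := by
  induction h with
  | seq _ _ ihp ihq =>
    intro T' τ' h'
    cases h' with
    | seq hp' hq' =>
      obtain ⟨rfl, rfl⟩ := ihp hp'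
      obtain ⟨rfl, rfl⟩ := ihq hq'
      exact ⟨rfl, rfl⟩
  | branch_true hb _ ih =>
    intro T' τ' h'
    cases h' with
    | branch_true _ hp' => obtain ⟨rfl, rfl⟩ := ih hp'; exact ⟨rfl, rfl⟩
    | branch_false hb' _ => exact absurd hb hb'
  | branch_false hb _ ih =>
    intro T' τ' h'
    cases h' with
    | branch_true hb' _ => exact absurd hb' hb
    | branch_false _ hp' => obtain ⟨rfl, rfl⟩ := ih hp'; exact ⟨rfl, rfl⟩
  | loop_done hb =>
    intro T' τ' h'
    cases h' with
    | loop_done _ => exact ⟨rfl, rfl⟩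
    | loop_step hb' _ _ => exact absurd hb' hb
  | loop_step hb _ _ ihp ihl =>
    intro T' τ' h'
    cases h' with
    | loop_done hb' => exact absurd hb hb'
    | loop_step _ hp' hl' =>
      obtain ⟨rfl, rfl⟩ := ihp hp'
      obtain ⟨rfl, rfl⟩ := ihl hl'
      exact ⟨rfl, rfl⟩
  | _ =>
    intro T' τ' h'
    cases h'
    exact ⟨rfl, rfl⟩

/-- The initial memory for the graph `G`, the source `s` and the threshold `lam`: the integer
variables `0`, `1`, `2` hold `n`, `m`, `s`; the integer arrays `0`, `1` hold the endpoints of the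
edges and the real array `0` their weights; the real variable `0` holds `lam`; the rest is `0`. -/
noncomputable def input (G : WGraph) (s : ℕ) (lam : ℝ) : State where
  iv := fun x => if x = 0 then G.n else if x = 1 then G.m else if x = 2 then s else 0
  rv := fun x => if x = 0 then lam else 0
  ia := fun a i =>
    if h : i < G.m then
      (if a = 0 then G.src ⟨i, h⟩ else if a = 1 then G.dst ⟨i, h⟩ else 0)
    else 0
  ra := fun a i => if h : i < G.m then (if a = 0 then G.wt ⟨i, h⟩ else 0) else 0
  coins := 0
  calls := []

/-- The set of vertices (numbers below `n`) that is output in the final memory: those marked by a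
non-zero entry of the integer array `2`. -/
def output (n : ℕ) (τ : State) : Set ℕ :=
  {v | v < n ∧ τ.ia 2 v ≠ 0}

/-- The law of a sequence of independent fair coin tosses. -/
noncomputable def coinLaw : MeasureTheory.Measure (ℕ → Bool) :=
  MeasureTheory.Measure.infinitePi (fun _ : ℕ => (PMF.uniformOfFintype Bool).toMeasure)

end RAM

/-!
The algorithm repeats phases of random sampling and isolating cuts. Call a vertex `v ≠ s` light if
`mincut(s,v) ≤ lam`, and let `M(v)` be the smallest side of a minimum cut that separates `v` from `s`
(`WGraph.minSide`). All vertices of `M(v)` are light if `v` is, and the sets `M(v)` form a laminar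
family (`WGraph.disjoint_minSide`).

*Isolating cuts.* Let `R` be a set of terminals that contains `s`. For each bit of the names of the
vertices, one computes a minimum cut between the terminals whose bit is `0` and those whose bit is
`1`. These logarithmically many cuts together divide the vertices into classes, with at most one
terminal in each. One more maximum flow, in which each class is cut off from the rest of the graph
and all terminals are merged into the source, yields a cut inside every class; the vertices in those
that do not contain `s` and have weight at most `lam` are marked. Only light vertices are marked,
because each marked set is itself a cut of weight at most `lam`. Conversely, if `v` is light and the
only terminal in `M(v)`, then all of `M(v)` is marked: by uncrossing, no cut between terminals passes
through `M(v)` (`WGraph.Isolated.mem_iff`), and by exchanging it for `M(v)` the cut in the class of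
`v` is a minimum cut between `v` and `s`, so that it contains `M(v)` (`WGraph.Isolated.subset`).
A minimum cut is read off from a maximum flow as the set of vertices that are reachable in the
residual graph (`FlowInstance.IsMaxFlow.cut_le`). All sets of terminals are contracted, so that no
instance has more than twice as many edges as the graph.

*Sampling.* A phase starts with all unmarked vertices as terminals and halves the set of terminals at
random from level to level, except that `s` is kept. If `M(v)` contains `k` light unmarked vertices,
then `v` is isolated with probability at least `1 / (8 * k)` on a suitable level (`isolated_prob`), in
which case the phase marks these `k` vertices. On each level, the sets `M(v)` of the isolated vertices
are disjoint, so that every vertex is counted at most once for each of the `L` levels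
(`sum_isolated_le`). Hence the expected number of light unmarked vertices drops by a factor of
`1 - 1 / (8 * L)` in each phase, and Markov's inequality shows that `8 * (C + 1) * L ^ 2` phases
suffice (`coinLaw_not_subset_le`). The coins of different phases are independent because an execution
depends only on the coins it consumes (`Exec.congr_tape`).

*The machine.* The integer variables hold: `0`, `1`, `2` the input `n`, `m`, `s`; `3` the number of
bits of `n`; `4` the number of levels; `5` the number of phases; `6` to `10` loop counters for phases,
levels, bits, vertices and edges; `12` the number of edges of the current flow instance; `13` the
number of its residual arcs; `14` the height of the stack; `15` to `17` temporary values. The integer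
arrays hold: `0`, `1` the endpoints of the edges; `2` the marks; `3` the terminals; `4` the remaining
bits of the names of the vertices; `5` the classes; `6` a table of doubles, as the machine cannot
double in one step; `7`, `8` the endpoints of the edges of the flow instance; `9` the vertices to
which the vertices are contracted; `10` to `13` the residual graph; `14` the visited vertices; `15`
the stack. The real arrays hold: `0` the weights; `1` the capacities; `2` the flow; `3` the weights
of the cuts of the classes. Programs are verified in a logic of total correctness with time bounds (`Run`). What a
program does not write is preserved (`Exec.frame`), and this is decided by computation on its syntax.
-/

local infixr:60 " ;; " => RAM.Prog.seq

/-! ### Program logic for the machine model -/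

namespace RAM

/-- Does one of the commands that occur in the program satisfy `f`? -/
def Prog.any (f : Prog → Bool) : Prog → Bool
  | .seq p q => p.any f || q.any f
  | .branch _ p q => p.any f || q.any f
  | .loop b p => f (.loop b p) || p.any f
  | p => f p

/-- Does the program write the integer variable `x`? -/
def Prog.writesI (p : Prog) (x : ℕ) : Bool :=
  p.any fun | .iset y _ => y == x | .coin y => y == x | _ => false

/-- Does the program write the real variable `x`? -/
def Prog.writesR (p : Prog) (x : ℕ) : Bool :=
  p.any fun | .rset y _ => y == x | _ => false

/-- Does the program write the integer array `a`? -/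
def Prog.writesIA (p : Prog) (a : ℕ) : Bool :=
  p.any fun | .istore b _ _ => b == a | _ => false

/-- Does the program write the real array `a`? -/
def Prog.writesRA (p : Prog) (a : ℕ) : Bool :=
  p.any fun | .rstore b _ _ => b == a | .maxflow _ _ _ _ _ _ _ b => b == a | _ => false

/-- Does the program toss coins? -/
def Prog.tosses (p : Prog) : Bool :=
  p.any fun | .coin _ => true | _ => false

/-- Does the program ask for maximum flows? -/
def Prog.asks (p : Prog) : Bool :=
  p.any fun | .maxflow _ _ _ _ _ _ _ _ => true | _ => false

/-- Is the program free of loops? -/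
def Prog.straight (p : Prog) : Bool :=
  !p.any fun | .loop _ _ => true | _ => false

/-- The states `σ` and `τ` agree on everything that the program `p` does not write. -/
structure Frame (p : Prog) (σ τ : State) : Prop where
  iv : ∀ x, p.writesI x = false → τ.iv x = σ.iv x
  rv : ∀ x, p.writesR x = false → τ.rv x = σ.rv x
  ia : ∀ a, p.writesIA a = false → τ.ia a = σ.ia a
  ra : ∀ a, p.writesRA a = false → τ.ra a = σ.ra a
  coins : p.tosses = false → τ.coins = σ.coins
  calls : p.asks = false → τ.calls = σ.calls

theorem Frame.refl (p : Prog) (σ : State) : Frame p σ σ :=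
  ⟨fun _ _ => rfl, fun _ _ => rfl, fun _ _ => rfl, fun _ _ => rfl, fun _ => rfl, fun _ => rfl⟩

theorem Frame.trans {p : Prog} {σ τ ρ : State} (h : Frame p σ τ) (h' : Frame p τ ρ) :
    Frame p σ ρ :=
  ⟨fun x hx => (h'.iv x hx).trans (h.iv x hx), fun x hx => (h'.rv x hx).trans (h.rv x hx),
    fun x hx => (h'.ia x hx).trans (h.ia x hx), fun x hx => (h'.ra x hx).trans (h.ra x hx),
    fun hx => (h'.coins hx).trans (h.coins hx), fun hx => (h'.calls hx).trans (h.calls hx)⟩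

theorem Frame.of_any_le {p q : Prog} (hpq : ∀ f, q.any f = false → p.any f = false) {σ τ : State}
    (h : Frame p σ τ) : Frame q σ τ :=
  ⟨fun x hx => h.iv x (hpq _ hx), fun x hx => h.rv x (hpq _ hx), fun x hx => h.ia x (hpq _ hx),
    fun x hx => h.ra x (hpq _ hx), fun hx => h.coins (hpq _ hx), fun hx => h.calls (hpq _ hx)⟩

theorem Frame.seq_left {p q : Prog} {σ τ : State} (h : Frame p σ τ) : Frame (.seq p q) σ τ :=
  h.of_any_le fun f hf => by simp only [Prog.any, Bool.or_eq_false_iff] at hf; exact hf.1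

theorem Frame.seq_right {p q : Prog} {σ τ : State} (h : Frame q σ τ) : Frame (.seq p q) σ τ :=
  h.of_any_le fun f hf => by simp only [Prog.any, Bool.or_eq_false_iff] at hf; exact hf.2

theorem Frame.branch_left {b : BExp} {p q : Prog} {σ τ : State} (h : Frame p σ τ) :
    Frame (.branch b p q) σ τ :=
  h.of_any_le fun f hf => by simp only [Prog.any, Bool.or_eq_false_iff] at hf; exact hf.1

theorem Frame.branch_right {b : BExp} {p q : Prog} {σ τ : State} (h : Frame q σ τ) :
    Frame (.branch b p q) σ τ :=
  h.of_any_le fun f hf => by simp only [Prog.any, Bool.or_eq_false_iff] at hf; exact hf.2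

theorem Frame.loop {b : BExp} {p : Prog} {σ τ : State} (h : Frame p σ τ) :
    Frame (.loop b p) σ τ :=
  h.of_any_le fun f hf => by simp only [Prog.any, Bool.or_eq_false_iff] at hf; exact hf.2

theorem Frame.setI (σ : State) (x : ℕ) (e : IExp) (k : ℕ) : Frame (.iset x e) σ (σ.setI x k) where
  iv y hy := Function.update_of_ne (fun h => by simp [Prog.writesI, Prog.any, h] at hy) _ _
  rv _ _ := rfl
  ia _ _ := rfl
  ra _ _ := rfl
  coins _ := rfl
  calls _ := rfl

theorem Exec.frame {O : FlowOracle} {ω : ℕ → Bool} {p : Prog} {σ τ : State} {T : ℕ}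
    (h : Exec O ω p σ T τ) : Frame p σ τ := by
  induction h with
  | skip σ => exact .refl _ _
  | iset σ x e => exact .setI _ _ _ _
  | rset σ x e =>
    exact ⟨fun _ _ => rfl, fun y hy => Function.update_of_ne
      (fun h => by simp [Prog.writesR, Prog.any, h] at hy) _ _,
      fun _ _ => rfl, fun _ _ => rfl, fun _ => rfl, fun _ => rfl⟩
  | istore σ a i e =>
    exact ⟨fun _ _ => rfl, fun _ _ => rfl, fun y hy => Function.update_of_ne
      (fun h => by simp [Prog.writesIA, Prog.any, h] at hy) _ _,
      fun _ _ => rfl, fun _ => rfl, fun _ => rfl⟩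
  | rstore σ a i e =>
    exact ⟨fun _ _ => rfl, fun _ _ => rfl, fun _ _ => rfl, fun y hy => Function.update_of_ne
      (fun h => by simp [Prog.writesRA, Prog.any, h] at hy) _ _,
      fun _ => rfl, fun _ => rfl⟩
  | coin σ x =>
    exact ⟨fun y hy => Function.update_of_ne
      (fun h => by simp [Prog.writesI, Prog.any, h] at hy) _ _, fun _ _ => rfl, fun _ _ => rfl,
      fun _ _ => rfl, fun h => by simp [Prog.tosses, Prog.any] at h, fun _ => rfl⟩
  | maxflow σ N M a b c s t f =>
    exact ⟨fun _ _ => rfl, fun _ _ => rfl, fun _ _ => rfl, fun y hy => Function.update_of_ne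
      (fun h => by simp [Prog.writesRA, Prog.any, h] at hy) _ _,
      fun _ => rfl, fun h => by simp [Prog.asks, Prog.any] at h⟩
  | seq _ _ ihp ihq => exact ihp.seq_left.trans ihq.seq_right
  | branch_true _ _ ih => exact ih.branch_left
  | branch_false _ _ ih => exact ih.branch_right
  | loop_done _ => exact .refl _ _
  | loop_step _ _ _ ihp ihl => exact ihp.loop.trans ihl

theorem Exec.coins_mono {O : FlowOracle} {ω : ℕ → Bool} {p : Prog} {σ τ : State} {T : ℕ}
    (h : Exec O ω p σ T τ) : σ.coins ≤ τ.coins := by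
  induction h with
  | seq _ _ ihp ihq => exact ihp.trans ihq
  | branch_true _ _ ih => exact ih
  | branch_false _ _ ih => exact ih
  | loop_step _ _ _ ihp ihl => exact ihp.trans ihl
  | coin σ x => exact Nat.le_succ _
  | _ => exact le_rfl

/-- An execution depends only on those coins of the random tape that it consumes. -/
theorem Exec.congr_tape {O : FlowOracle} {ω ω' : ℕ → Bool} {p : Prog} {σ τ : State} {T : ℕ}
    (h : Exec O ω p σ T τ) (hω : ∀ i, σ.coins ≤ i → i < τ.coins → ω i = ω' i) :
    Exec O ω' p σ T τ := by
  induction h with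
  | skip σ => exact .skip σ
  | iset σ x e => exact .iset σ x e
  | rset σ x e => exact .rset σ x e
  | istore σ a i e => exact .istore σ a i e
  | rstore σ a i e => exact .rstore σ a i e
  | coin σ x =>
    have h : σ.toss ω x = σ.toss ω' x := by
      unfold State.toss
      rw [hω _ le_rfl (Nat.lt_succ_self _)]
    exact h ▸ Exec.coin σ x
  | maxflow σ N M a b c s t f => exact .maxflow σ N M a b c s t f
  | seq hp hq ihp ihq =>
    exact .seq (ihp fun i h1 h2 => hω i h1 (h2.trans_le hq.coins_mono))
      (ihq fun i h1 h2 => hω i (hp.coins_mono.trans h1) h2)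
  | branch_true hb _ ih => exact .branch_true hb (ih hω)
  | branch_false hb _ ih => exact .branch_false hb (ih hω)
  | loop_done hb => exact .loop_done hb
  | loop_step hb hp hq ihp ihq =>
    exact .loop_step hb (ihp fun i h1 h2 => hω i h1 (h2.trans_le hq.coins_mono))
      (ihq fun i h1 h2 => hω i (hp.coins_mono.trans h1) h2)

/-- Total correctness with a time bound: `p` started in `σ` halts after at most `t` steps in a state
that satisfies `Q`. -/
def Run (O : FlowOracle) (ω : ℕ → Bool) (p : Prog) (σ : State) (t : ℕ) (Q : State → Prop) : Prop :=
  ∃ T τ, Exec O ω p σ T τ ∧ T ≤ t ∧ Q τ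

section Run

variable {O : FlowOracle} {ω : ℕ → Bool} {p q : Prog} {σ : State} {t t₁ t₂ : ℕ}
  {P Q : State → Prop}

theorem Run.mono (h : Run O ω p σ t₁ P) (hQ : ∀ τ, P τ → Frame p σ τ → Q τ) (ht : t₁ ≤ t) :
    Run O ω p σ t Q := by
  obtain ⟨T, τ, he, hT, hP⟩ := h
  exact ⟨T, τ, he, hT.trans ht, hQ τ hP he.frame⟩

theorem Run.seq (hp : Run O ω p σ t₁ P) (hq : ∀ τ, P τ → Frame p σ τ → Run O ω q τ t₂ Q)
    (ht : t₁ + t₂ ≤ t) : Run O ω (.seq p q) σ t Q := by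
  obtain ⟨T, τ, he, hT, hP⟩ := hp
  obtain ⟨U, ρ, he', hU, hQ⟩ := hq τ hP he.frame
  exact ⟨T + U, ρ, .seq he he', by omega, hQ⟩

/-- A loop runs correctly if its body preserves an invariant and decreases a variant. -/
theorem Run.loop {b : BExp} (I : State → Prop) (μ : State → ℕ)
    (step : ∀ τ, I τ → b.Holds τ → Run O ω p τ t₁ fun τ' => I τ' ∧ μ τ' < μ τ)
    (hσ : I σ) (hQ : ∀ τ, I τ → ¬ b.Holds τ → Q τ) (ht : μ σ * (t₁ + 1) + 1 ≤ t) :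
    Run O ω (.loop b p) σ t Q := by
  suffices H : ∀ k τ, μ τ ≤ k → I τ → Run O ω (.loop b p) τ (k * (t₁ + 1) + 1) Q from
    (H _ σ le_rfl hσ).mono (fun _ h _ => h) ht
  intro k
  induction k with
  | zero =>
    intro τ hk hI
    by_cases hb : b.Holds τ
    · obtain ⟨_, _, _, _, _, h⟩ := step τ hI hb
      omega
    · exact ⟨1, τ, .loop_done hb, by omega, hQ τ hI hb⟩
  | succ k ih =>
    intro τ hk hI
    by_cases hb : b.Holds τ
    · obtain ⟨T, τ', he, hT, hI', hlt⟩ := step τ hI hb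
      obtain ⟨U, ρ, he', hU, hρ⟩ := ih τ' (by omega) hI'
      refine ⟨T + U + 1, ρ, .loop_step hb he he', ?_, hρ⟩
      rw [Nat.succ_mul]
      omega
    · exact ⟨1, τ, .loop_done hb, by omega, hQ τ hI hb⟩

open Classical in
/-- The final state of a program without loops. -/
noncomputable def Prog.run (O : FlowOracle) (ω : ℕ → Bool) : Prog → State → State
  | .skip, σ => σ
  | .iset x e, σ => σ.setI x (e.eval σ)
  | .rset x e, σ => σ.setR x (e.eval σ)
  | .istore a i e, σ => σ.storeI a (i.eval σ) (e.eval σ)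
  | .rstore a i e, σ => σ.storeR a (i.eval σ) (e.eval σ)
  | .coin x, σ => σ.toss ω x
  | .maxflow N M a b c s t f, σ =>
    σ.callFlow O (σ.readInstance (N.eval σ) (M.eval σ) a b c (s.eval σ) (t.eval σ)) f
  | .seq p q, σ => q.run O ω (p.run O ω σ)
  | .branch b p q, σ => if b.Holds σ then p.run O ω σ else q.run O ω σ
  | .loop _ _, σ => σ

/-- An upper bound for the running time of a program without loops. -/
def Prog.size : Prog → ℕ
  | .seq p q => p.size + q.size
  | .branch _ p q => p.size + q.size + 1
  | _ => 1

theorem Exec.straight (hp : p.straight = true) (σ : State) :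
    ∃ T ≤ p.size, Exec O ω p σ T (p.run O ω σ) := by
  induction p generalizing σ with
  | seq p q ihp ihq =>
    simp only [Prog.straight, Prog.any, Bool.not_or, Bool.and_eq_true] at hp ihp ihq
    obtain ⟨T, hT, he⟩ := ihp hp.1 σ
    obtain ⟨U, hU, he'⟩ := ihq hp.2 (p.run O ω σ)
    exact ⟨T + U, add_le_add hT hU, .seq he he'⟩
  | branch b p q ihp ihq =>
    simp only [Prog.straight, Prog.any, Bool.not_or, Bool.and_eq_true] at hp ihp ihq
    by_cases hb : b.Holds σ
    · obtain ⟨T, hT, he⟩ := ihp hp.1 σ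
      refine ⟨T + 1, by simp only [Prog.size]; omega, ?_⟩
      rw [Prog.run, if_pos hb]
      exact .branch_true hb he
    · obtain ⟨T, hT, he⟩ := ihq hp.2 σ
      refine ⟨T + 1, by simp only [Prog.size]; omega, ?_⟩
      rw [Prog.run, if_neg hb]
      exact .branch_false hb he
  | loop b p _ => simp [Prog.straight, Prog.any] at hp
  | skip => exact ⟨1, le_rfl, .skip σ⟩
  | iset x e => exact ⟨1, le_rfl, .iset σ x e⟩
  | rset x e => exact ⟨1, le_rfl, .rset σ x e⟩
  | istore a i e => exact ⟨1, le_rfl, .istore σ a i e⟩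
  | rstore a i e => exact ⟨1, le_rfl, .rstore σ a i e⟩
  | coin x => exact ⟨1, le_rfl, .coin σ x⟩
  | maxflow N M a b c s t f => exact ⟨1, le_rfl, .maxflow σ N M a b c s t f⟩

theorem Run.straight (hp : p.straight = true) (ht : p.size ≤ t) (hQ : Q (p.run O ω σ)) :
    Run O ω p σ t Q := by
  obtain ⟨T, hT, he⟩ := Exec.straight (O := O) (ω := ω) hp σ
  exact ⟨T, _, he, hT.trans ht, hQ⟩

/-- The counting loop `for x = 0, …, bnd - 1 do p`. -/
def Prog.forLoop (x : ℕ) (bnd : IExp) (p : Prog) : Prog :=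
  .seq (.iset x (.lit 0)) (.loop (.ilt (.var x) bnd) (.seq p (.iset x (.succ (.var x)))))

/-- Induction along a counting loop; `I i` is what holds when the loop variable has just received
the value `i`. What the loop does not write is provided by the frame condition. -/
theorem Run.forLoop {x : ℕ} {bnd : IExp} (N : ℕ) (I : ℕ → State → Prop)
    (hx : p.writesI x = false)
    (hbnd : ∀ τ, Frame (.forLoop x bnd p) σ τ → bnd.eval τ = N)
    (h0 : I 0 (σ.setI x 0))
    (step : ∀ i < N, ∀ τ, Frame (.forLoop x bnd p) σ τ → τ.iv x = i → I i τ →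
      Run O ω p τ t₁ fun τ' => I (i + 1) (τ'.setI x (i + 1)))
    (hQ : ∀ τ, Frame (.forLoop x bnd p) σ τ → I N τ → Q τ) (ht : N * (t₁ + 2) + 2 ≤ t) :
    Run O ω (.forLoop x bnd p) σ t Q := by
  have hset : ∀ τ k, Frame (.forLoop x bnd p) τ (τ.setI x k) := fun τ k =>
    (Frame.setI τ x (.lit 0) k).seq_left
  refine Run.seq (t₁ := 1) (t₂ := N * (t₁ + 2) + 1)
    (P := fun τ => τ = σ.setI x 0) ⟨1, _, .iset σ x _, le_rfl, rfl⟩ ?_ (by omega)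
  rintro _ rfl -
  refine Run.loop (t₁ := t₁ + 1)
    (fun τ => I (τ.iv x) τ ∧ τ.iv x ≤ N ∧ Frame (.forLoop x bnd p) σ τ)
    (fun τ => N - τ.iv x) ?_ ⟨by simpa [State.setI] using h0, by simp [State.setI], hset _ _⟩ ?_
    (by simp [State.setI])
  · rintro τ ⟨hI, hle, hF⟩ hb
    have hlt : τ.iv x < N := by
      have := hbnd τ hF
      simpa [BExp.Holds, IExp.eval, this] using hb
    obtain ⟨T, τ', he, hT, h'⟩ := step _ hlt τ hF rfl hI
    have hτ' : τ'.iv x = τ.iv x := he.frame.iv x hx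
    refine ⟨T + 1, τ'.setI x (τ.iv x + 1), .seq he ?_, by omega, ?_⟩
    · have := Exec.iset (O := O) (ω := ω) τ' x (.succ (.var x))
      rwa [show (IExp.succ (.var x)).eval τ' = τ.iv x + 1 by simp [IExp.eval, hτ']] at this
    · have hv : (τ'.setI x (τ.iv x + 1)).iv x = τ.iv x + 1 := by simp [State.setI]
      refine ⟨⟨by rwa [hv], by omega, ?_⟩, by omega⟩
      exact (hF.trans he.frame.seq_left.loop.seq_right).trans (hset _ _)
  · rintro τ ⟨hI, hle, hF⟩ hb
    have heq : τ.iv x = N := by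
      have := hbnd τ hF
      simp [BExp.Holds, IExp.eval, this] at hb
      omega
    exact hQ τ hF (heq ▸ hI)

end Run

end RAM

/-! ### Cuts -/

namespace WGraph

/-- The edge with endpoints `x` and `y` crosses the boundary of `Z`. -/
def Crosses (Z : Set ℕ) (x y : ℕ) : Prop := ¬ (x ∈ Z ↔ y ∈ Z)

open Classical in
/-- The weight of the boundary of an arbitrary set of numbers; those that are not vertices do not
matter. -/
noncomputable def cut (G : WGraph) (Z : Set ℕ) : ℝ :=
  ∑ e, if Crosses Z (G.src e) (G.dst e) then G.wt e else 0

variable {G : WGraph} {s v : ℕ}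

theorem cutWeight_eq_cut (G : WGraph) (S : Finset ℕ) : G.cutWeight S = G.cut S := by
  unfold cutWeight cut
  refine Finset.sum_congr rfl fun e _ => ?_
  by_cases h1 : G.src e ∈ S <;> by_cases h2 : G.dst e ∈ S <;> simp [Crosses, h1, h2]

theorem cut_congr (hG : G.WF) {Z Z' : Set ℕ} (h : ∀ x < G.n, x ∈ Z ↔ x ∈ Z') :
    G.cut Z = G.cut Z' := by
  classical
  unfold cut
  refine Finset.sum_congr rfl fun e _ => ?_
  have h1 := h _ (hG e).1
  have h2 := h _ (hG e).2.1
  exact if_congr (not_congr (iff_congr h1 h2)) rfl rfl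

theorem cut_compl (G : WGraph) (Z : Set ℕ) : G.cut Zᶜ = G.cut Z := by
  unfold cut
  refine Finset.sum_congr rfl fun e _ => ?_
  by_cases h1 : G.src e ∈ Z <;> by_cases h2 : G.dst e ∈ Z <;> simp [Crosses, h1, h2]

theorem cut_submodular (hG : G.WF) (A B : Set ℕ) :
    G.cut (A ∩ B) + G.cut (A ∪ B) ≤ G.cut A + G.cut B := by
  unfold cut
  rw [← Finset.sum_add_distrib, ← Finset.sum_add_distrib]
  refine Finset.sum_le_sum fun e _ => ?_
  have := (hG e).2.2
  by_cases h1 : G.src e ∈ A <;> by_cases h2 : G.dst e ∈ A <;> by_cases h3 : G.src e ∈ B <;>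
    by_cases h4 : G.dst e ∈ B <;> simp [Crosses, h1, h2, h3, h4, this]

theorem cut_posimodular (hG : G.WF) (A B : Set ℕ) :
    G.cut (A \ B) + G.cut (B \ A) ≤ G.cut A + G.cut B := by
  have := cut_submodular hG A Bᶜ
  rwa [cut_compl, ← cut_compl G (A ∪ Bᶜ), Set.compl_union, compl_compl, Set.inter_comm Aᶜ] at this

theorem mincut_le_cut (hG : G.WF) (hv : v < G.n) {S : Set ℕ} (hvS : v ∈ S) (hsS : s ∉ S) :
    G.mincut s v ≤ G.cut S := by
  classical
  have h : G.cut S = G.cutWeight ((Finset.range G.n).filter (· ∈ S)) := by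
    rw [cutWeight_eq_cut]
    exact cut_congr hG fun x hx => by simp [hx]
  rw [h]
  refine csInf_le ?_ ⟨_, Finset.filter_subset _ _, by simp [hv, hvS], by simp [hsS], rfl⟩
  refine ⟨0, ?_⟩
  rintro _ ⟨S, _, _, _, rfl⟩
  refine Finset.sum_nonneg fun e _ => ?_
  split_ifs
  exacts [(hG e).2.2, le_rfl]

theorem exists_minSide (hG : G.WF) (hv : v < G.n) (hvs : v ≠ s) :
    ∃ M : Finset ℕ, M ⊆ Finset.range G.n ∧ v ∈ M ∧ s ∉ M ∧ G.cut M = G.mincut s v ∧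
      ∀ S : Set ℕ, v ∈ S → s ∉ S → G.cut S ≤ G.mincut s v → (M : Set ℕ) ⊆ S := by
  classical
  set F := (Finset.range G.n).powerset.filter fun S => v ∈ S ∧ s ∉ S with hF
  have hne : F.Nonempty := ⟨{v}, by simp [hF, hv, hvs.symm]⟩
  obtain ⟨A, hA, hmin⟩ := Finset.exists_min_image F (fun S => G.cut S) hne
  have hAmin : G.cut A = G.mincut s v := by
    simp only [hF, Finset.mem_filter, Finset.mem_powerset] at hA hmin
    refine le_antisymm (le_csInf ⟨_, A, hA.1, hA.2.1, hA.2.2, rfl⟩ ?_)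
      (mincut_le_cut hG hv (by simpa using hA.2.1) (by simpa using hA.2.2))
    rintro _ ⟨S, h1, h2, h3, rfl⟩
    rw [cutWeight_eq_cut]
    exact hmin S ⟨h1, h2, h3⟩
  obtain ⟨M, hM, hcard⟩ := Finset.exists_min_image
    (F.filter fun S : Finset ℕ => G.cut S = G.mincut s v) Finset.card ⟨A, by simp [hA, hAmin]⟩
  simp only [hF, Finset.mem_filter, Finset.mem_powerset] at hM hcard
  obtain ⟨⟨hMn, hvM, hsM⟩, hMmin⟩ := hM
  refine ⟨M, hMn, hvM, hsM, hMmin, fun S hvS hsS hS x hx => ?_⟩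
  have hi : G.cut (M.filter (· ∈ S)) = G.mincut s v := by
    have h1 := cut_submodular hG (M : Set ℕ) S
    have h2 : G.mincut s v ≤ G.cut ((M : Set ℕ) ∪ S) :=
      mincut_le_cut hG hv (Or.inr hvS) (by simp [hsM, hsS])
    have h3 : G.mincut s v ≤ G.cut ((M : Set ℕ) ∩ S) :=
      mincut_le_cut hG hv ⟨by simpa using hvM, hvS⟩ (by simp [hsM])
    have h4 : ((M.filter (· ∈ S) : Finset ℕ) : Set ℕ) = (M : Set ℕ) ∩ S := by ext; simp
    rw [h4]
    linarith
  have h := hcard (M.filter (· ∈ S))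
    ⟨⟨(Finset.filter_subset _ _).trans hMn, by simp [hvM, hvS], by simp [hsM]⟩, hi⟩
  have h' := Finset.eq_of_subset_of_card_le (Finset.filter_subset (· ∈ S) M) h
  rw [← h'] at hx
  exact (Finset.mem_filter.1 hx).2

open Classical in
/-- The smallest side of a minimum cut that separates `v` from `s`. (It is `∅` if `v` is not a vertex
or `v = s`.) -/
noncomputable def minSide (G : WGraph) (s v : ℕ) : Finset ℕ :=
  if h : G.WF ∧ v < G.n ∧ v ≠ s then (exists_minSide h.1 h.2.1 h.2.2).choose else ∅

theorem minSide_spec (hG : G.WF) (hv : v < G.n) (hvs : v ≠ s) :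
    G.minSide s v ⊆ Finset.range G.n ∧ v ∈ G.minSide s v ∧ s ∉ G.minSide s v ∧
      G.cut (G.minSide s v) = G.mincut s v ∧
      ∀ S : Set ℕ, v ∈ S → s ∉ S → G.cut S ≤ G.mincut s v → (G.minSide s v : Set ℕ) ⊆ S := by
  rw [minSide, dif_pos ⟨hG, hv, hvs⟩]
  exact (exists_minSide hG hv hvs).choose_spec

/-- The smallest sides of minimum cuts form a laminar family: if neither of `v` and `v'` lies on the
side of the other one, then the two sides are disjoint. -/
theorem disjoint_minSide (hG : G.WF) {v' : ℕ} (hv : v < G.n) (hvs : v ≠ s) (hv' : v' < G.n)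
    (hvs' : v' ≠ s) (h : v ∉ G.minSide s v') (h' : v' ∉ G.minSide s v) :
    Disjoint (G.minSide s v) (G.minSide s v') := by
  obtain ⟨-, hvM, hsM, hM, hmin⟩ := minSide_spec hG hv hvs
  obtain ⟨-, hvM', hsM', hM', -⟩ := minSide_spec hG hv' hvs'
  have h1 := cut_posimodular hG (G.minSide s v : Set ℕ) (G.minSide s v')
  have h2 : G.mincut s v' ≤ G.cut ((G.minSide s v' : Set ℕ) \ G.minSide s v) :=
    mincut_le_cut hG hv' ⟨by simpa using hvM', by simpa using h'⟩ fun h => hsM' (by simpa using h.1)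
  have h3 := hmin ((G.minSide s v : Set ℕ) \ G.minSide s v') ⟨by simpa using hvM, by simpa using h⟩
    (fun h => hsM (by simpa using h.1)) (by linarith)
  rw [Finset.disjoint_left]
  intro u hu
  have := (h3 (by simpa using hu)).2
  simpa using this

/-- All vertices on the smallest side for `v` are separated from `s` by a cut of the same weight. -/
theorem mincut_le_of_mem_minSide (hG : G.WF) (hv : v < G.n) (hvs : v ≠ s) {u : ℕ}
    (hu : u ∈ G.minSide s v) : u < G.n ∧ u ≠ s ∧ G.mincut s u ≤ G.mincut s v := by
  obtain ⟨hn, hvM, hsM, hM, hmin⟩ := minSide_spec hG hv hvs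
  have hun : u < G.n := by simpa using hn hu
  refine ⟨hun, fun h => hsM (h ▸ hu), ?_⟩
  rw [← hM]
  exact mincut_le_cut hG hun (by simpa using hu) (by simpa using hsM)

end WGraph

/-! ### The sources of the residual graph of a maximum flow form a minimum cut -/

namespace FlowInstance

/-- The arcs of the residual graph of `f`. -/
def Residual (I : FlowInstance) (f : Fin I.m → ℝ) (x y : ℕ) : Prop :=
  ∃ e, (I.src e = x ∧ I.dst e = y ∧ f e < I.wt e) ∨ (I.dst e = x ∧ I.src e = y ∧ 0 < I.wt e + f e)

variable {I : FlowInstance} {f : Fin I.m → ℝ}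

theorem netOut_add (g : Fin I.m → ℝ) (x : ℕ) : I.netOut (f + g) x = I.netOut f x + I.netOut g x := by
  unfold netOut
  rw [← Finset.sum_add_distrib]
  refine Finset.sum_congr rfl fun e _ => ?_
  simp only [Pi.add_apply]
  split_ifs <;> ring

theorem netOut_smul (r : ℝ) (x : ℕ) : I.netOut (r • f) x = r * I.netOut f x := by
  unfold netOut
  rw [Finset.mul_sum]
  refine Finset.sum_congr rfl fun e _ => ?_
  simp only [Pi.smul_apply, smul_eq_mul]
  split_ifs <;> ring

theorem netOut_single (e : Fin I.m) (r : ℝ) (x : ℕ) : I.netOut (Pi.single e r) x =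
    (if I.src e = x then r else 0) - (if I.dst e = x then r else 0) := by
  unfold netOut
  rw [Finset.sum_eq_single e]
  · simp
  · intro e' _ he
    simp [he]
  · simp

/-- Along a walk in the residual graph one can send a unit of flow. Where the walk uses an edge in
both directions the flow cancels, so that the walk need not be a path. -/
theorem exists_unit_flow {x : ℕ} (h : Relation.ReflTransGen (I.Residual f) I.s x) :
    ∃ g : Fin I.m → ℝ,
      (∀ y, I.netOut g y = (if y = I.s then 1 else 0) - (if y = x then 1 else 0)) ∧
      ∀ e, (0 < g e → f e < I.wt e) ∧ (g e < 0 → 0 < I.wt e + f e) := by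
  classical
  induction h with
  | refl => exact ⟨0, fun y => by simp [netOut], fun e => by simp⟩
  | @tail x z _ hxz ih =>
    obtain ⟨g, hg, hgr⟩ := ih
    obtain ⟨e, ⟨rfl, rfl, hlt⟩ | ⟨rfl, rfl, hlt⟩⟩ := hxz
    · refine ⟨g + Pi.single e 1, fun y => ?_, fun e' => ?_⟩
      · rw [netOut_add, netOut_single, hg]
        simp only [eq_comm (b := y)]
        ring
      · by_cases he : e' = e
        · subst he
          refine ⟨fun _ => hlt, fun h => (hgr e').2 ?_⟩
          simp at h
          linarith
        · simpa [Pi.single_apply, he] using hgr e'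
    · refine ⟨g + Pi.single e (-1), fun y => ?_, fun e' => ?_⟩
      · rw [netOut_add, netOut_single, hg]
        simp only [eq_comm (b := y)]
        split_ifs <;> ring
      · by_cases he : e' = e
        · subst he
          refine ⟨fun h => (hgr e').1 ?_, fun _ => hlt⟩
          simp at h
          linarith
        · simpa [Pi.single_apply, he] using hgr e'

/-- A maximum flow admits no augmenting walk. -/
theorem IsMaxFlow.not_reachable (hI : I.Valid) (hf : I.IsMaxFlow f) :
    ¬ Relation.ReflTransGen (I.Residual f) I.s I.t := by
  intro h
  obtain ⟨g, hg, hgr⟩ := exists_unit_flow h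
  -- a small multiple of the unit flow fits into the residual capacities
  obtain ⟨ε, hε, hfit⟩ : ∃ ε > 0, ∀ e, |f e + ε * g e| ≤ I.wt e := by
    have H : ∀ e, ∃ δ > 0, ∀ ε, 0 < ε → ε ≤ δ → |f e + ε * g e| ≤ I.wt e := by
      intro e
      have hfe := abs_le.1 (hf.1.1 e)
      rcases lt_trichotomy (g e) 0 with hneg | h0 | hpos
      · have hr := (hgr e).2 hneg
        refine ⟨(I.wt e + f e) / (- g e), div_pos hr (by linarith), fun ε h1 h2 => ?_⟩
        rw [le_div_iff₀ (by linarith)] at h2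
        have : ε * g e ≤ 0 := by nlinarith
        exact abs_le.2 ⟨by nlinarith, by linarith⟩
      · exact ⟨1, one_pos, fun ε _ _ => by simpa [h0] using hf.1.1 e⟩
      · have hr := (hgr e).1 hpos
        refine ⟨(I.wt e - f e) / g e, div_pos (by linarith) hpos, fun ε h1 h2 => ?_⟩
        rw [le_div_iff₀ hpos] at h2
        have : 0 ≤ ε * g e := by positivity
        exact abs_le.2 ⟨by linarith, by linarith⟩
    choose δ hδ hδ' using H
    by_cases hm : Nonempty (Fin I.m)
    · obtain ⟨e₀, -, he₀⟩ := Finset.exists_min_image Finset.univ δ Finset.univ_nonempty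
      exact ⟨δ e₀, hδ e₀, fun e => hδ' e _ (hδ e₀) (he₀ e (Finset.mem_univ e))⟩
    · exact ⟨1, one_pos, fun e => absurd ⟨e⟩ hm⟩
  have hflow : I.IsFlow (f + ε • g) := by
    refine ⟨fun e => by simpa using hfit e, fun x hx hxs hxt => ?_⟩
    rw [netOut_add, netOut_smul, hf.1.2 x hx hxs hxt, hg]
    simp [hxs, hxt]
  have := hf.2 _ hflow
  rw [netOut_add, netOut_smul, hg] at this
  simp [hI.2.2.2] at this
  linarith

/-- The value of a flow, measured at a cut. -/
theorem IsFlow.netOut_eq (hf : I.IsFlow f) {Z : Finset ℕ}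
    (hZ : Z ⊆ Finset.range I.n) (hs : I.s ∈ Z) (ht : I.t ∉ Z) :
    I.netOut f I.s =
      ∑ e, ((if I.src e ∈ Z then f e else 0) - (if I.dst e ∈ Z then f e else 0)) := by
  have h : I.netOut f I.s = ∑ x ∈ Z, I.netOut f x := by
    rw [Finset.sum_eq_single I.s]
    · intro x hx hxs
      exact hf.2 x (by simpa using hZ hx) hxs fun h => ht (h ▸ hx)
    · exact fun h => absurd hs h
  rw [h]
  unfold netOut
  rw [Finset.sum_comm]
  refine Finset.sum_congr rfl fun e _ => ?_
  rw [Finset.sum_sub_distrib]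
  simp

/-- The set of vertices reachable in the residual graph of a maximum flow is a minimum cut. -/
theorem IsMaxFlow.cut_le (hI : I.Valid) (hf : I.IsMaxFlow f) {Z : Set ℕ}
    (hZ : ∀ x, x ∈ Z ↔ Relation.ReflTransGen (I.Residual f) I.s x) {Z' : Set ℕ} (hs : I.s ∈ Z')
    (ht : I.t ∉ Z') : I.cut Z ≤ I.cut Z' := by
  classical
  have hval : ∀ Y : Set ℕ, I.s ∈ Y → I.t ∉ Y → I.netOut f I.s =
      ∑ e, ((if I.src e ∈ Y then f e else 0) - (if I.dst e ∈ Y then f e else 0)) := by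
    intro Y hs ht
    rw [hf.1.netOut_eq (Z := (Finset.range I.n).filter (· ∈ Y)) (Finset.filter_subset _ _)
      (by simp [hI.2.1, hs]) (by simp [ht])]
    refine Finset.sum_congr rfl fun e _ => ?_
    simp [(hI.1 e).1, (hI.1 e).2.1]
  have h1 := hval Z ((hZ _).2 .refl) fun h => hf.not_reachable hI ((hZ _).1 h)
  have h2 := hval Z' hs ht
  have h3 : I.cut Z = I.netOut f I.s := by
    rw [h1]
    unfold WGraph.cut
    refine Finset.sum_congr rfl fun e _ => ?_
    have hfe := abs_le.1 (hf.1.1 e)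
    by_cases ha : I.src e ∈ Z <;> by_cases hb : I.dst e ∈ Z
    · simp [WGraph.Crosses, ha, hb]
    · have : ¬ f e < I.wt e := fun h =>
        hb ((hZ _).2 (((hZ _).1 ha).tail ⟨e, Or.inl ⟨rfl, rfl, h⟩⟩))
      simp [WGraph.Crosses, ha, hb]
      linarith
    · have : ¬ 0 < I.wt e + f e := fun h =>
        ha ((hZ _).2 (((hZ _).1 hb).tail ⟨e, Or.inr ⟨rfl, rfl, h⟩⟩))
      simp [WGraph.Crosses, ha, hb]
      linarith
    · simp [WGraph.Crosses, ha, hb]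
  rw [h3, h2]
  unfold WGraph.cut
  refine Finset.sum_le_sum fun e _ => ?_
  have hfe := abs_le.1 (hf.1.1 e)
  by_cases ha : I.src e ∈ Z' <;> by_cases hb : I.dst e ∈ Z' <;> simp [WGraph.Crosses, ha, hb] <;>
    linarith

end FlowInstance

/-! ### Graph search -/

namespace RAM

/-- `A` arcs, the `k`-th of which leads from `tl k` to `hd k`, are stored in linked lists, one for
each tail: `first v = k + 1` if `k` is the first arc of the list of `v`, `nxt k = k' + 1` if `k'`
follows `k`, and `0` marks the end of a list. The numbers decrease along each list; so the arcs of
`v` that have not been passed by `first v` are just those with a number below `first v`. -/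
structure ArcLists (N A : ℕ) (tl hd nxt first : ℕ → ℕ) : Prop where
  lt_vertices : ∀ k < A, tl k < N ∧ hd k < N
  nxt_le : ∀ k < A, nxt k ≤ k
  tl_nxt : ∀ k < A, nxt k = 0 ∨ tl (nxt k - 1) = tl k
  lt_nxt : ∀ k < A, ∀ k' < k, tl k' = tl k → k' < nxt k
  tl_first : ∀ v < N, first v = 0 ∨ first v ≤ A ∧ tl (first v - 1) = v
  lt_first : ∀ k < A, k < first (tl k)

theorem ArcLists.push {N A : ℕ} {tl hd nxt first : ℕ → ℕ} (h : ArcLists N A tl hd nxt first)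
    {x y : ℕ} (hx : x < N) (hy : y < N) :
    ArcLists N (A + 1) (Function.update tl A x) (Function.update hd A y)
      (Function.update nxt A (first x)) (Function.update first x (A + 1)) := by
  have hne : ∀ k < A, k ≠ A := fun k hk => hk.ne
  have hcases : ∀ k < A + 1, k < A ∨ k = A := fun k hk => by omega
  refine ⟨?_, ?_, ?_, ?_, ?_, ?_⟩
  · intro k hk
    rcases hcases k hk with hk | rfl
    · simpa [hne k hk] using h.lt_vertices k hk
    · simp [hx, hy]
  · intro k hk
    rcases hcases k hk with hk | rfl
    · simpa [hne k hk] using h.nxt_le k hk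
    · have := h.tl_first x hx
      simp
      omega
  · intro k hk
    rcases hcases k hk with hk | rfl
    · have h1 := h.nxt_le k hk
      have h2 := h.tl_nxt k hk
      have h3 : nxt k - 1 ≠ A := by omega
      simpa [hne k hk, h3] using h2
    · rcases h.tl_first x hx with h1 | ⟨h1, h2⟩
      · simp [h1]
      · by_cases h0 : first x = 0
        · simp [h0]
        · have h3 : first x - 1 ≠ k := by omega
          simp [h3, h2]
  · intro k hk k' hk'
    rcases hcases k hk with hk | rfl
    · simpa [hne k hk, hne k' (hk'.trans hk)] using h.lt_nxt k hk k' hk'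
    · have h1 := h.lt_first k' hk'
      simp only [Function.update_self, Function.update_of_ne (hne k' hk')]
      rintro rfl
      exact h1
  · intro v hv
    by_cases hvx : v = x
    · subst hvx
      simp
    · rcases h.tl_first v hv with h1 | ⟨h1, h2⟩
      · simp [hvx, h1]
      · by_cases h0 : first v = 0
        · simp [hvx, h0]
        · have h3 : first v - 1 ≠ A := by omega
          simp [hvx, h3, h2, Nat.le_succ_of_le h1]
  · intro k hk
    rcases hcases k hk with hk | rfl
    · have h1 := h.lt_first k hk
      by_cases hkx : tl k = x
      · simp [hne k hk, hkx]
        omega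
      · simpa [hne k hk, hkx] using h1
    · simp

/-- The invariant of the graph search: `first` marks how far the lists have been scanned, `vis` the
vertices that have been found, and `stk 0, …, stk (p - 1)` is the stack, which contains all vertices
whose lists have not been scanned to the end. -/
structure SearchInv (N A : ℕ) (tl hd nxt : ℕ → ℕ) (a : ℕ) (first vis stk : ℕ → ℕ) (p : ℕ) :
    Prop where
  sound : ∀ x < N, vis x ≠ 0 →
    Relation.ReflTransGen (fun u w => ∃ k < A, tl k = u ∧ hd k = w) a x
  start : vis a ≠ 0
  stack : ∀ i < p, stk i < N ∧ vis (stk i) ≠ 0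
  done : ∀ v < N, vis v ≠ 0 → (∃ i < p, stk i = v) ∨ first v = 0
  scanned : ∀ k < A, first (tl k) ≤ k → vis (hd k) ≠ 0
  tl_first : ∀ v < N, first v = 0 ∨ first v ≤ A ∧ tl (first v - 1) = v

/-- The variant of the graph search. -/
def searchVariant (N A : ℕ) (tl : ℕ → ℕ) (first vis : ℕ → ℕ) (p : ℕ) : ℕ :=
  ((Finset.range A).filter fun k => k < first (tl k)).card + p +
    ((Finset.range N).filter fun v => vis v = 0).card

namespace SearchInv

variable {N A a p : ℕ} {tl hd nxt first vis stk : ℕ → ℕ}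

theorem init (hA : ArcLists N A tl hd nxt first) (ha : a < N) (hvis : ∀ x < N, vis x = 0) :
    SearchInv N A tl hd nxt a first (Function.update vis a 1) (Function.update stk 0 a) 1 where
  sound x hx hv := by
    by_cases hxa : x = a
    · exact hxa ▸ .refl
    · simp [hxa, hvis x hx] at hv
  start := by simp
  stack i hi := by
    obtain rfl : i = 0 := by omega
    simp [ha]
  done v hv hvv := by
    by_cases hva : v = a
    · exact Or.inl ⟨0, by omega, by simp [hva]⟩
    · simp [hva, hvis v hv] at hvv
  scanned k hk h := by
    have := hA.lt_first k hk
    omega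
  tl_first := hA.tl_first

theorem pop (h : SearchInv N A tl hd nxt a first vis stk p) (h0 : first (stk (p - 1)) = 0) :
    SearchInv N A tl hd nxt a first vis stk (p - 1) where
  sound := h.sound
  start := h.start
  stack i hi := h.stack i (by omega)
  done v hv hvv := by
    rcases h.done v hv hvv with ⟨i, hi, rfl⟩ | h1
    · by_cases hip : i = p - 1
      · exact Or.inr (hip ▸ h0)
      · exact Or.inl ⟨i, by omega, rfl⟩
    · exact Or.inr h1
  scanned := h.scanned
  tl_first := h.tl_first

/-- The next arc in the list of the vertex on top of the stack. -/
theorem top (h : SearchInv N A tl hd nxt a first vis stk p) (hp : 0 < p)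
    (h0 : first (stk (p - 1)) ≠ 0) :
    first (stk (p - 1)) - 1 < A ∧ tl (first (stk (p - 1)) - 1) = stk (p - 1) := by
  have h1 := h.stack (p - 1) (by omega)
  have h2 := h.tl_first _ h1.1
  exact ⟨by omega, (h2.resolve_left h0).2⟩

theorem advance (hA : ArcLists N A tl hd nxt first₀)
    (h : SearchInv N A tl hd nxt a first vis stk p) {k : ℕ}
    (hk : k < A) (hfk : first (tl k) = k + 1) (hvis : vis (hd k) ≠ 0) :
    SearchInv N A tl hd nxt a (Function.update first (tl k) (nxt k)) vis stk p where
  sound := h.sound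
  start := h.start
  stack := h.stack
  done v hv hvv := by
    rcases h.done v hv hvv with h1 | h1
    · exact Or.inl h1
    · refine Or.inr ?_
      have : v ≠ tl k := by rintro rfl; omega
      simp [this, h1]
  scanned k' hk' h1 := by
    by_cases hkk : k' = k
    · exact hkk ▸ hvis
    · by_cases ht : tl k' = tl k
      · rw [ht, Function.update_self] at h1
        refine h.scanned k' hk' ?_
        rw [ht, hfk]
        by_contra hlt
        have := hA.lt_nxt k hk k' (by omega) ht
        omega
      · rw [Function.update_of_ne ht] at h1
        exact h.scanned k' hk' h1
  tl_first v hv := by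
    by_cases ht : v = tl k
    · subst ht
      have h1 := hA.nxt_le k hk
      have h2 := hA.tl_nxt k hk
      simp only [Function.update_self]
      omega
    · simpa [ht] using h.tl_first v hv

theorem push (h : SearchInv N A tl hd nxt a first vis stk p) {k : ℕ} (hk : k < A)
    (hlt : tl k < N ∧ hd k < N) (hvis : vis (tl k) ≠ 0) :
    SearchInv N A tl hd nxt a first (Function.update vis (hd k) 1)
      (Function.update stk p (hd k)) (p + 1) where
  sound x hx hv := by
    by_cases hxa : x = hd k
    · exact hxa ▸ (h.sound _ hlt.1 hvis).tail ⟨k, hk, rfl, rfl⟩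
    · exact h.sound x hx (by simpa [hxa] using hv)
  start := by
    by_cases hxa : a = hd k
    · simp [hxa]
    · simpa [hxa] using h.start
  stack i hi := by
    by_cases hip : i = p
    · simp [hip, hlt.2]
    · have := h.stack i (by omega)
      by_cases hxa : stk i = hd k
      · simp [hip, hxa, hlt.2]
      · simpa [hip, hxa] using this
  done v hv hvv := by
    by_cases hva : v = hd k
    · exact Or.inl ⟨p, by omega, by simp [hva]⟩
    · rcases h.done v hv (by simpa [hva] using hvv) with ⟨i, hi, rfl⟩ | h1
      · exact Or.inl ⟨i, by omega, by simp [hi.ne]⟩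
      · exact Or.inr h1
  scanned k' hk' h1 := by
    by_cases hva : hd k' = hd k
    · simp [hva]
    · simpa [hva] using h.scanned k' hk' h1
  tl_first := h.tl_first

theorem vis_iff (h : SearchInv N A tl hd nxt a first vis stk 0)
    (hlt : ∀ k < A, tl k < N ∧ hd k < N) {x : ℕ} (hx : x < N) :
    vis x ≠ 0 ↔ Relation.ReflTransGen (fun u w => ∃ k < A, tl k = u ∧ hd k = w) a x := by
  refine ⟨h.sound x hx, fun hr => ?_⟩
  clear hx
  induction hr with
  | refl => exact h.start
  | tail _ hs ih =>
    obtain ⟨k, hk, rfl, rfl⟩ := hs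
    refine h.scanned k hk ?_
    have := (h.done _ (hlt k hk).1 ih).resolve_left (by simp)
    omega

end SearchInv

theorem searchVariant_advance {N A k p : ℕ} {tl nxt first vis : ℕ → ℕ} (hk : k < A)
    (hfk : first (tl k) = k + 1) (hn : nxt k ≤ k) :
    searchVariant N A tl (Function.update first (tl k) (nxt k)) vis p <
      searchVariant N A tl first vis p := by
  unfold searchVariant
  have : ((Finset.range A).filter fun j => j < Function.update first (tl k) (nxt k) (tl j)).card <
      ((Finset.range A).filter fun j => j < first (tl j)).card := by
    refine Finset.card_lt_card (Finset.ssubset_iff_of_subset ?_ |>.2 ⟨k, ?_, ?_⟩)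
    · intro j hj
      simp only [Finset.mem_filter] at hj ⊢
      refine ⟨hj.1, ?_⟩
      by_cases ht : tl j = tl k
      · have := hj.2
        rw [ht, Function.update_self] at this
        rw [ht]
        omega
      · simpa [ht] using hj.2
    · simp [hk, hfk]
    · simp [hn]
  omega

theorem searchVariant_push {N A x p : ℕ} {tl first vis : ℕ → ℕ} (hx : x < N) (hvis : vis x = 0) :
    searchVariant N A tl first (Function.update vis x 1) (p + 1) ≤
      searchVariant N A tl first vis p := by
  unfold searchVariant
  have : ((Finset.range N).filter fun v => Function.update vis x 1 v = 0).card <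
      ((Finset.range N).filter fun v => vis v = 0).card := by
    refine Finset.card_lt_card (Finset.ssubset_iff_of_subset ?_ |>.2 ⟨x, ?_, ?_⟩)
    · intro j hj
      simp only [Finset.mem_filter] at hj ⊢
      refine ⟨hj.1, ?_⟩
      by_cases ht : j = x
      · rw [ht, Function.update_self] at hj
        simp at hj
      · simpa [ht] using hj.2
    · simp [hx, hvis]
    · simp
  omega

/-- Graph search from the vertex `iv 0` along the arcs in the arrays `10`, …, `13`. -/
def search : Prog :=
  .istore 14 (.var 0) (.lit 1) ;;
  .istore 15 (.lit 0) (.var 0) ;;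
  .iset 14 (.lit 1) ;;
  .loop (.ilt (.lit 0) (.var 14))
    (.iset 15 (.arr 15 (.sub (.var 14) (.lit 1))) ;;
     .branch (.ieq (.arr 13 (.var 15)) (.lit 0))
       (.iset 14 (.sub (.var 14) (.lit 1)))
       (.iset 16 (.sub (.arr 13 (.var 15)) (.lit 1)) ;;
        .istore 13 (.var 15) (.arr 12 (.var 16)) ;;
        .iset 16 (.arr 11 (.var 16)) ;;
        .branch (.ieq (.arr 14 (.var 16)) (.lit 0))
          (.istore 14 (.var 16) (.lit 1) ;;
           .istore 15 (.var 14) (.var 16) ;;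
           .iset 14 (.succ (.var 14)))
          .skip))

theorem Run.search {O : FlowOracle} {ω : ℕ → Bool} {σ : State} {N : ℕ}
    (hA : ArcLists N (σ.iv 13) (σ.ia 10) (σ.ia 11) (σ.ia 12) (σ.ia 13)) (hN : σ.iv 0 < N)
    (hvis : ∀ x < N, σ.ia 14 x = 0) :
    Run O ω search σ (12 * (σ.iv 13 + N) + 16) fun τ => ∀ x < N, τ.ia 14 x ≠ 0 ↔
      Relation.ReflTransGen (fun u w => ∃ k < σ.iv 13, σ.ia 10 k = u ∧ σ.ia 11 k = w)
        (σ.iv 0) x := by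
  refine Run.seq (t₂ := 12 * (σ.iv 13 + N) + 15) (.straight rfl le_rfl (Q := (· = _)) rfl) ?_
    (by simp only [Prog.size]; omega)
  rintro _ rfl -
  refine Run.seq (t₂ := 12 * (σ.iv 13 + N) + 14) (.straight rfl le_rfl (Q := (· = _)) rfl) ?_
    (by simp only [Prog.size]; omega)
  rintro _ rfl -
  refine Run.seq (t₂ := 12 * (σ.iv 13 + N) + 13) (.straight rfl le_rfl (Q := (· = _)) rfl) ?_
    (by simp only [Prog.size]; omega)
  rintro _ rfl -
  refine Run.loop (t₁ := 11)
    (fun τ => SearchInv N (σ.iv 13) (σ.ia 10) (σ.ia 11) (σ.ia 12) (σ.iv 0) (τ.ia 13) (τ.ia 14)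
        (τ.ia 15) (τ.iv 14) ∧ τ.ia 11 = σ.ia 11 ∧ τ.ia 12 = σ.ia 12)
    (fun τ => searchVariant N (σ.iv 13) (σ.ia 10) (τ.ia 13) (τ.ia 14) (τ.iv 14)) ?_ ?_ ?_ ?_
  · rintro τ ⟨hI, h11, h12⟩ hb
    have hp : 0 < τ.iv 14 := by simpa [BExp.Holds, IExp.eval] using hb
    refine Run.straight rfl (by simp [Prog.size]) ?_
    by_cases h0 : τ.ia 13 (τ.ia 15 (τ.iv 14 - 1)) = 0
    · simp [Prog.run, IExp.eval, BExp.Holds, State.setI, h0]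
      refine ⟨⟨hI.pop h0, h11, h12⟩, ?_⟩
      simp only [searchVariant]
      omega
    · obtain ⟨hk, htl⟩ := hI.top hp h0
      have hst := hI.stack (τ.iv 14 - 1) (by omega)
      set k := τ.ia 13 (τ.ia 15 (τ.iv 14 - 1)) - 1 with hkdef
      have hfk : τ.ia 13 (σ.ia 10 k) = k + 1 := by rw [htl]; omega
      have hadv := searchVariant_advance (N := N) (p := τ.iv 14) (vis := τ.ia 14) hk hfk
        (hA.nxt_le k hk)
      by_cases h1 : τ.ia 14 (σ.ia 11 k) = 0
      · have hpush := hI.push hk (hA.lt_vertices k hk) (by rw [htl]; exact hst.2)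
        have hpv := searchVariant_push (A := σ.iv 13) (tl := σ.ia 10) (p := τ.iv 14)
          (first := Function.update (τ.ia 13) (σ.ia 10 k) (σ.ia 12 k)) (hA.lt_vertices k hk).2 h1
        have hinv := hpush.advance hA hk hfk (by simp)
        rw [htl] at hinv hpv hadv
        simp [Prog.run, IExp.eval, BExp.Holds, State.setI, State.storeI, h0, h11, h12, ← hkdef, h1]
        exact ⟨hinv, by omega⟩
      · have hinv := hI.advance hA hk hfk h1
        rw [htl] at hinv hadv
        simp [Prog.run, IExp.eval, BExp.Holds, State.setI, State.storeI, h0, h11, h12, ← hkdef, h1]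
        exact ⟨hinv, hadv⟩
  · have := SearchInv.init (stk := σ.ia 15) hA hN hvis
    simpa [Prog.run, IExp.eval, State.setI, State.storeI] using this
  · rintro τ ⟨hI, h11, h12⟩ hb
    have hp : τ.iv 14 = 0 := by simpa [BExp.Holds, IExp.eval] using hb
    rw [hp] at hI
    exact fun x hx => hI.vis_iff hA.lt_vertices hx
  · have h1 : searchVariant N (σ.iv 13) (σ.ia 10) (σ.ia 13) (Function.update (σ.ia 14) (σ.iv 0) 1) 1 ≤
        σ.iv 13 + 1 + N := by
      unfold searchVariant
      gcongr
      · exact (Finset.card_filter_le _ _).trans_eq (Finset.card_range _)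
      · exact (Finset.card_filter_le _ _).trans_eq (Finset.card_range _)
    simp [Prog.run, IExp.eval, State.setI, State.storeI]
    omega

/-! ### Minimum cuts from the black box -/

/-- Append an arc from `x` to `y` to the linked lists. -/
def pushArc (x y : IExp) : Prog :=
  .istore 10 (.var 13) x ;;
  .istore 11 (.var 13) y ;;
  .istore 12 (.var 13) (.arr 13 x) ;;
  .iset 13 (.succ (.var 13)) ;;
  .istore 13 x (.var 13)

/-- Append the residual arcs of the edge number `iv 10`. -/
def pushResidual : Prog :=
  .branch (.not (.rle (.arr 1 (.var 10)) (.arr 2 (.var 10))))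
    (pushArc (.arr 7 (.var 10)) (.arr 8 (.var 10))) .skip ;;
  .branch (.not (.rle (.add (.arr 1 (.var 10)) (.arr 2 (.var 10))) .zero))
    (pushArc (.arr 8 (.var 10)) (.arr 7 (.var 10))) .skip

/-- Build the residual graph of the flow in the real array `2`. -/
def buildResidual : Prog :=
  .iset 13 (.lit 0) ;; .forLoop 10 (.var 12) pushResidual

/-- Determine a minimum cut that separates `n` from `n + 1` in the graph with `n + 2` vertices and
`iv 12` edges that is stored in the integer arrays `7` and `8` and in the real array `1`. The side
of `n` is marked in the integer array `14`. -/
def minCut : Prog :=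
  .maxflow (.succ (.succ (.var 0))) (.var 12) 7 8 1 (.var 0) (.succ (.var 0)) 2 ;;
  .forLoop 10 (.succ (.succ (.var 0)))
    (.istore 13 (.var 10) (.lit 0) ;; .istore 14 (.var 10) (.lit 0)) ;;
  buildResidual ;;
  search

/-- The arrays `10`, …, `13` hold the digraph with vertices below `N` and adjacency relation `r`. -/
def HoldsDigraph (N : ℕ) (r : ℕ → ℕ → Prop) (τ : State) : Prop :=
  ArcLists N (τ.iv 13) (τ.ia 10) (τ.ia 11) (τ.ia 12) (τ.ia 13) ∧
    ∀ u w, (∃ k < τ.iv 13, τ.ia 10 k = u ∧ τ.ia 11 k = w) ↔ r u w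

section

variable {O : FlowOracle} {ω : ℕ → Bool} {σ : State}

theorem HoldsDigraph.pushArc {N a b : ℕ} {r : ℕ → ℕ → Prop} (h : HoldsDigraph N r σ)
    (ha : a < 10) (hb : b < 10) (hx : σ.ia a (σ.iv 10) < N) (hy : σ.ia b (σ.iv 10) < N) :
    HoldsDigraph N (fun u w => r u w ∨ σ.ia a (σ.iv 10) = u ∧ σ.ia b (σ.iv 10) = w)
      ((pushArc (.arr a (.var 10)) (.arr b (.var 10))).run O ω σ) ∧
    ((pushArc (.arr a (.var 10)) (.arr b (.var 10))).run O ω σ).iv 13 = σ.iv 13 + 1 := by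
  have h1 : a ≠ 10 := by omega
  have h2 : a ≠ 11 := by omega
  have h3 : a ≠ 12 := by omega
  have h4 : b ≠ 10 := by omega
  have key := h.1.push hx hy
  refine ⟨⟨?_, fun u w => ?_⟩, ?_⟩
  · simpa [RAM.pushArc, Prog.run, IExp.eval, State.setI, State.storeI, h1, h2, h3, h4] using key
  · simp only [RAM.pushArc, Prog.run, IExp.eval, State.setI, State.storeI]
    simp [h4]
    rw [← h.2 u w]
    constructor
    · rintro ⟨k, hk, hu, hw⟩
      by_cases hkA : k = σ.iv 13
      · subst hkA
        exact Or.inr (by simpa using And.intro hu hw)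
      · exact Or.inl ⟨k, by omega, by simpa [hkA] using hu, by simpa [hkA] using hw⟩
    · rintro (⟨k, hk, hu, hw⟩ | ⟨hu, hw⟩)
      · exact ⟨k, by omega, by simpa [hk.ne] using hu, by simpa [hk.ne] using hw⟩
      · exact ⟨σ.iv 13, by omega, by simpa using hu, by simpa using hw⟩
  · simp [RAM.pushArc, Prog.run, IExp.eval, State.setI, State.storeI]

theorem HoldsDigraph.congr {N : ℕ} {r r' : ℕ → ℕ → Prop} (h : HoldsDigraph N r σ)
    (hr : ∀ u w, r u w ↔ r' u w) : HoldsDigraph N r' σ :=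
  ⟨h.1, fun u w => (h.2 u w).trans (hr u w)⟩

/-- The residual arcs of the edge number `e`, in terms of the memory. -/
def ResidualAt (σ : State) (e u w : ℕ) : Prop :=
  (σ.ia 7 e = u ∧ σ.ia 8 e = w ∧ σ.ra 2 e < σ.ra 1 e) ∨
    (σ.ia 8 e = u ∧ σ.ia 7 e = w ∧ 0 < σ.ra 1 e + σ.ra 2 e)

theorem HoldsDigraph.pushResidual {N : ℕ} {r : ℕ → ℕ → Prop} (h : HoldsDigraph N r σ)
    (hx : σ.ia 7 (σ.iv 10) < N) (hy : σ.ia 8 (σ.iv 10) < N) :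
    HoldsDigraph N (fun u w => r u w ∨ ResidualAt σ (σ.iv 10) u w) (pushResidual.run O ω σ) ∧
    (pushResidual.run O ω σ).iv 13 ≤ σ.iv 13 + 2 := by
  rw [RAM.pushResidual, Prog.run]
  generalize hτ : Prog.run O ω (.branch (.not (.rle (.arr 1 (.var 10)) (.arr 2 (.var 10))))
    (RAM.pushArc (.arr 7 (.var 10)) (.arr 8 (.var 10))) .skip) σ = τ
  obtain ⟨T, -, hexec⟩ := Exec.straight (O := O) (ω := ω)
    (p := .branch (.not (.rle (.arr 1 (.var 10)) (.arr 2 (.var 10))))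
      (RAM.pushArc (.arr 7 (.var 10)) (.arr 8 (.var 10))) .skip) rfl σ
  rw [hτ] at hexec
  have hF := hexec.frame
  have f10 := hF.iv 10 rfl
  have f7 := hF.ia 7 rfl
  have f8 := hF.ia 8 rfl
  have f1 := hF.ra 1 rfl
  have f2 := hF.ra 2 rfl
  have h1 : HoldsDigraph N (fun u w => r u w ∨ σ.ia 7 (σ.iv 10) = u ∧ σ.ia 8 (σ.iv 10) = w ∧
      σ.ra 2 (σ.iv 10) < σ.ra 1 (σ.iv 10)) τ ∧ τ.iv 13 ≤ σ.iv 13 + 1 := by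
    rw [Prog.run] at hτ
    by_cases hc : σ.ra 2 (σ.iv 10) < σ.ra 1 (σ.iv 10)
    · rw [if_pos (by simpa [BExp.Holds, IExp.eval, RExp.eval] using hc)] at hτ
      obtain ⟨k1, k2⟩ := h.pushArc (O := O) (ω := ω) (a := 7) (b := 8) (by norm_num) (by norm_num) hx hy
      rw [hτ] at k1 k2
      exact ⟨k1.congr fun u w => by simp [hc], k2.le⟩
    · rw [if_neg (by simpa [BExp.Holds, IExp.eval, RExp.eval] using hc)] at hτ
      rw [← hτ]
      exact ⟨h.congr fun u w => by simp [hc], by simp [Prog.run]⟩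
  rw [Prog.run]
  by_cases hc : 0 < σ.ra 1 (σ.iv 10) + σ.ra 2 (σ.iv 10)
  · rw [if_pos (by simpa [BExp.Holds, IExp.eval, RExp.eval, f1, f2, f10] using hc)]
    obtain ⟨k1, k2⟩ := h1.1.pushArc (O := O) (ω := ω) (a := 8) (b := 7) (by norm_num) (by norm_num)
      (by rw [f10, f8]; exact hy) (by rw [f10, f7]; exact hx)
    refine ⟨k1.congr fun u w => ?_, by omega⟩
    simp only [ResidualAt, f7, f8, f10, hc, and_true, or_assoc]
  · rw [if_neg (by simpa [BExp.Holds, IExp.eval, RExp.eval, f1, f2, f10] using hc)]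
    refine ⟨h1.1.congr fun u w => ?_, by simp only [Prog.run]; omega⟩
    simp only [ResidualAt, hc, and_false, or_false]

theorem Run.buildResidual {N : ℕ} (hlt : ∀ e < σ.iv 12, σ.ia 7 e < N ∧ σ.ia 8 e < N)
    (hfirst : ∀ x < N, σ.ia 13 x = 0) :
    Run O ω buildResidual σ (16 * σ.iv 12 + 3) fun τ =>
      HoldsDigraph N (fun u w => ∃ e < σ.iv 12, ResidualAt σ e u w) τ ∧
      τ.iv 13 ≤ 2 * σ.iv 12 := by
  refine Run.seq (t₁ := 1) (t₂ := 16 * σ.iv 12 + 2)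
    (.straight rfl le_rfl (Q := (· = _)) rfl) ?_ (by omega)
  rintro _ rfl -
  refine Run.forLoop (t₁ := 14) (σ.iv 12)
    (fun i τ => HoldsDigraph N (fun u w => ∃ e < i, ResidualAt σ e u w) τ ∧ τ.iv 13 ≤ 2 * i)
    rfl (fun τ hF => hF.iv 12 rfl) ?_ ?_ (fun τ _ h => h) (by omega)
  · refine ⟨⟨?_, fun u w => ?_⟩, ?_⟩
    · simp only [Prog.run, State.setI, IExp.eval]
      exact ⟨by simp, by simp, by simp, by simp, fun v hv => Or.inl (hfirst v hv), by simp⟩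
    · simp [Prog.run, State.setI, IExp.eval]
    · simp [Prog.run, State.setI, IExp.eval]
  · rintro i hi τ hF h10 ⟨hI, hle⟩
    have f7 : τ.ia 7 = σ.ia 7 := hF.ia 7 rfl
    have f8 : τ.ia 8 = σ.ia 8 := hF.ia 8 rfl
    have f1 : τ.ra 1 = σ.ra 1 := hF.ra 1 rfl
    have f2 : τ.ra 2 = σ.ra 2 := hF.ra 2 rfl
    have hlti := hlt i hi
    obtain ⟨k1, k2⟩ := hI.pushResidual (O := O) (ω := ω) (by rw [h10, f7]; exact hlti.1)
      (by rw [h10, f8]; exact hlti.2)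
    refine Run.straight rfl (by decide) ?_
    refine ⟨?_, ?_⟩
    · have := k1.congr (r' := fun u w => ∃ e < i + 1, ResidualAt σ e u w) fun u w => by
        rw [show ResidualAt τ (τ.iv 10) u w ↔ ResidualAt σ i u w by
          simp only [ResidualAt, f7, f8, f1, f2, h10]]
        constructor
        · rintro (⟨e, he, h⟩ | h)
          exacts [⟨e, by omega, h⟩, ⟨i, by omega, h⟩]
        · rintro ⟨e, he, h⟩
          rcases Nat.lt_succ_iff_lt_or_eq.1 he with he | rfl
          exacts [Or.inl ⟨e, he, h⟩, Or.inr h]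
      simpa [HoldsDigraph, State.setI] using this
    · simp [State.setI]
      omega

/-- The side `Z` of the cut that is found is the set of vertices visited in the residual graph. -/
theorem Run.minCut (hO : O.Correct) {n M : ℕ} (hn : σ.iv 0 = n) (hM : σ.iv 12 = M)
    {I : FlowInstance} (hI : σ.readInstance (n + 2) M 7 8 1 n (n + 1) = I) (hV : I.toWGraph.WF) :
    Run O ω minCut σ (60 * (n + M) + 60) fun τ => τ.calls = σ.calls ++ [I] ∧
      ∃ Z : Set ℕ, n ∈ Z ∧ n + 1 ∉ Z ∧ (∀ x < n + 2, τ.ia 14 x ≠ 0 ↔ x ∈ Z) ∧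
        ∀ Z' : Set ℕ, n ∈ Z' → n + 1 ∉ Z' → I.cut Z ≤ I.cut Z' := by
  have hval : I.Valid := by
    subst hI
    exact ⟨hV, by simp [State.readInstance], by simp [State.readInstance],
      by simp [State.readInstance]⟩
  refine Run.seq (t₂ := 60 * (n + M) + 59) (.straight rfl le_rfl (Q := (· = _)) rfl) ?_
    (by simp only [Prog.size]; omega)
  rintro _ rfl hF₀
  generalize hσ' : Prog.run O ω (.maxflow (.succ (.succ (.var 0))) (.var 12) 7 8 1 (.var 0)
    (.succ (.var 0)) 2) σ = σ₁ at *
  have hcall : σ₁ = σ.callFlow O I 2 := by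
    rw [← hσ', ← hI, ← hn, ← hM]
    rfl
  have a7 : σ₁.ia 7 = σ.ia 7 := hF₀.ia 7 rfl
  have a8 : σ₁.ia 8 = σ.ia 8 := hF₀.ia 8 rfl
  have a1 : σ₁.ra 1 = σ.ra 1 := hF₀.ra 1 rfl
  have a0 : σ₁.iv 0 = n := (hF₀.iv 0 rfl).trans hn
  have a12 : σ₁.iv 12 = M := (hF₀.iv 12 rfl).trans hM
  have acalls : σ₁.calls = σ.calls ++ [I] := by rw [hcall]; rfl
  have hlt : ∀ e < M, σ.ia 7 e < n + 2 ∧ σ.ia 8 e < n + 2 := by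
    subst hI
    exact fun e he => ⟨(hV ⟨e, he⟩).1, (hV ⟨e, he⟩).2.1⟩
  have hres : ∀ u w, (∃ e < M, ResidualAt σ₁ e u w) ↔ I.Residual (O I) u w := by
    subst hI
    intro u w
    have h2 : ∀ e (he : e < M), σ₁.ra 2 e = O (σ.readInstance (n + 2) M 7 8 1 n (n + 1)) ⟨e, he⟩ := by
      intro e he
      rw [hcall]
      simp only [State.callFlow, Function.update_self]
      exact dif_pos he
    constructor
    · rintro ⟨e, he, h⟩
      refine ⟨⟨e, he⟩, ?_⟩
      simp only [ResidualAt, a7, a8, a1, h2 e he] at h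
      exact h
    · rintro ⟨⟨e, he⟩, h⟩
      refine ⟨e, he, ?_⟩
      simp only [ResidualAt, a7, a8, a1, h2 e he]
      exact h
  clear hσ' hcall
  refine Run.seq (t₁ := (n + 2) * 4 + 2) (t₂ := 55 * (n + M) + 49)
    (P := fun τ => ∀ x < n + 2, τ.ia 13 x = 0 ∧ τ.ia 14 x = 0) ?_ ?_ (by omega)
  · refine Run.forLoop (t₁ := 2) (n + 2) (fun i τ => ∀ x < i, τ.ia 13 x = 0 ∧ τ.ia 14 x = 0) rfl ?_
      (by simp) ?_ (fun τ _ h => h) le_rfl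
    · intro τ hF
      simp only [IExp.eval, hF.iv 0 rfl, a0]
    · intro i hi τ hF h10 h
      refine Run.straight rfl le_rfl ?_
      intro x hx
      by_cases hxi : x = i
      · simp [Prog.run, State.setI, State.storeI, IExp.eval, h10, hxi]
      · have := h x (by omega)
        simpa [Prog.run, State.setI, State.storeI, IExp.eval, h10, hxi] using this
  intro σ₂ h₂ hF₂
  have b0 : σ₂.iv 0 = n := (hF₂.iv 0 rfl).trans a0
  have b12 : σ₂.iv 12 = M := (hF₂.iv 12 rfl).trans a12
  have hres₂ : ∀ u w, (∃ e < M, ResidualAt σ₂ e u w) ↔ I.Residual (O I) u w := by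
    intro u w
    rw [← hres u w]
    simp only [ResidualAt, hF₂.ia 7 rfl, hF₂.ia 8 rfl, hF₂.ra 1 rfl, hF₂.ra 2 rfl]
  have hlt₂ : ∀ e < M, σ₂.ia 7 e < n + 2 ∧ σ₂.ia 8 e < n + 2 := by
    rw [hF₂.ia 7 rfl, hF₂.ia 8 rfl, a7, a8]
    exact hlt
  refine Run.seq (t₂ := 24 * M + 12 * (n + 2) + 16)
    (Run.buildResidual (N := n + 2) (by rwa [b12]) fun x hx => (h₂ x hx).1) ?_
    (by rw [b12]; omega)
  rintro σ₃ ⟨⟨hA, hr⟩, hle⟩ hF₃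
  rw [b12] at hle hr
  have c0 : σ₃.iv 0 = n := (hF₃.iv 0 rfl).trans b0
  refine Run.mono (Run.search (N := n + 2) hA (by omega) ?_) ?_ (by omega)
  · rw [hF₃.ia 14 rfl]
    exact fun x hx => (h₂ x hx).2
  intro τ hτ hF₄
  have hs : I.s = n := by rw [← hI]; rfl
  have ht : I.t = n + 1 := by rw [← hI]; rfl
  have hmf := hO I hval
  refine ⟨?_, {x | Relation.ReflTransGen (I.Residual (O I)) I.s x}, ?_, ?_, ?_, ?_⟩
  · rw [hF₄.calls rfl, hF₃.calls rfl, hF₂.calls rfl, acalls]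
  · exact hs ▸ .refl
  · rw [← ht]
    exact hmf.not_reachable hval
  · intro x hx
    have : (fun u w => ∃ k < σ₃.iv 13, σ₃.ia 10 k = u ∧ σ₃.ia 11 k = w) = I.Residual (O I) := by
      funext u w
      exact propext ((hr u w).trans (hres₂ u w))
    rw [hτ x hx, c0, this, hs]
    rfl
  · intro Z' h1 h2
    exact hmf.cut_le hval (fun x => Iff.rfl) (hs ▸ h1) (ht ▸ h2)

end

end RAM

/-! ### Isolating cuts -/

namespace WGraph

variable {G : WGraph} {s v : ℕ} {r : Set ℕ}

/-- The terminal `v` is the only terminal on the smallest side of a minimum cut that separates it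
from `s`. -/
def Isolated (G : WGraph) (s : ℕ) (r : Set ℕ) (v : ℕ) : Prop :=
  v < G.n ∧ v ≠ s ∧ v ∈ r ∧ ∀ x ∈ G.minSide s v, x ∈ r → x = v

/-- Uncrossing: a cut `X` that is minimum among all cuts that split the terminals in the same way
does not cut through the smallest side of an isolated terminal. -/
theorem Isolated.mem_iff (hG : G.WF) (hv : G.Isolated s r v) {X : Set ℕ}
    (hX : ∀ X' : Set ℕ, (∀ x ∈ r, x ∈ X' ↔ x ∈ X) → G.cut X ≤ G.cut X') {x : ℕ}
    (hx : x ∈ G.minSide s v) : x ∈ X ↔ v ∈ X := by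
  obtain ⟨hvn, hvs, hvr, hiso⟩ := hv
  obtain ⟨-, hvM, hsM, hM, hmin⟩ := minSide_spec hG hvn hvs
  by_cases hvX : v ∈ X
  · have h1 := hX ((G.minSide s v : Set ℕ) ∪ X) fun y hy => by
      refine ⟨?_, Or.inr⟩
      rintro (h | h)
      · rwa [hiso y (by simpa using h) hy]
      · exact h
    have h2 := cut_submodular hG (G.minSide s v : Set ℕ) X
    have h3 := hmin ((G.minSide s v : Set ℕ) ∩ X) ⟨by simpa using hvM, hvX⟩
      (fun h => hsM (by simpa using h.1)) (by linarith)
    exact iff_of_true (h3 (by simpa using hx)).2 hvX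
  · have h1 := hX (X \ G.minSide s v) fun y hy => by
      refine ⟨fun h => h.1, fun h => ⟨h, fun h' => hvX ?_⟩⟩
      rwa [← hiso y (by simpa using h') hy]
    have h2 := cut_posimodular hG (G.minSide s v : Set ℕ) X
    have h3 := hmin ((G.minSide s v : Set ℕ) \ X) ⟨by simpa using hvM, hvX⟩
      (fun h => hsM (by simpa using h.1)) (by linarith)
    exact iff_of_false (h3 (by simpa using hx)).2 hvX

open Classical in
/-- The total weight of the boundaries of the sets into which `X` is split by the classes of `sig`:
an edge between two classes counts once for each of its endpoints in `X`. -/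
noncomputable def splitCut (G : WGraph) (sig : ℕ → ℕ) (X : Set ℕ) : ℝ :=
  ∑ e, if sig (G.src e) = sig (G.dst e) then
      (if Crosses X (G.src e) (G.dst e) then G.wt e else 0)
    else (if G.src e ∈ X then G.wt e else 0) + (if G.dst e ∈ X then G.wt e else 0)

theorem splitCut_congr (hG : G.WF) (sig : ℕ → ℕ) {X X' : Set ℕ}
    (h : ∀ x < G.n, x ∈ X ↔ x ∈ X') : G.splitCut sig X = G.splitCut sig X' := by
  classical
  unfold splitCut
  refine Finset.sum_congr rfl fun e _ => ?_
  have h1 := h _ (hG e).1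
  have h2 := h _ (hG e).2.1
  have h3 : Crosses X (G.src e) (G.dst e) ↔ Crosses X' (G.src e) (G.dst e) :=
    not_congr (iff_congr h1 h2)
  simp only [h1, h2, h3]

/-- Exchanging the part of `X` in one class for another subset `M` of that class. -/
theorem splitCut_exchange (G : WGraph) (sig : ℕ → ℕ) (X M : Set ℕ) (κ : ℕ)
    (hM : ∀ x ∈ M, sig x = κ) :
    G.splitCut sig {x | sig x = κ ∧ x ∈ M ∨ sig x ≠ κ ∧ x ∈ X} + G.cut {x | x ∈ X ∧ sig x = κ} =
      G.splitCut sig X + G.cut M := by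
  unfold splitCut cut
  rw [← Finset.sum_add_distrib, ← Finset.sum_add_distrib]
  refine Finset.sum_congr rfl fun e _ => ?_
  have h1 := hM (G.src e)
  have h2 := hM (G.dst e)
  by_cases a1 : sig (G.src e) = κ <;> by_cases a2 : sig (G.dst e) = κ <;>
    by_cases b1 : G.src e ∈ X <;> by_cases b2 : G.dst e ∈ X <;>
    by_cases c1 : G.src e ∈ M <;> by_cases c2 : G.dst e ∈ M <;>
    simp_all [Crosses, eq_comm (a := κ)]

/-- If the classes of `sig` separate the terminals from each other and contain the smallest side of
the isolated terminal `v`, then the part in the class of `v` of a minimum split cut contains this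
side and has the same weight. -/
theorem Isolated.subset (hG : G.WF) (hv : G.Isolated s r v) (hsr : s ∈ r) {sig : ℕ → ℕ}
    (hinj : ∀ x ∈ r, ∀ y ∈ r, sig x = sig y → x = y)
    (hsig : ∀ x ∈ G.minSide s v, sig x = sig v) {X : Set ℕ} (hrX : r ⊆ X)
    (hX : ∀ X' : Set ℕ, r ⊆ X' → G.splitCut sig X ≤ G.splitCut sig X') :
    (G.minSide s v : Set ℕ) ⊆ {x | x ∈ X ∧ sig x = sig v} ∧
      G.cut {x | x ∈ X ∧ sig x = sig v} ≤ G.mincut s v := by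
  obtain ⟨hvn, hvs, hvr, hiso⟩ := hv
  obtain ⟨-, hvM, hsM, hM, hmin⟩ := minSide_spec hG hvn hvs
  have h1 := splitCut_exchange G sig X (G.minSide s v) (sig v) (by simpa using hsig)
  have h2 := hX {x | sig x = sig v ∧ x ∈ (G.minSide s v : Set ℕ) ∨ sig x ≠ sig v ∧ x ∈ X} <| by
    intro x hx
    by_cases h : sig x = sig v
    · rw [hinj x hx v hvr h]
      exact Or.inl ⟨rfl, by simpa using hvM⟩
    · exact Or.inr ⟨h, hrX hx⟩
  have h3 : G.cut {x | x ∈ X ∧ sig x = sig v} ≤ G.mincut s v := by linarith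
  exact ⟨hmin _ ⟨hrX hvr, rfl⟩ (fun h => hvs (hinj s hsr v hvr h.2).symm) h3, h3⟩

end WGraph

namespace RAM

/-- The part of the memory that is set up once and for all: the input, the number `iv 3` of bits of
`n`, the number `iv 4` of sampling levels, and a table of doubles in the integer array `6`. -/
structure Static (G : WGraph) (s : ℕ) (lam : ℝ) (σ : State) : Prop where
  n : σ.iv 0 = G.n
  m : σ.iv 1 = G.m
  s : σ.iv 2 = s
  bits : σ.iv 3 = G.n.size
  levels : σ.iv 4 = G.n.size + 2
  lam : σ.rv 0 = lam
  src : ∀ e : Fin G.m, σ.ia 0 e = G.src e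
  dst : ∀ e : Fin G.m, σ.ia 1 e = G.dst e
  wt : ∀ e : Fin G.m, σ.ra 0 e = G.wt e
  double : ∀ i ≤ G.n, σ.ia 6 i = 2 * i

/-- The program leaves the static part of the memory alone. -/
def Prog.keepsStatic (p : Prog) : Bool :=
  !(p.writesI 0 || p.writesI 1 || p.writesI 2 || p.writesI 3 || p.writesI 4 ||
    p.writesR 0 || p.writesIA 0 || p.writesIA 1 || p.writesIA 6 || p.writesRA 0)

theorem Static.frame {G : WGraph} {s : ℕ} {lam : ℝ} {p : Prog} {σ τ : State}
    (h : Static G s lam σ) (hF : Frame p σ τ) (hp : p.keepsStatic = true) : Static G s lam τ := by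
  simp only [Prog.keepsStatic, Bool.not_or, Bool.and_eq_true, Bool.not_eq_true'] at hp
  obtain ⟨⟨⟨⟨⟨⟨⟨⟨⟨h0, h1⟩, h2⟩, h3⟩, h4⟩, hr⟩, ha⟩, hb⟩, hd⟩, hw⟩ := hp
  exact ⟨(hF.iv _ h0).trans h.n, (hF.iv _ h1).trans h.m, (hF.iv _ h2).trans h.s,
    (hF.iv _ h3).trans h.bits, (hF.iv _ h4).trans h.levels,
    (hF.rv _ hr).trans h.lam, by rw [hF.ia _ ha]; exact h.src, by rw [hF.ia _ hb]; exact h.dst,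
    by rw [hF.ra _ hw]; exact h.wt, by rw [hF.ia _ hd]; exact h.double⟩

/-- The vertices marked in the integer array `3`. -/
def terminals (G : WGraph) (σ : State) : Set ℕ := {x | x < G.n ∧ σ.ia 3 x ≠ 0}

/-- The requirements on the instances of maximum flow. -/
def GoodCall (G : WGraph) (I : FlowInstance) : Prop :=
  I.Valid ∧ I.n ≤ 3 * G.n ∧ I.m ≤ 2 * G.m

/-- Determine a minimum cut between the terminals for which the number in the array `4` is even and
the other terminals, by contracting both sets. Append the side of each vertex as a new last bit to
its number in the array `5`, and delete the last bit of its number in the array `4`. -/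
def bitCut : Prog :=
  .forLoop 9 (.var 0)
    (.branch (.ieq (.arr 3 (.var 9)) (.lit 0))
      (.istore 9 (.var 9) (.var 9))
      (.branch (.ieq (.parity (.arr 4 (.var 9))) (.lit 0))
        (.istore 9 (.var 9) (.var 0))
        (.istore 9 (.var 9) (.succ (.var 0))))) ;;
  .forLoop 10 (.var 1)
    (.istore 7 (.var 10) (.arr 9 (.arr 0 (.var 10))) ;;
     .istore 8 (.var 10) (.arr 9 (.arr 1 (.var 10))) ;;
     .rstore 1 (.var 10) (.arr 0 (.var 10))) ;;
  .iset 12 (.var 1) ;;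
  minCut ;;
  .forLoop 9 (.var 0)
    (.istore 5 (.var 9) (.arr 6 (.arr 5 (.var 9))) ;;
     .branch (.ieq (.arr 14 (.arr 9 (.var 9))) (.lit 0)) .skip
       (.istore 5 (.var 9) (.succ (.arr 5 (.var 9)))) ;;
     .istore 4 (.var 9) (.half (.arr 4 (.var 9))))

section

variable {O : FlowOracle} {ω : ℕ → Bool} {σ : State} {G : WGraph} {s : ℕ} {lam : ℝ}

open Classical in
/-- The set `X` is one side of the cut: it has minimum weight among all cuts that split the terminals
in the same way. -/
theorem Run.bitCut (hO : O.Correct) (hG : G.WF) (hn : 0 < G.n) (hσ : Static G s lam σ)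
    (hsig : ∀ x < G.n, σ.ia 5 x ≤ G.n) :
    Run O ω bitCut σ (200 * (G.n + G.m)) fun τ =>
      (∃ I, GoodCall G I ∧ τ.calls = σ.calls ++ [I]) ∧
      ∃ X : Set ℕ, (∀ x ∈ terminals G σ, x ∈ X ↔ σ.ia 4 x % 2 = 0) ∧
        (∀ X' : Set ℕ, (∀ x ∈ terminals G σ, x ∈ X' ↔ x ∈ X) → G.cut X ≤ G.cut X') ∧
        ∀ x < G.n, τ.ia 5 x = 2 * σ.ia 5 x + (if x ∈ X then 1 else 0) ∧
          τ.ia 4 x = σ.ia 4 x / 2 := by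
  -- the contraction
  let ℓ : ℕ → ℕ := fun x =>
    if σ.ia 3 x = 0 then x else if σ.ia 4 x % 2 = 0 then G.n else G.n + 1
  have hℓ : ∀ x < G.n, ℓ x < G.n + 2 := fun x hx => by
    simp only [ℓ]
    split_ifs <;> omega
  refine Run.seq (t₁ := G.n * 7 + 2) (t₂ := 190 * (G.n + G.m)) (P := fun τ => ∀ x < G.n, τ.ia 9 x = ℓ x)
    ?_ ?_ (by omega)
  · refine Run.forLoop (t₁ := 5) G.n (fun i τ => ∀ x < i, τ.ia 9 x = ℓ x) rfl
      (fun τ hF => (hF.iv 0 rfl).trans hσ.n) (by simp) ?_ (fun τ _ h => h) le_rfl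
    intro i hi τ hF h9 h
    refine Run.straight rfl le_rfl fun x hx => ?_
    have f0 : τ.iv 0 = G.n := (hF.iv 0 rfl).trans hσ.n
    have f3 : τ.ia 3 = σ.ia 3 := hF.ia 3 rfl
    have f4 : τ.ia 4 = σ.ia 4 := hF.ia 4 rfl
    by_cases hxi : x = i
    · subst hxi
      by_cases h1 : σ.ia 3 x = 0 <;> by_cases h2 : σ.ia 4 x % 2 = 0 <;>
        simp [Prog.run, BExp.Holds, IExp.eval, State.setI, State.storeI, f0, f3, f4, h9, h1, h2, ℓ]
    · have := h x (by omega)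
      by_cases h1 : σ.ia 3 i = 0 <;> by_cases h2 : σ.ia 4 i % 2 = 0 <;>
        simp [Prog.run, BExp.Holds, IExp.eval, State.setI, State.storeI, f0, f3, f4, h9, h1, h2,
          hxi, this]
  intro σ₁ h₁ hF₁
  have hσ₁ := hσ.frame hF₁ rfl
  refine Run.seq (t₁ := G.m * 5 + 2) (t₂ := 180 * (G.n + G.m) + 1)
    (P := fun τ => ∀ e : Fin G.m, τ.ia 7 e = ℓ (G.src e) ∧ τ.ia 8 e = ℓ (G.dst e) ∧
      τ.ra 1 e = G.wt e) ?_ ?_ (by omega)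
  · refine Run.forLoop (t₁ := 3) G.m (fun i τ => ∀ e : Fin G.m, (e : ℕ) < i →
      τ.ia 7 e = ℓ (G.src e) ∧ τ.ia 8 e = ℓ (G.dst e) ∧ τ.ra 1 e = G.wt e) rfl
      (fun τ hF => (hF.iv 1 rfl).trans hσ₁.m) (by simp) ?_ (fun τ _ h e => h e e.2) le_rfl
    intro i hi τ hF h10 h
    refine Run.straight rfl le_rfl fun e he => ?_
    have hτ := hσ₁.frame hF rfl
    have f9 : τ.ia 9 = σ₁.ia 9 := hF.ia 9 rfl
    by_cases hxi : (e : ℕ) = i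
    · subst hxi
      simp [Prog.run, RExp.eval, IExp.eval, State.setI, State.storeI, State.storeR, h10,
        hτ.src, hτ.dst, hτ.wt, f9, h₁ _ (hG e).1, h₁ _ (hG e).2.1]
    · have := h e (by omega)
      simpa [Prog.run, RExp.eval, IExp.eval, State.setI, State.storeI, State.storeR, h10, hxi]
        using this
  intro σ₂ h₂ hF₂
  have hσ₂ := hσ₁.frame hF₂ rfl
  refine Run.seq (t₁ := 1) (t₂ := 180 * (G.n + G.m)) (P := fun τ => τ.iv 12 = G.m)
    (.straight rfl le_rfl hσ₂.m) ?_ (by omega)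
  intro σ₃ h₃ hF₃
  have hσ₃ := hσ₂.frame hF₃ rfl
  have f7 : σ₃.ia 7 = σ₂.ia 7 := hF₃.ia 7 rfl
  have f8 : σ₃.ia 8 = σ₂.ia 8 := hF₃.ia 8 rfl
  have f1 : σ₃.ra 1 = σ₂.ra 1 := hF₃.ra 1 rfl
  have f9 : σ₃.ia 9 = σ₁.ia 9 := (hF₃.ia 9 rfl).trans (hF₂.ia 9 rfl)
  obtain ⟨I, hI⟩ : ∃ I, σ₃.readInstance (G.n + 2) G.m 7 8 1 G.n (G.n + 1) = I := ⟨_, rfl⟩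
  have hWF : I.toWGraph.WF := by
    rw [← hI]
    intro e
    obtain ⟨k1, k2, k3⟩ := h₂ e
    simp only [State.readInstance, f7, f8, f1, k1, k2, k3]
    exact ⟨hℓ _ (hG e).1, hℓ _ (hG e).2.1, (hG e).2.2⟩
  have hgood : GoodCall G I := by
    refine ⟨⟨hWF, ?_⟩, ?_, ?_⟩ <;> rw [← hI] <;> simp [State.readInstance] <;> omega
  have hcut : ∀ Z : Set ℕ, I.cut Z = G.cut (ℓ ⁻¹' Z) := by
    intro Z
    rw [← hI]
    unfold WGraph.cut
    refine Finset.sum_congr rfl fun e _ => ?_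
    obtain ⟨k1, k2, k3⟩ := h₂ e
    simp only [State.readInstance, f7, f8, f1, k1, k2, k3]
    rfl
  refine Run.seq (t₂ := 12 * G.n + 2) (Run.minCut hO hσ₃.n h₃ hI hWF) ?_ (by omega)
  rintro σ₄ ⟨hcalls, Z, hnZ, hnZ', hvis, hmin⟩ hF₄
  have hσ₄ := hσ₃.frame hF₄ rfl
  have g3 : ∀ x ∈ terminals G σ, ℓ x ∈ Z ↔ σ.ia 4 x % 2 = 0 := by
    intro x hx
    by_cases h2 : σ.ia 4 x % 2 = 0 <;> simp [ℓ, hx.2, h2, hnZ, hnZ']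
  have g9 : ∀ x < G.n, σ₄.ia 9 x = ℓ x := fun x hx => by rw [hF₄.ia 9 rfl, f9, h₁ x hx]
  have g5 : σ₄.ia 5 = σ.ia 5 := by
    rw [hF₄.ia 5 rfl, hF₃.ia 5 rfl, hF₂.ia 5 rfl, hF₁.ia 5 rfl]
  have g4 : σ₄.ia 4 = σ.ia 4 := by
    rw [hF₄.ia 4 rfl, hF₃.ia 4 rfl, hF₂.ia 4 rfl, hF₁.ia 4 rfl]
  have gcalls : σ₃.calls = σ.calls := by
    rw [hF₃.calls rfl, hF₂.calls rfl, hF₁.calls rfl]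
  refine Run.forLoop (t₁ := 5) G.n (fun i τ =>
    (∀ x < i, τ.ia 5 x = 2 * σ.ia 5 x + (if ℓ x ∈ Z then 1 else 0) ∧ τ.ia 4 x = σ.ia 4 x / 2) ∧
    ∀ x, i ≤ x → τ.ia 5 x = σ.ia 5 x ∧ τ.ia 4 x = σ.ia 4 x) rfl
    (fun τ hF => (hF.iv 0 rfl).trans hσ₄.n) ?_ ?_ ?_ (by omega)
  · exact ⟨by simp, fun x _ => by simp [State.setI, g4, g5]⟩
  · rintro i hi τ hF h9 ⟨hlo, hhi⟩
    refine Run.straight rfl le_rfl ?_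
    have hτ := hσ₄.frame hF rfl
    have k9 : τ.ia 9 i = ℓ i := by rw [hF.ia 9 rfl, g9 i hi]
    have k14 : τ.ia 14 = σ₄.ia 14 := hF.ia 14 rfl
    have k6 := hτ.double _ (hsig i hi)
    have kvis := hvis _ (hℓ i hi)
    obtain ⟨k5, k4⟩ := hhi i le_rfl
    refine ⟨fun x hx => ?_, fun x hx => ?_⟩
    · by_cases hxi : x = i
      · subst hxi
        by_cases h1 : σ₄.ia 14 (ℓ x) = 0
        · have hZ : ℓ x ∉ Z := fun h => kvis.2 h h1
          simp [Prog.run, BExp.Holds, IExp.eval, State.setI, State.storeI, h9, k9, k14, k5, k6, k4,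
            h1, hZ]
        · have hZ : ℓ x ∈ Z := kvis.1 h1
          simp [Prog.run, BExp.Holds, IExp.eval, State.setI, State.storeI, h9, k9, k14, k5, k6, k4,
            h1, hZ]
      · have := hlo x (by omega)
        by_cases h1 : σ₄.ia 14 (ℓ i) = 0 <;>
        simpa [Prog.run, BExp.Holds, IExp.eval, State.setI, State.storeI, h9, k9, k14, h1, hxi]
          using this
    · have := hhi x (by omega)
      have hxi : x ≠ i := by omega
      by_cases h1 : σ₄.ia 14 (ℓ i) = 0 <;>
        simpa [Prog.run, BExp.Holds, IExp.eval, State.setI, State.storeI, h9, k9, k14, h1, hxi]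
          using this
  · rintro τ hF ⟨hlo, -⟩
    refine ⟨⟨I, hgood, by rw [hF.calls rfl, hcalls, gcalls]⟩, ℓ ⁻¹' Z, g3, fun X' hX' => ?_, hlo⟩
    rw [← hcut]
    refine (hmin ({G.n} ∪ {x | x < G.n ∧ σ.ia 3 x = 0 ∧ x ∈ X'}) (Or.inl rfl) (by simp)).trans ?_
    rw [hcut]
    refine (G.cut_congr hG fun x hx => ?_).le
    by_cases h0 : σ.ia 3 x = 0
    · have : x ≠ G.n := by omega
      simp [ℓ, h0, hx, this]
    · rw [hX' x ⟨hx, h0⟩, Set.mem_preimage, Set.mem_preimage, g3 x ⟨hx, h0⟩]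
      by_cases h2 : σ.ia 4 x % 2 = 0 <;> simp [ℓ, h0, h2]

end

/-- Compute in the array `5` a number for each vertex, whose bits are the sides of the vertex in
the minimum cuts between the terminals with bit `b` equal to `0` and those with bit `b` equal to
`1`, for all `b`. -/
def classify : Prog :=
  .forLoop 9 (.var 0)
    (.istore 4 (.var 9) (.var 9) ;; .istore 5 (.var 9) (.lit 0)) ;;
  .forLoop 8 (.var 3) bitCut

/-- Compute the minimum cuts between each terminal and the complement of its class, all with a
single instance of maximum flow: all terminals are contracted to the source, and an edge between two
classes is replaced by two edges that join its endpoints to the sink. The real array `3` is cleared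
for later use. -/
def classCut : Prog :=
  .forLoop 9 (.var 0)
    (.branch (.ieq (.arr 3 (.var 9)) (.lit 0))
      (.istore 9 (.var 9) (.var 9))
      (.istore 9 (.var 9) (.var 0)) ;;
     .rstore 3 (.arr 5 (.var 9)) .zero) ;;
  .iset 12 (.var 1) ;;
  .forLoop 10 (.var 1)
    (.istore 7 (.var 10) (.arr 9 (.arr 0 (.var 10))) ;;
     .istore 7 (.var 12) (.succ (.var 0)) ;;
     .branch (.ieq (.arr 5 (.arr 0 (.var 10))) (.arr 5 (.arr 1 (.var 10))))
       (.istore 8 (.var 10) (.arr 9 (.arr 1 (.var 10))) ;;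
        .istore 8 (.var 12) (.succ (.var 0)))
       (.istore 8 (.var 10) (.succ (.var 0)) ;;
        .istore 8 (.var 12) (.arr 9 (.arr 1 (.var 10)))) ;;
     .rstore 1 (.var 10) (.arr 0 (.var 10)) ;;
     .rstore 1 (.var 12) (.arr 0 (.var 10)) ;;
     .iset 12 (.succ (.var 12))) ;;
  minCut

section

variable {O : FlowOracle} {ω : ℕ → Bool} {σ : State} {G : WGraph} {s : ℕ} {lam : ℝ}

/-- The classes separate the terminals from each other, because the numbers of two different vertices
differ in some bit. They do not cut through the smallest side of an isolated terminal, because none of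
the minimum cuts does. -/
theorem Run.classify (hO : O.Correct) (hG : G.WF) (hn : 0 < G.n) (hσ : Static G s lam σ) :
    Run O ω classify σ ((G.n.size + 1) * (210 * (G.n + G.m))) fun τ =>
      (∃ l, (∀ I ∈ l, GoodCall G I) ∧ l.length = G.n.size ∧ τ.calls = σ.calls ++ l) ∧
      (∀ x ∈ terminals G σ, ∀ y ∈ terminals G σ, τ.ia 5 x = τ.ia 5 y → x = y) ∧
      ∀ v, G.Isolated s (terminals G σ) v → ∀ x ∈ G.minSide s v, τ.ia 5 x = τ.ia 5 v := by
  have ht : (G.n * 4 + 2) + (G.n.size * (200 * (G.n + G.m) + 2) + 2) ≤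
      (G.n.size + 1) * (210 * (G.n + G.m)) := by
    have : G.n.size * (200 * (G.n + G.m) + 2) ≤ G.n.size * (210 * (G.n + G.m)) :=
      Nat.mul_le_mul_left _ (by omega)
    have := Nat.add_mul G.n.size 1 (210 * (G.n + G.m))
    omega
  refine Run.seq (P := fun τ => ∀ x < G.n, τ.ia 4 x = x ∧ τ.ia 5 x = 0) ?_ ?_ ht
  · refine Run.forLoop (t₁ := 2) G.n (fun i τ => ∀ x < i, τ.ia 4 x = x ∧ τ.ia 5 x = 0) rfl
      (fun τ hF => (hF.iv 0 rfl).trans hσ.n) (by simp) ?_ (fun τ _ h => h) le_rfl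
    intro i hi τ hF h9 h
    refine Run.straight rfl le_rfl fun x hx => ?_
    by_cases hxi : x = i
    · simp [Prog.run, IExp.eval, State.setI, State.storeI, h9, hxi]
    · have := h x (by omega)
      simpa [Prog.run, IExp.eval, State.setI, State.storeI, h9, hxi] using this
  intro σ₁ h₁ hF₁
  have hσ₁ := hσ.frame hF₁ rfl
  refine Run.forLoop (t₁ := 200 * (G.n + G.m)) G.n.size (fun b τ =>
    (∃ l, (∀ I ∈ l, GoodCall G I) ∧ l.length = b ∧ τ.calls = σ.calls ++ l) ∧
    (∀ x < G.n, τ.ia 4 x = x / 2 ^ b ∧ τ.ia 5 x < 2 ^ b) ∧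
    (∀ x ∈ terminals G σ, ∀ y ∈ terminals G σ, τ.ia 5 x = τ.ia 5 y → x % 2 ^ b = y % 2 ^ b) ∧
    ∀ v, G.Isolated s (terminals G σ) v → ∀ x ∈ G.minSide s v, τ.ia 5 x = τ.ia 5 v) rfl
    (fun τ hF => (hF.iv 3 rfl).trans hσ₁.bits) ?_ ?_ ?_ le_rfl
  · refine ⟨⟨[], by simp, rfl, by simpa [State.setI] using hF₁.calls rfl⟩, ?_, ?_, ?_⟩
    · intro x hx
      simp [State.setI, h₁ x hx]
    · simp [Nat.mod_one]
    · intro v hv x hx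
      simp [State.setI, (h₁ v hv.1).2,
        (h₁ x (WGraph.mincut_le_of_mem_minSide hG hv.1 hv.2.1 hx).1).2]
  · rintro b hb τ hF h8 ⟨⟨l, hl, hlen, hcalls⟩, hbits, hmod, hiso⟩
    have hτ := hσ₁.frame hF rfl
    have hR : terminals G τ = terminals G σ := by
      simp only [terminals, hF.ia 3 rfl, hF₁.ia 3 rfl]
    have h2b : 2 ^ b ≤ G.n := Nat.lt_size.1 hb
    refine (Run.bitCut hO hG hn hτ fun x hx => (hbits x hx).2.le.trans h2b).mono ?_ le_rfl
    rintro τ' ⟨⟨I, hI, hcalls'⟩, X, hXR, hXmin, hnew⟩ hF'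
    rw [hR] at hXR hXmin
    refine ⟨⟨l ++ [I], ?_, by simp [hlen], ?_⟩, ?_, ?_, ?_⟩
    · simpa [or_imp, forall_and, hI] using hl
    · simp [State.setI, hcalls', hcalls]
    · intro x hx
      obtain ⟨k1, k2⟩ := hnew x hx
      obtain ⟨k3, k4⟩ := hbits x hx
      refine ⟨?_, ?_⟩
      · change τ'.ia 4 x = _
        rw [k2, k3, Nat.div_div_eq_div_mul, pow_succ]
      · change τ'.ia 5 x < _
        rw [k1, pow_succ]
        split_ifs <;> omega
    · intro x hx y hy hxy
      change τ'.ia 5 x = τ'.ia 5 y at hxy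
      rw [(hnew x hx.1).1, (hnew y hy.1).1] at hxy
      have hX : (x ∈ X ↔ y ∈ X) ∧ τ.ia 5 x = τ.ia 5 y := by
        by_cases k1 : x ∈ X <;> by_cases k2 : y ∈ X <;> simp [k1, k2] at hxy ⊢ <;> omega
      have hpar : x / 2 ^ b % 2 = y / 2 ^ b % 2 := by
        have k1 := hXR x hx
        have k2 := hXR y hy
        rw [(hbits x hx.1).1] at k1
        rw [(hbits y hy.1).1] at k2
        have := hX.1
        rw [k1, k2] at this
        omega
      rw [Nat.mod_pow_succ, Nat.mod_pow_succ, hmod x hx y hy hX.2, hpar]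
    · intro v hv x hx
      change τ'.ia 5 x = τ'.ia 5 v
      rw [(hnew v hv.1).1, (hnew x (WGraph.mincut_le_of_mem_minSide hG hv.1 hv.2.1 hx).1).1,
        hiso v hv x hx]
      have hmem := hv.mem_iff hG hXmin hx
      by_cases hvX : v ∈ X <;> simp [hmem, hvX]
  · rintro τ hF ⟨hcalls, -, hmod, hiso⟩
    refine ⟨hcalls, fun x hx y hy hxy => ?_, hiso⟩
    have := hmod x hx y hy hxy
    have hlt := Nat.lt_size_self G.n
    rwa [Nat.mod_eq_of_lt (hx.1.trans hlt), Nat.mod_eq_of_lt (hy.1.trans hlt)] at this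

open Classical in
/-- The set `X` of the vertices on the side of the source minimizes the split cut among all sets that
contain the terminals. -/
theorem Run.classCut (hO : O.Correct) (hG : G.WF) (hn : 0 < G.n) (hσ : Static G s lam σ) :
    Run O ω classCut σ (200 * (G.n + G.m)) fun τ =>
      (∃ I, GoodCall G I ∧ τ.calls = σ.calls ++ [I]) ∧
      (∀ x < G.n, τ.ra 3 (σ.ia 5 x) = 0) ∧
      ∃ X : Set ℕ, terminals G σ ⊆ X ∧
        (∀ X' : Set ℕ, terminals G σ ⊆ X' → G.splitCut (σ.ia 5) X ≤ G.splitCut (σ.ia 5) X') ∧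
        ∀ x < G.n, τ.ia 14 (τ.ia 9 x) ≠ 0 ↔ x ∈ X := by
  let ℓ : ℕ → ℕ := fun x => if σ.ia 3 x = 0 then x else G.n
  have hℓ : ∀ x < G.n, ℓ x < G.n + 1 := fun x hx => by
    simp only [ℓ]
    split_ifs <;> omega
  refine Run.seq (t₁ := G.n * 6 + 2) (t₂ := 190 * (G.n + G.m))
    (P := fun τ => ∀ x < G.n, τ.ia 9 x = ℓ x ∧ τ.ra 3 (σ.ia 5 x) = 0) ?_ ?_ (by omega)
  · refine Run.forLoop (t₁ := 4) G.n
      (fun i τ => ∀ x < i, τ.ia 9 x = ℓ x ∧ τ.ra 3 (σ.ia 5 x) = 0) rfl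
      (fun τ hF => (hF.iv 0 rfl).trans hσ.n) (by simp) ?_ (fun τ _ h => h) le_rfl
    intro i hi τ hF h9 h
    refine Run.straight rfl le_rfl fun x hx => ?_
    have f0 : τ.iv 0 = G.n := (hF.iv 0 rfl).trans hσ.n
    have f3 : τ.ia 3 = σ.ia 3 := hF.ia 3 rfl
    have f5 : τ.ia 5 = σ.ia 5 := hF.ia 5 rfl
    by_cases hxi : x = i
    · subst hxi
      by_cases h1 : σ.ia 3 x = 0 <;>
        simp [Prog.run, BExp.Holds, IExp.eval, RExp.eval, State.setI, State.storeI, State.storeR,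
          f0, f3, f5, h9, h1, ℓ]
    · have hx' := h x (by omega)
      by_cases hs : σ.ia 5 x = σ.ia 5 i
      · by_cases h1 : σ.ia 3 i = 0 <;>
          simp [Prog.run, BExp.Holds, IExp.eval, RExp.eval, State.setI, State.storeI, State.storeR,
            f0, f3, f5, h9, h1, hxi, hx', hs]
      · by_cases h1 : σ.ia 3 i = 0 <;>
          simp [Prog.run, BExp.Holds, IExp.eval, RExp.eval, State.setI, State.storeI, State.storeR,
            f0, f3, f5, h9, h1, hxi, hx', hs]
  intro σ₁ h₁ hF₁
  have hσ₁ := hσ.frame hF₁ rfl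
  have f5 : σ₁.ia 5 = σ.ia 5 := hF₁.ia 5 rfl
  refine Run.seq (t₁ := 1) (t₂ := 180 * (G.n + G.m)) (P := fun τ => τ.iv 12 = G.m)
    (.straight rfl le_rfl hσ₁.m) ?_ (by omega)
  intro σ₂ h₂ hF₂
  have hσ₂ := hσ₁.frame hF₂ rfl
  -- the second endpoints of the two edges that replace an edge between `x` and `y`; inside a class,
  -- the second edge is a loop at the sink
  let ℓ' : ℕ → ℕ → ℕ := fun x y => if σ.ia 5 x = σ.ia 5 y then ℓ y else G.n + 1
  let ℓ'' : ℕ → ℕ → ℕ := fun x y => if σ.ia 5 x = σ.ia 5 y then G.n + 1 else ℓ y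
  refine Run.seq (t₁ := G.m * 12 + 2) (t₂ := 160 * (G.n + G.m)) (P := fun τ => τ.iv 12 = G.m + G.m ∧
    ∀ e : Fin G.m, (τ.ia 7 e = ℓ (G.src e) ∧ τ.ia 8 e = ℓ' (G.src e) (G.dst e) ∧
      τ.ra 1 e = G.wt e) ∧ τ.ia 7 (G.m + e) = G.n + 1 ∧
      τ.ia 8 (G.m + e) = ℓ'' (G.src e) (G.dst e) ∧ τ.ra 1 (G.m + e) = G.wt e) ?_ ?_ (by omega)
  · refine Run.forLoop (t₁ := 10) G.m (fun i τ => τ.iv 12 = G.m + i ∧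
      ∀ e : Fin G.m, (e : ℕ) < i → (τ.ia 7 e = ℓ (G.src e) ∧ τ.ia 8 e = ℓ' (G.src e) (G.dst e) ∧
      τ.ra 1 e = G.wt e) ∧ τ.ia 7 (G.m + e) = G.n + 1 ∧
      τ.ia 8 (G.m + e) = ℓ'' (G.src e) (G.dst e) ∧ τ.ra 1 (G.m + e) = G.wt e) rfl
      (fun τ hF => (hF.iv 1 rfl).trans hσ₂.m) ?_ ?_ (fun τ _ h => ⟨h.1, fun e => h.2 e e.2⟩) le_rfl
    · simpa [State.setI] using h₂
    rintro i hi τ hF h10 ⟨h12, h⟩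
    refine Run.straight rfl le_rfl ⟨?_, fun e he => ?_⟩
    · by_cases hs : BExp.Holds τ (.ieq (.arr 5 (.arr 0 (.var 10))) (.arr 5 (.arr 1 (.var 10)))) <;>
      · simp only [BExp.Holds, IExp.eval, h10] at hs
        simp [Prog.run, BExp.Holds, RExp.eval, IExp.eval, State.setI, State.storeI, State.storeR,
          h10, h12, hs]
        omega
    have hτ := hσ₂.frame hF rfl
    have g9 : τ.ia 9 = σ₁.ia 9 := (hF.ia 9 rfl).trans (hF₂.ia 9 rfl)
    have g5 : τ.ia 5 = σ.ia 5 := (hF.ia 5 rfl).trans ((hF₂.ia 5 rfl).trans f5)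
    obtain ⟨⟨i, hi'⟩, rfl⟩ : ∃ j : Fin G.m, (j : ℕ) = i := ⟨⟨i, hi⟩, rfl⟩
    have k0 := hτ.src ⟨i, hi⟩
    have k1 := hτ.dst ⟨i, hi⟩
    have k2 := hτ.wt ⟨i, hi⟩
    have k3 := (h₁ _ (hG ⟨i, hi⟩).1).1
    have k4 := (h₁ _ (hG ⟨i, hi⟩).2.1).1
    simp only at k0 k1 k2 h10 h12 he h hi
    have n1 : G.m ≠ 0 := by omega
    have n3 := hτ.n
    by_cases hxi : (e : ℕ) = i
    · obtain rfl : e = ⟨i, hi⟩ := Fin.ext hxi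
      by_cases hs : σ.ia 5 (G.src ⟨i, hi⟩) = σ.ia 5 (G.dst ⟨i, hi⟩) <;>
        simp [Prog.run, BExp.Holds, RExp.eval, IExp.eval, State.setI, State.storeI, State.storeR,
          h10, h12, g9, g5, k0, k1, k2, k3, k4, n1, n3, hs, ℓ', ℓ'']
    · have he' := h e (by omega)
      have n2 : (e : ℕ) ≠ G.m + i := by omega
      have n5 : G.m + (e : ℕ) ≠ i := by omega
      by_cases hs : σ.ia 5 (G.src ⟨i, hi⟩) = σ.ia 5 (G.dst ⟨i, hi⟩) <;>
        simpa [Prog.run, BExp.Holds, RExp.eval, IExp.eval, State.setI, State.storeI, State.storeR,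
          h10, h12, g5, k0, k1, n2, n5, hs, hxi] using he'
  rintro σ₃ ⟨h12, h₃⟩ hF₃
  have hσ₃ := hσ₂.frame hF₃ rfl
  have g9 : σ₃.ia 9 = σ₁.ia 9 := (hF₃.ia 9 rfl).trans (hF₂.ia 9 rfl)
  obtain ⟨I, hI⟩ : ∃ I, σ₃.readInstance (G.n + 2) (G.m + G.m) 7 8 1 G.n (G.n + 1) = I := ⟨_, rfl⟩
  have hWF : I.toWGraph.WF := by
    rw [← hI]
    intro e
    have hx := fun e => hℓ _ (hG e).1
    have hy := fun e => hℓ _ (hG e).2.1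
    refine Fin.addCases (fun e => ?_) (fun e => ?_) e <;>
    · obtain ⟨⟨k1, k2, k3⟩, k4, k5, k6⟩ := h₃ e
      have := hx e
      have := hy e
      simp only [State.readInstance, Fin.val_castAdd, Fin.val_natAdd, k1, k2, k3, k4, k5, k6, ℓ',
        ℓ'']
      refine ⟨?_, ?_, (hG e).2.2⟩ <;> try split_ifs
      all_goals omega
  have hgood : GoodCall G I := by
    refine ⟨⟨hWF, ?_⟩, ?_, ?_⟩ <;> rw [← hI] <;> simp [State.readInstance] <;> omega
  have hcut : ∀ Z : Set ℕ, G.n + 1 ∉ Z → I.cut Z = G.splitCut (σ.ia 5) (ℓ ⁻¹' Z) := by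
    intro Z hZ
    rw [← hI]
    unfold WGraph.cut WGraph.splitCut
    refine (Fin.sum_univ_add _).trans ?_
    rw [← Finset.sum_add_distrib]
    refine Finset.sum_congr rfl fun e _ => ?_
    obtain ⟨⟨k1, k2, k3⟩, k4, k5, k6⟩ := h₃ e
    simp only [State.readInstance, Fin.val_castAdd, Fin.val_natAdd, k1, k2, k3, k4, k5, k6]
    by_cases hs : σ.ia 5 (G.src e) = σ.ia 5 (G.dst e) <;>
      by_cases hx : ℓ (G.src e) ∈ Z <;> by_cases hy : ℓ (G.dst e) ∈ Z <;>
      simp [ℓ', ℓ'', hs, hZ, WGraph.Crosses, hx, hy]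
  refine Run.mono (Run.minCut hO hσ₃.n h12 hI hWF) ?_ (by omega)
  rintro τ ⟨hcalls, Z, hnZ, hnZ', hvis, hmin⟩ hF₄
  refine ⟨⟨I, hgood, ?_⟩, fun x hx => ?_, ℓ ⁻¹' Z, ?_, fun X' hX' => ?_, fun x hx => ?_⟩
  · rw [hcalls, hF₃.calls rfl, hF₂.calls rfl, hF₁.calls rfl]
  · rw [hF₄.ra 3 rfl, hF₃.ra 3 rfl, hF₂.ra 3 rfl, (h₁ x hx).2]
  · intro x hx
    simpa [ℓ, hx.2] using hnZ
  · rw [← hcut Z hnZ']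
    have hZ' : G.n + 1 ∉ ({G.n} ∪ {x | x < G.n ∧ σ.ia 3 x = 0 ∧ x ∈ X'} : Set ℕ) := by simp
    refine (hmin ({G.n} ∪ {x | x < G.n ∧ σ.ia 3 x = 0 ∧ x ∈ X'}) (Or.inl rfl) hZ').trans ?_
    rw [hcut _ hZ']
    refine (G.splitCut_congr hG _ fun x hx => ?_).le
    by_cases h0 : σ.ia 3 x = 0
    · have : x ≠ G.n := by omega
      simp [ℓ, h0, hx, this]
    · exact iff_of_true (by simp [ℓ, h0]) (hX' ⟨hx, h0⟩)
  · rw [hF₄.ia 9 rfl, g9, (h₁ x hx).1]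
    exact hvis _ (by have := hℓ x hx; omega)

end

/-- If the endpoint in the array `a` of the current edge has been reached, and if the other endpoint,
in the array `b`, does not lie in the same class or has not been reached, then add the weight of the
edge to the cut of the class of the former endpoint. -/
def tally (a b : ℕ) : Prog :=
  .branch (.and (.not (.ieq (.arr 14 (.arr 9 (.arr a (.var 10)))) (.lit 0)))
      (.not (.and (.not (.ieq (.arr 14 (.arr 9 (.arr b (.var 10)))) (.lit 0)))
        (.ieq (.arr 5 (.arr b (.var 10))) (.arr 5 (.arr a (.var 10)))))))
    (.rstore 3 (.arr 5 (.arr a (.var 10)))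
      (.add (.arr 3 (.arr 5 (.arr a (.var 10)))) (.arr 0 (.var 10))))
    .skip

/-- Compute the weights of the cuts found for all classes. -/
def weigh : Prog := .forLoop 10 (.var 1) (tally 0 1 ;; tally 1 0)

/-- Mark the vertices in the cuts of weight at most `lam`, except for the cut around `s`. -/
def markCuts : Prog :=
  .forLoop 9 (.var 0)
    (.branch (.and (.not (.ieq (.arr 14 (.arr 9 (.var 9))) (.lit 0)))
        (.and (.not (.ieq (.arr 5 (.var 9)) (.arr 5 (.var 2))))
          (.rle (.arr 3 (.arr 5 (.var 9))) (.var 0))))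
      (.istore 2 (.var 9) (.lit 1)) .skip)

/-- Compute minimum isolating cuts for the terminals, and mark the vertices in those that do not
contain `s` and have weight at most `lam`. -/
def isolate : Prog := classify ;; classCut ;; weigh ;; markCuts

/-- The vertices of the class `κ` that have been reached by the last graph search. -/
def found (σ : State) (κ : ℕ) : Set ℕ := {x | σ.ia 14 (σ.ia 9 x) ≠ 0 ∧ σ.ia 5 x = κ}

section

variable {O : FlowOracle} {ω : ℕ → Bool} {σ : State} {G : WGraph} {s : ℕ} {lam : ℝ}

open Classical in
theorem tally_run (a b κ : ℕ) : ((tally a b).run O ω σ).ra 3 κ = σ.ra 3 κ +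
    if σ.ia a (σ.iv 10) ∈ found σ κ ∧ σ.ia b (σ.iv 10) ∉ found σ κ then σ.ra 0 (σ.iv 10)
    else 0 := by
  by_cases h1 : σ.ia 14 (σ.ia 9 (σ.ia a (σ.iv 10))) = 0
  · simp [tally, Prog.run, BExp.Holds, IExp.eval, h1, found]
  by_cases h2 : σ.ia 5 (σ.ia a (σ.iv 10)) = κ
  · subst h2
    by_cases h3 : σ.ia 14 (σ.ia 9 (σ.ia b (σ.iv 10))) = 0 <;>
      by_cases h4 : σ.ia 5 (σ.ia b (σ.iv 10)) = σ.ia 5 (σ.ia a (σ.iv 10)) <;>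
      simp [tally, Prog.run, BExp.Holds, IExp.eval, RExp.eval, State.storeR, h1, h3, h4, found]
  · by_cases h3 : σ.ia 14 (σ.ia 9 (σ.ia b (σ.iv 10))) = 0 <;>
      by_cases h4 : σ.ia 5 (σ.ia b (σ.iv 10)) = σ.ia 5 (σ.ia a (σ.iv 10)) <;>
      simp [tally, Prog.run, BExp.Holds, IExp.eval, RExp.eval, State.storeR, h1, h2, h3, h4, found,
        Ne.symm h2]

theorem Run.weigh (hσ : Static G s lam σ) :
    Run O ω weigh σ (8 * G.m + 2) fun τ => ∀ κ, τ.ra 3 κ = σ.ra 3 κ + G.cut (found σ κ) := by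
  classical
  refine Run.forLoop (t₁ := 6) G.m (fun i τ => ∀ κ, τ.ra 3 κ = σ.ra 3 κ +
    ∑ e ∈ Finset.range i, if WGraph.Crosses (found σ κ) (σ.ia 0 e) (σ.ia 1 e) then σ.ra 0 e else 0)
    rfl (fun τ hF => (hF.iv 1 rfl).trans hσ.m) (by simp [State.setI]) ?_ ?_ (by omega)
  · intro i hi τ hF h10 h
    refine Run.straight rfl le_rfl fun κ => ?_
    obtain ⟨T, -, he⟩ := Exec.straight (O := O) (ω := ω) (p := tally 0 1) rfl τ
    have hF' := he.frame
    change ((tally 1 0).run O ω ((tally 0 1).run O ω τ)).ra 3 κ = _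
    have e1 : found ((tally 0 1).run O ω τ) κ = found σ κ := by
      simp only [found, hF'.ia 14 rfl, hF'.ia 9 rfl, hF'.ia 5 rfl, hF.ia 14 rfl, hF.ia 9 rfl,
        hF.ia 5 rfl]
    have e2 : found τ κ = found σ κ := by
      simp only [found, hF.ia 14 rfl, hF.ia 9 rfl, hF.ia 5 rfl]
    rw [tally_run, tally_run, e1, e2, hF'.ia 0 rfl, hF'.ia 1 rfl, hF'.ra 0 rfl, hF'.iv 10 rfl, h10,
      h κ, Finset.sum_range_succ, hF.ia 0 rfl, hF.ia 1 rfl, hF.ra 0 rfl]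
    by_cases k1 : σ.ia 0 i ∈ found σ κ <;> by_cases k2 : σ.ia 1 i ∈ found σ κ <;>
      simp [WGraph.Crosses, k1, k2, add_assoc]
  · intro τ hF h κ
    rw [h κ, WGraph.cut, Finset.sum_range]
    congr 1
    refine Finset.sum_congr rfl fun e _ => ?_
    rw [hσ.src, hσ.dst, hσ.wt]

theorem Run.markCuts (hσ : Static G s lam σ) :
    Run O ω markCuts σ (5 * G.n + 2) fun τ => ∀ x, τ.ia 2 x ≠ 0 ↔ σ.ia 2 x ≠ 0 ∨
      x < G.n ∧ x ∈ found σ (σ.ia 5 x) ∧ σ.ia 5 x ≠ σ.ia 5 s ∧ σ.ra 3 (σ.ia 5 x) ≤ lam := by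
  refine Run.forLoop (t₁ := 3) G.n (fun i τ => ∀ x, τ.ia 2 x ≠ 0 ↔ σ.ia 2 x ≠ 0 ∨
      x < i ∧ x ∈ found σ (σ.ia 5 x) ∧ σ.ia 5 x ≠ σ.ia 5 s ∧ σ.ra 3 (σ.ia 5 x) ≤ lam)
    rfl (fun τ hF => (hF.iv 0 rfl).trans hσ.n) (by simp [State.setI]) ?_ (fun τ _ h => h) (by omega)
  intro i hi τ hF h9 h
  refine Run.straight rfl le_rfl fun x => ?_
  have f14 : τ.ia 14 = σ.ia 14 := hF.ia 14 rfl
  have f9 : τ.ia 9 = σ.ia 9 := hF.ia 9 rfl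
  have f5 : τ.ia 5 = σ.ia 5 := hF.ia 5 rfl
  have f3 : τ.ra 3 = σ.ra 3 := hF.ra 3 rfl
  have hτ := hσ.frame hF rfl
  have hx := h x
  have hlt : x ≠ i → (x < i + 1 ↔ x < i) := fun h => by omega
  by_cases hc : i ∈ found σ (σ.ia 5 i) ∧ σ.ia 5 i ≠ σ.ia 5 s ∧ σ.ra 3 (σ.ia 5 i) ≤ lam
  · obtain ⟨⟨h1, -⟩, h2, h3⟩ := hc
    by_cases hxi : x = i
    · subst hxi
      simp [Prog.run, BExp.Holds, IExp.eval, RExp.eval, State.setI, State.storeI, h9, f14, f9, f5,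
        f3, hτ.s, hτ.lam, h1, h2, h3, found]
    · simpa [Prog.run, BExp.Holds, IExp.eval, RExp.eval, State.setI, State.storeI, h9, f14, f9, f5,
        f3, hτ.s, hτ.lam, h1, h2, h3, found, hxi, hlt] using hx
  · have hc' : ¬ (σ.ia 14 (σ.ia 9 i) ≠ 0 ∧ σ.ia 5 i ≠ σ.ia 5 s ∧ σ.ra 3 (σ.ia 5 i) ≤ lam) :=
      fun k => hc ⟨⟨k.1, rfl⟩, k.2⟩
    rw [Prog.run, if_neg (by simpa [BExp.Holds, IExp.eval, RExp.eval, h9, f14, f9, f5, f3, hτ.s,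
      hτ.lam] using hc')]
    change τ.ia 2 x ≠ 0 ↔ _
    rw [hx]
    by_cases hxi : x = i
    · subst hxi
      simp only [lt_self_iff_false, hc, and_false]
    · rw [hlt hxi]

/-- Only vertices in the threshold set get marked, and the smallest sides of the isolated vertices in
the threshold set get marked. -/
theorem Run.isolate (hO : O.Correct) (hG : G.WF) (hs : s < G.n) (hσ : Static G s lam σ)
    (hsσ : s ∈ terminals G σ) :
    Run O ω isolate σ ((G.n.size + 1) * (420 * (G.n + G.m))) fun τ =>
      (∃ l, (∀ I ∈ l, GoodCall G I) ∧ l.length = G.n.size + 1 ∧ τ.calls = σ.calls ++ l) ∧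
      (∀ x, σ.ia 2 x ≠ 0 → τ.ia 2 x ≠ 0) ∧
      (∀ x, τ.ia 2 x ≠ 0 → σ.ia 2 x ≠ 0 ∨ x ∈ G.cutThresholdSet s lam) ∧
      ∀ v, G.Isolated s (terminals G σ) v → G.mincut s v ≤ lam →
        ∀ x ∈ G.minSide s v, τ.ia 2 x ≠ 0 := by
  have hn : 0 < G.n := by omega
  refine Run.seq (t₂ := 210 * (G.n + G.m)) (Run.classify hO hG hn hσ) ?_ ?_
  swap
  · have h1 := Nat.add_mul G.n.size 1 (210 * (G.n + G.m))
    have h2 := Nat.add_mul G.n.size 1 (420 * (G.n + G.m))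
    have h3 : G.n.size * (210 * (G.n + G.m)) ≤ G.n.size * (420 * (G.n + G.m)) :=
      Nat.mul_le_mul_left _ (by omega)
    omega
  rintro σ₁ ⟨⟨l, hl, hlen, hcalls⟩, hinj, hiso⟩ hF₁
  have hσ₁ := hσ.frame hF₁ rfl
  have hR : terminals G σ₁ = terminals G σ := by simp only [terminals, hF₁.ia 3 rfl]
  refine Run.seq (t₂ := 10 * (G.n + G.m)) (Run.classCut hO hG hn hσ₁) ?_ (by omega)
  rintro σ₂ ⟨⟨I, hI, hcalls₂⟩, hacc, X, hRX, hmin, hX⟩ hF₂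
  have hσ₂ := hσ₁.frame hF₂ rfl
  have f5 : σ₂.ia 5 = σ₁.ia 5 := hF₂.ia 5 rfl
  rw [hR] at hRX hmin
  refine Run.seq (t₂ := 5 * G.n + 2) (Run.weigh hσ₂) ?_ (by omega)
  rintro σ₃ h₃ hF₃
  have hσ₃ := hσ₂.frame hF₃ rfl
  have g5 : σ₃.ia 5 = σ₁.ia 5 := (hF₃.ia 5 rfl).trans f5
  have hfound : ∀ κ, found σ₃ κ = found σ₂ κ := fun κ => by
    simp only [found, hF₃.ia 14 rfl, hF₃.ia 9 rfl, hF₃.ia 5 rfl]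
  have hweight : ∀ x < G.n, σ₃.ra 3 (σ₁.ia 5 x) = G.cut (found σ₂ (σ₁.ia 5 x)) := by
    intro x hx
    rw [h₃, hacc x hx, zero_add]
  have hmem : ∀ x < G.n, ∀ κ, x ∈ found σ₂ κ ↔ x ∈ {x | x ∈ X ∧ σ₁.ia 5 x = κ} := by
    intro x hx κ
    simp only [found, Set.mem_ofPred_eq, hX x hx, f5]
  refine Run.mono (Run.markCuts hσ₃) ?_ le_rfl
  intro τ hτ hF₄
  have hm : σ₃.ia 2 = σ.ia 2 := by rw [hF₃.ia 2 rfl, hF₂.ia 2 rfl, hF₁.ia 2 rfl]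
  simp only [g5, hm, hfound] at hτ
  refine ⟨⟨l ++ [I], ?_, by simp [hlen], ?_⟩, fun x hx => (hτ x).2 (Or.inl hx), fun x hx => ?_,
    fun v hv hvl x hx => (hτ x).2 (Or.inr ?_)⟩
  · simpa [or_imp, forall_and, hI] using hl
  · rw [hF₄.calls rfl, hF₃.calls rfl, hcalls₂, hcalls, List.append_assoc]
  · rcases (hτ x).1 hx with h | ⟨hxn, hxf, hxs, hxl⟩
    · exact Or.inl h
    · refine Or.inr ⟨hxn, fun h => hxs (by rw [h]), ?_⟩
      rw [hweight x hxn] at hxl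
      refine (WGraph.mincut_le_cut hG hxn hxf fun h => hxs ?_).trans hxl
      rw [← f5]
      exact (h.2.trans (by rw [f5])).symm
  · obtain ⟨hsub, hle⟩ := hv.subset hG hsσ hinj (hiso v hv) hRX hmin
    have hxn := (WGraph.mincut_le_of_mem_minSide hG hv.1 hv.2.1 hx).1
    have hxv := hiso v hv x hx
    refine ⟨hxn, ?_, ?_, ?_⟩
    · rw [hxv]
      exact (hmem x hxn _).2 (hsub (by simpa using hx))
    · rw [hxv]
      exact fun h => hv.2.1 (hinj v hv.2.2.1 s hsσ h)
    · rw [hweight x hxn, hxv, G.cut_congr hG fun y hy => hmem y hy _]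
      exact hle.trans hvl

end

/-! ### Random sampling of the terminals -/

/-- Toss a coin for each vertex, and remove the vertex from the set of terminals if the outcome is
`0`; but keep the vertex `s`. -/
def subsample : Prog :=
  .forLoop 9 (.var 0)
    (.coin 17 ;;
     .branch (.and (.ieq (.var 17) (.lit 0)) (.not (.ieq (.var 9) (.var 2))))
       (.istore 3 (.var 9) (.lit 0)) .skip)

/-- Start with all vertices as terminals that have not been marked. On each level, compute isolating
cuts, and then halve the set of terminals at random. -/
def phase : Prog :=
  .forLoop 9 (.var 0)
    (.branch (.ieq (.arr 2 (.var 9)) (.lit 0))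
      (.istore 3 (.var 9) (.lit 1)) (.istore 3 (.var 9) (.lit 0))) ;;
  .forLoop 7 (.var 4) (isolate ;; subsample)

/-- The terminals on level `i` of a phase that starts with the set `Y` of marked vertices and with
the coin number `c`: on level `j`, the coin for the vertex `x` is the one with number
`c + j * G.n + x`. -/
def sample (G : WGraph) (s : ℕ) (Y : Set ℕ) (ω : ℕ → Bool) (c i : ℕ) : Set ℕ :=
  {x | x < G.n ∧ x ∉ Y ∧ (x = s ∨ ∀ j < i, ω (c + j * G.n + x) = true)}

/-- The vertices marked in the output array. -/
def marked (σ : State) : Set ℕ := {x | σ.ia 2 x ≠ 0}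

section

variable {O : FlowOracle} {ω : ℕ → Bool} {σ : State} {G : WGraph} {s : ℕ} {lam : ℝ}

theorem Run.subsample (hσ : Static G s lam σ) :
    Run O ω subsample σ (6 * G.n + 2) fun τ => τ.coins = σ.coins + G.n ∧
      ∀ x < G.n, τ.ia 3 x ≠ 0 ↔ σ.ia 3 x ≠ 0 ∧ (x = s ∨ ω (σ.coins + x) = true) := by
  refine Run.forLoop (t₁ := 4) G.n (fun i τ => τ.coins = σ.coins + i ∧
      (∀ x < i, τ.ia 3 x ≠ 0 ↔ σ.ia 3 x ≠ 0 ∧ (x = s ∨ ω (σ.coins + x) = true)) ∧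
      ∀ x, i ≤ x → τ.ia 3 x = σ.ia 3 x)
    rfl (fun τ hF => (hF.iv 0 rfl).trans hσ.n) (by simp [State.setI]) ?_
    (fun τ _ h => ⟨h.1, h.2.1⟩) (by omega)
  rintro i hi τ hF h9 ⟨hc, hlo, hhi⟩
  have h2 : τ.iv 2 = s := (hF.iv 2 rfl).trans hσ.s
  have h3 := hhi i le_rfl
  refine Run.straight rfl le_rfl ⟨?_, fun x hx => ?_, fun x hx => ?_⟩
  · by_cases k1 : ω (σ.coins + i) = true <;> by_cases k2 : i = s <;>
      simp [Prog.run, BExp.Holds, IExp.eval, State.setI, State.storeI, State.toss, h9, h2, hc, k1,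
        k2, add_assoc]
  · by_cases hxi : x = i
    · subst hxi
      by_cases k1 : ω (σ.coins + x) = true <;> by_cases k2 : x = s <;>
        simp [Prog.run, BExp.Holds, IExp.eval, State.setI, State.storeI, State.toss, h9, h2, hc, k1,
          k2, h3]
      all_goals simp_all
    · have := hlo x (by omega)
      by_cases k1 : ω (σ.coins + i) = true <;> by_cases k2 : i = s <;>
        simp [Prog.run, BExp.Holds, IExp.eval, State.setI, State.storeI, State.toss, h9, h2, hc, k1,
          k2, hxi] <;> simp_all
  · have := hhi x (by omega)
    have hxi : x ≠ i := by omega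
    by_cases k1 : ω (σ.coins + i) = true <;> by_cases k2 : i = s <;>
      simp [Prog.run, BExp.Holds, IExp.eval, State.setI, State.storeI, State.toss, h9, h2, hc, k1,
        k2, hxi, this]

/-- The guarantees of `isolate` for all levels of a phase. The number of coins that a phase consumes
does not depend on their outcome. -/
theorem Run.phase (hO : O.Correct) (hG : G.WF) (hs : s < G.n) (hσ : Static G s lam σ)
    (hsσ : s ∉ marked σ) :
    Run O ω phase σ ((G.n.size + 3) * ((G.n.size + 1) * (440 * (G.n + G.m)))) fun τ =>
      (∃ l, (∀ I ∈ l, GoodCall G I) ∧ l.length = (G.n.size + 2) * (G.n.size + 1) ∧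
        τ.calls = σ.calls ++ l) ∧
      τ.coins = σ.coins + (G.n.size + 2) * G.n ∧
      marked σ ⊆ marked τ ∧ marked τ ⊆ marked σ ∪ G.cutThresholdSet s lam ∧
      ∀ i < G.n.size + 2, ∀ v, G.Isolated s (sample G s (marked σ) ω σ.coins i) v →
        G.mincut s v ≤ lam → (G.minSide s v : Set ℕ) ⊆ marked τ := by
  have ht : (5 * G.n + 2) + ((G.n.size + 2) *
      ((G.n.size + 1) * (420 * (G.n + G.m)) + (6 * G.n + 2) + 2) + 2) ≤
      (G.n.size + 3) * ((G.n.size + 1) * (440 * (G.n + G.m))) := by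
    have h1 : (G.n.size + 1) * (420 * (G.n + G.m)) + (6 * G.n + 2) + 2 ≤
        (G.n.size + 1) * (440 * (G.n + G.m)) := by nlinarith
    have h2 := Nat.mul_le_mul_left (G.n.size + 2) h1
    nlinarith
  refine Run.seq (P := fun τ => ∀ x < G.n, τ.ia 3 x ≠ 0 ↔ x ∉ marked σ) ?_ ?_ ht
  · refine Run.forLoop (t₁ := 3) G.n (fun i τ => ∀ x < i, τ.ia 3 x ≠ 0 ↔ x ∉ marked σ) rfl
      (fun τ hF => (hF.iv 0 rfl).trans hσ.n) (by simp) ?_ (fun τ _ h => h) (by omega)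
    intro i hi τ hF h9 h
    have f2 : τ.ia 2 = σ.ia 2 := hF.ia 2 rfl
    refine Run.straight rfl le_rfl fun x hx => ?_
    by_cases hxi : x = i
    · subst hxi
      by_cases h1 : σ.ia 2 x = 0 <;>
        simp [Prog.run, BExp.Holds, IExp.eval, State.setI, State.storeI, h9, f2, h1, marked]
    · have := h x (by omega)
      by_cases h1 : σ.ia 2 i = 0 <;>
        simpa [Prog.run, BExp.Holds, IExp.eval, State.setI, State.storeI, h9, f2, h1, hxi] using this
  intro σ₁ h₁ hF₁
  have hσ₁ := hσ.frame hF₁ rfl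
  have hm₁ : marked σ₁ = marked σ := by simp only [marked, hF₁.ia 2 rfl]
  refine Run.forLoop (t₁ := (G.n.size + 1) * (420 * (G.n + G.m)) + (6 * G.n + 2)) (G.n.size + 2)
    (fun i τ => terminals G τ = sample G s (marked σ) ω σ.coins i ∧
      (∃ l, (∀ I ∈ l, GoodCall G I) ∧ l.length = i * (G.n.size + 1) ∧ τ.calls = σ.calls ++ l) ∧
      τ.coins = σ.coins + i * G.n ∧
      marked σ ⊆ marked τ ∧ marked τ ⊆ marked σ ∪ G.cutThresholdSet s lam ∧
      ∀ j < i, ∀ v, G.Isolated s (sample G s (marked σ) ω σ.coins j) v →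
        G.mincut s v ≤ lam → (G.minSide s v : Set ℕ) ⊆ marked τ)
    rfl (fun τ hF => (hF.iv 4 rfl).trans hσ₁.levels) ?_ ?_ (fun τ _ h => h.2) le_rfl
  · refine ⟨?_, ⟨[], by simp, by simp, by simpa [State.setI] using hF₁.calls rfl⟩,
      by simpa [State.setI] using hF₁.coins rfl, hm₁.superset, hm₁.subset.trans Set.subset_union_left,
      by simp⟩
    ext x
    simp only [terminals, sample, Set.mem_ofPred_eq, not_lt_zero, false_implies, implies_true,
      or_true, and_true]
    exact and_congr_right fun hx => h₁ x hx
  rintro i hi τ hF h7 ⟨hterm, ⟨l, hl, hlen, hcalls⟩, hcoins, hmono, hsound, hcompl⟩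
  have hτ := hσ₁.frame hF rfl
  have hsτ : s ∈ terminals G τ := by
    rw [hterm]
    exact ⟨hs, hsσ, Or.inl rfl⟩
  refine Run.seq (Run.isolate hO hG hs hτ hsτ) ?_ le_rfl
  rintro τ₁ ⟨⟨l₁, hl₁, hlen₁, hcalls₁⟩, hmono₁, hsound₁, hcompl₁⟩ hG₁
  have hτ₁ := hτ.frame hG₁ rfl
  refine (Run.subsample hτ₁).mono ?_ le_rfl
  rintro τ₂ ⟨hcoins₂, h₂⟩ hG₂
  rw [hterm] at hcompl₁
  have hc₁ : τ₁.coins = σ.coins + i * G.n := (hG₁.coins rfl).trans hcoins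
  have hm : marked (τ₂.setI 7 (i + 1)) = marked τ₁ := by
    change marked τ₂ = marked τ₁
    simp only [marked, hG₂.ia 2 rfl]
  rw [hm]
  have hmτ : marked τ ⊆ marked τ₁ := hmono₁
  refine ⟨?_, ⟨l ++ l₁, ?_, by rw [List.length_append, hlen, hlen₁, Nat.succ_mul], ?_⟩, ?_,
    hmono.trans hmτ, ?_, ?_⟩
  · ext x
    have hx : x < G.n → (τ.ia 3 x ≠ 0 ↔ x ∈ sample G s (marked σ) ω σ.coins i) := fun hx => by
      rw [← hterm]
      exact ⟨fun h => ⟨hx, h⟩, fun h => h.2⟩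
    change x < G.n ∧ τ₂.ia 3 x ≠ 0 ↔ _
    constructor
    · rintro ⟨hxn, h⟩
      rw [h₂ x hxn, hG₁.ia 3 rfl, hx hxn, hc₁] at h
      obtain ⟨⟨-, h1, h2⟩, h3⟩ := h
      refine ⟨hxn, h1, ?_⟩
      rcases h3 with h3 | h3
      · exact Or.inl h3
      · refine h2.imp_right fun h2 j hj => ?_
        rcases Nat.lt_succ_iff_lt_or_eq.1 hj with hj | rfl
        exacts [h2 j hj, h3]
    · rintro ⟨hxn, h1, h2⟩
      refine ⟨hxn, ?_⟩
      rw [h₂ x hxn, hG₁.ia 3 rfl, hx hxn, hc₁]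
      exact ⟨⟨hxn, h1, h2.imp_right fun h2 j hj => h2 j (by omega)⟩, h2.imp_right fun h2 =>
        h2 i (by omega)⟩
  · simp only [List.mem_append]
    rintro I (h | h)
    exacts [hl I h, hl₁ I h]
  · change τ₂.calls = _
    rw [hG₂.calls rfl, hcalls₁, hcalls, List.append_assoc]
  · change τ₂.coins = _
    rw [hcoins₂, hc₁, Nat.succ_mul, add_assoc]
  · intro x hx
    rcases hsound₁ x hx with h | h
    exacts [hsound h, Or.inr h]
  · intro j hj v hv hvl
    rcases Nat.lt_succ_iff_lt_or_eq.1 hj with hj | rfl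
    · exact (hcompl j hj v hv hvl).trans hmτ
    · exact fun x hx => hcompl₁ v hv hvl x (by simpa using hx)

end

/-! ### The expected progress of a phase -/

open MeasureTheory

instance : IsProbabilityMeasure coinLaw := by
  unfold coinLaw
  infer_instance

theorem coinLaw_forall_eq_true (S : Finset ℕ) :
    coinLaw.real {ω | ∀ i ∈ S, ω i = true} = (1 / 2) ^ S.card := by
  have h : {ω : ℕ → Bool | ∀ i ∈ S, ω i = true} = Set.pi S fun _ => {true} := by
    ext ω
    simp [Set.mem_pi]
  rw [Measure.real, h, coinLaw, Measure.infinitePi_pi _ (by simp)]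
  simp

/-- The random tape that agrees with `ω` before the coin number `c`, and with `η` from there on. -/
def splice (c : ℕ) (ω η : ℕ → Bool) (i : ℕ) : Bool := if i < c then ω i else η i

theorem measurable_splice (c : ℕ) :
    Measurable fun p : (ℕ → Bool) × (ℕ → Bool) => splice c p.1 p.2 := by
  refine measurable_pi_lambda _ fun i => ?_
  unfold splice
  split_ifs
  · exact (measurable_pi_apply i).comp measurable_fst
  · exact (measurable_pi_apply i).comp measurable_snd

/-- The coins from number `c` on may be tossed anew. -/
theorem map_splice (c : ℕ) :
    (coinLaw.prod coinLaw).map (fun p => splice c p.1 p.2) = coinLaw := by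
  refine Measure.eq_infinitePi _ fun S t ht => ?_
  rw [Measure.map_apply (measurable_splice c)
    (MeasurableSet.pi S.countable_toSet fun i _ => ht i)]
  have h : (fun p : (ℕ → Bool) × (ℕ → Bool) => splice c p.1 p.2) ⁻¹' Set.pi S t =
      (Set.pi (S.filter (· < c)) t) ×ˢ (Set.pi (S.filter (¬ · < c)) t) := by
    ext ⟨ω, η⟩
    simp only [Set.mem_preimage, Set.mem_pi, Set.mem_prod, splice, Finset.coe_filter]
    constructor
    · refine fun h => ⟨fun i hi => ?_, fun i hi => ?_⟩
      · simpa [hi.2] using h i hi.1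
      · have := h i hi.1
        rwa [if_neg hi.2] at this
    · rintro ⟨h1, h2⟩ i hi
      split_ifs with hc
      exacts [h1 i ⟨hi, hc⟩, h2 i ⟨hi, hc⟩]
  rw [h, Measure.prod_prod, coinLaw, Measure.infinitePi_pi _ (fun i _ => ht i),
    Measure.infinitePi_pi _ (fun i _ => ht i), Finset.prod_filter_mul_prod_filter_not]

/-- A function of finitely many coins is measurable. -/
theorem measurable_of_finite_coins {α : Type*} [MeasurableSpace α] {f : (ℕ → Bool) → α} (N : ℕ)
    (h : ∀ ω ω' : ℕ → Bool, (∀ i < N, ω i = ω' i) → f ω = f ω') : Measurable f := by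
  let ext : (Fin N → Bool) → ℕ → Bool := fun x i => if hi : i < N then x ⟨i, hi⟩ else false
  have hf : f = (f ∘ ext) ∘ fun ω i => ω (i : Fin N) := by
    funext ω
    refine h _ _ fun i hi => ?_
    simp [ext, hi]
  rw [hf]
  exact (measurable_of_countable _).comp
    (measurable_pi_lambda _ fun i => measurable_pi_apply _)

/-- If the expectation of a bounded non-negative function `g` over the coins from number `c` on is at
most `ρ` times a function of the earlier coins, then so are the total expectations. -/
theorem integral_le_of_splice {f g : (ℕ → Bool) → ℝ} (hf : Measurable f) (hg : Measurable g)
    {b : ℝ} (hfb : ∀ ω, |f ω| ≤ b) (hgb : ∀ ω, |g ω| ≤ b) (c : ℕ) (ρ : ℝ)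
    (h : ∀ ω, ∫ η, g (splice c ω η) ∂coinLaw ≤ ρ * f ω) :
    ∫ ω, g ω ∂coinLaw ≤ ρ * ∫ ω, f ω ∂coinLaw := by
  have hgi : Integrable (fun p : (ℕ → Bool) × (ℕ → Bool) => g (splice c p.1 p.2))
      (coinLaw.prod coinLaw) :=
    Integrable.of_bound (hg.comp (measurable_splice c)).aestronglyMeasurable b
      (Filter.Eventually.of_forall fun p => hgb _)
  have hfi : Integrable f coinLaw :=
    Integrable.of_bound hf.aestronglyMeasurable b (Filter.Eventually.of_forall fun p => hfb _)
  have h1 : ∫ ω, g ω ∂coinLaw = ∫ ω, ∫ η, g (splice c ω η) ∂coinLaw ∂coinLaw := by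
    conv_lhs => rw [← map_splice c]
    rw [integral_map (measurable_splice c).aemeasurable hg.aestronglyMeasurable, integral_prod _ hgi]
  rw [h1, ← integral_const_mul]
  exact integral_mono hgi.integral_prod_left (hfi.const_mul ρ) h

section

variable {G : WGraph} {s : ℕ} {lam : ℝ}

open Classical in
/-- The vertices of the threshold set that do not belong to `Y`. -/
noncomputable def missing (G : WGraph) (s : ℕ) (lam : ℝ) (Y : Set ℕ) : Finset ℕ :=
  (Finset.range G.n).filter fun v => v ∈ G.cutThresholdSet s lam ∧ v ∉ Y

theorem mem_missing {Y : Set ℕ} {v : ℕ} :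
    v ∈ missing G s lam Y ↔ v ∈ G.cutThresholdSet s lam ∧ v ∉ Y := by
  simp only [missing, Finset.mem_filter, Finset.mem_range, and_iff_right_iff_imp]
  exact fun h => h.1.1

theorem card_missing_le (Y : Set ℕ) : (missing G s lam Y).card ≤ G.n := by
  classical
  exact (Finset.card_filter_le _ _).trans_eq (Finset.card_range _)

/-- The number of missing vertices on the smallest side for `v`. -/
noncomputable def sideSize (G : WGraph) (s : ℕ) (lam : ℝ) (Y : Set ℕ) (v : ℕ) : ℕ :=
  (G.minSide s v ∩ missing G s lam Y).card

open Classical in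
/-- On each level the smallest sides of isolated vertices are disjoint. So if every vertex `v` is
assigned to one of `L` levels, then the sides of the vertices isolated on their levels cover no
vertex more than `L` times. -/
theorem sum_isolated_le (hG : G.WF) {Y Y' : Set ℕ} {r : ℕ → Set ℕ} {lvl : ℕ → ℕ} {L : ℕ}
    (hlvl : ∀ v ∈ missing G s lam Y, lvl v < L)
    (hY' : ∀ i < L, ∀ v, G.Isolated s (r i) v → G.mincut s v ≤ lam →
      (G.minSide s v : Set ℕ) ⊆ Y') :
    ∑ v ∈ missing G s lam Y, (if G.Isolated s (r (lvl v)) v then sideSize G s lam Y v else 0) ≤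
      L * ((missing G s lam Y).filter (· ∈ Y')).card := by
  rw [← Finset.sum_fiberwise_of_maps_to (t := Finset.range L) (g := lvl)
    fun v hv => Finset.mem_range.2 (hlvl v hv)]
  refine (Finset.sum_le_card_nsmul _ _ _ fun i hi => ?_).trans_eq (by
    rw [Finset.card_range, smul_eq_mul])
  rw [← Finset.sum_filter]
  unfold sideSize
  rw [← Finset.card_biUnion]
  · refine Finset.card_le_card fun u hu => ?_
    simp only [Finset.mem_biUnion, Finset.mem_filter, Finset.mem_inter] at hu ⊢
    obtain ⟨v, ⟨⟨hv, rfl⟩, hiso⟩, huv, hu⟩ := hu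
    exact ⟨hu, hY' _ (hlvl v hv) v hiso (mem_missing.1 hv).1.2.2 (by simpa using huv)⟩
  · intro v hv v' hv' hne
    simp only [Finset.coe_filter, Finset.mem_filter, Set.mem_ofPred_eq] at hv hv'
    obtain ⟨⟨-, hlv⟩, hvn, hvs, hvr, hiso⟩ := hv
    obtain ⟨⟨-, hlv'⟩, hvn', hvs', hvr', hiso'⟩ := hv'
    rw [hlv] at hvr hiso
    rw [hlv'] at hvr' hiso'
    exact (WGraph.disjoint_minSide hG hvn hvs hvn' hvs' (fun h => hne (hiso' v h hvr))
      (fun h => hne (hiso v' h hvr').symm)).mono Finset.inter_subset_left Finset.inter_subset_left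

/-- A vertex whose smallest side has `k` missing vertices is isolated with probability at least
`1 / (8 * k)` on the level where the sampling rate lies between `1 / (4 * k)` and `1 / (2 * k)`. For
this, the union bound over the other missing vertices on the side is sufficient. -/
theorem isolated_prob (hG : G.WF) {Y : Set ℕ} {v : ℕ} (hv : v ∈ missing G s lam Y) (c : ℕ) :
    1 / (8 * (sideSize G s lam Y v : ℝ)) ≤ coinLaw.real {η | G.Isolated s
      (sample G s Y η c ((sideSize G s lam Y v).size + 1)) v} := by
  classical
  set k := sideSize G s lam Y v with hk
  set i := k.size + 1 with hi
  obtain ⟨⟨hvn, hvs, hvl⟩, hvY⟩ := mem_missing.1 hv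
  obtain ⟨-, hvM, hsM, -, -⟩ := WGraph.minSide_spec hG hvn hvs
  have hn : 0 < G.n := by omega
  have hvA : v ∈ G.minSide s v ∩ missing G s lam Y := Finset.mem_inter.2 ⟨hvM, hv⟩
  have hkpos : 0 < k := Finset.card_pos.2 ⟨v, hvA⟩
  -- the coins that decide on the vertex `u`
  let coins : ℕ → Finset ℕ := fun u => (Finset.range i).image fun j => c + j * G.n + u
  have hcard : ∀ u, (coins u).card = i := fun u => by
    rw [Finset.card_image_of_injective _ fun j j' h => ?_, Finset.card_range]
    simp only [Nat.add_right_cancel_iff, Nat.add_left_cancel_iff] at h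
    exact Nat.eq_of_mul_eq_mul_right hn h
  have hdisj : ∀ u < G.n, u ≠ v → Disjoint (coins u) (coins v) := by
    intro u hu huv
    rw [Finset.disjoint_left]
    intro x hx hx'
    simp only [coins, Finset.mem_image] at hx hx'
    obtain ⟨j, -, rfl⟩ := hx
    obtain ⟨j', -, h⟩ := hx'
    have h2 : j' * G.n + v = j * G.n + u := by omega
    have h3 := congrArg (· % G.n) h2
    simp only [Nat.mul_add_mod', Nat.mod_eq_of_lt hu,
      Nat.mod_eq_of_lt hvn] at h3
    exact huv h3.symm
  let E : Finset ℕ → Set (ℕ → Bool) := fun S => {ω | ∀ i ∈ S, ω i = true}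
  have hsub : E (coins v) ⊆ {η | G.Isolated s (sample G s Y η c i) v} ∪
      ⋃ u ∈ (G.minSide s v ∩ missing G s lam Y).erase v, E (coins u ∪ coins v) := by
    intro η hη
    by_cases hiso : G.Isolated s (sample G s Y η c i) v
    · exact Or.inl hiso
    · have hvr : v ∈ sample G s Y η c i :=
        ⟨hvn, hvY, Or.inr fun j hj => hη _ (Finset.mem_image.2 ⟨j, Finset.mem_range.2 hj, rfl⟩)⟩
      have : ∃ u ∈ G.minSide s v, u ∈ sample G s Y η c i ∧ u ≠ v := by
        by_contra! hcon
        exact hiso ⟨hvn, hvs, hvr, hcon⟩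
      obtain ⟨u, hu, ⟨hun, huY, hur⟩, huv⟩ := this
      obtain ⟨-, hus, hul⟩ := WGraph.mincut_le_of_mem_minSide hG hvn hvs hu
      refine Or.inr (Set.mem_biUnion (Finset.mem_erase.2 ⟨huv, Finset.mem_inter.2
        ⟨hu, mem_missing.2 ⟨⟨hun, hus, hul.trans hvl⟩, huY⟩⟩⟩) ?_)
      intro x hx
      rcases Finset.mem_union.1 hx with hx | hx
      · obtain ⟨j, hj, rfl⟩ := Finset.mem_image.1 hx
        exact hur.resolve_left hus j (Finset.mem_range.1 hj)
      · exact hη x hx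
  have h1 := (measureReal_mono (μ := coinLaw) hsub).trans (measureReal_union_le _ _)
  have h2 : coinLaw.real (⋃ u ∈ (G.minSide s v ∩ missing G s lam Y).erase v,
      E (coins u ∪ coins v)) ≤ (k - 1 : ℝ) * ((1 / 2) ^ i * (1 / 2) ^ i) := by
    refine (measureReal_biUnion_finset_le _ _).trans ?_
    rw [Finset.sum_congr rfl (g := fun _ => ((1 / 2 : ℝ) ^ i * (1 / 2) ^ i))]
    · rw [Finset.sum_const, Finset.card_erase_of_mem hvA, nsmul_eq_mul, ← sideSize, ← hk,
        Nat.cast_pred hkpos]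
    · intro u hu
      simp only [Finset.mem_erase, Finset.mem_inter] at hu
      rw [coinLaw_forall_eq_true, Finset.card_union_of_disjoint
        (hdisj u (mem_missing.1 hu.2.2).1.1 hu.1), hcard, hcard, pow_add]
  rw [coinLaw_forall_eq_true, hcard] at h1
  -- the sampling rate `(1 / 2) ^ i` lies between `1 / (4 * k)` and `1 / (2 * k)`
  have hlow : (2 * k : ℝ) ≤ 2 ^ i := by
    have := Nat.lt_size_self k
    rw [hi, pow_succ, mul_comm]
    gcongr
    exact_mod_cast this.le
  have hup : (2 : ℝ) ^ i ≤ 4 * k := by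
    have : 2 ^ (k.size - 1) ≤ k := Nat.lt_size.1 (by have := Nat.size_pos.2 hkpos; omega)
    have h3 : i = (k.size - 1) + 2 := by have := Nat.size_pos.2 hkpos; omega
    rw [h3, pow_add]
    have h4 : (2 : ℝ) ^ (k.size - 1) ≤ k := by exact_mod_cast this
    linarith
  have hp : (1 / 2 : ℝ) ^ i = 1 / 2 ^ i := by rw [div_pow, one_pow]
  have hpos : (0 : ℝ) < 2 ^ i := by positivity
  have hkpos' : (0 : ℝ) < k := by exact_mod_cast hkpos
  have h5 : (k - 1 : ℝ) * ((1 / 2) ^ i * (1 / 2) ^ i) ≤ 1 / 2 * (1 / 2) ^ i := by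
    rw [← mul_assoc]
    refine mul_le_mul_of_nonneg_right ?_ (by positivity)
    rw [hp, mul_one_div, div_le_iff₀ hpos]
    linarith
  have h6 : 1 / (8 * (k : ℝ)) ≤ 1 / 2 * (1 / 2) ^ i := by
    rw [hp, one_div_mul_one_div]
    exact one_div_le_one_div_of_le (by positivity) (by linarith)
  linarith

open Classical in
/-- In expectation, a phase covers at least the fraction `1 / (8 * L)` of the missing vertices, where
`L` is the number of its levels. -/
theorem integral_missing_le (hG : G.WF) (Y : Set ℕ) (Y' : (ℕ → Bool) → Set ℕ) (c : ℕ)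
    (hmono : ∀ η, Y ⊆ Y' η)
    (hY' : ∀ η, ∀ i < G.n.size + 2, ∀ v, G.Isolated s (sample G s Y η c i) v → G.mincut s v ≤ lam →
      (G.minSide s v : Set ℕ) ⊆ Y' η)
    (hmeas : Measurable fun η => ((missing G s lam (Y' η)).card : ℝ))
    (hiso : ∀ i v, MeasurableSet {η | G.Isolated s (sample G s Y η c i) v}) :
    ∫ η, ((missing G s lam (Y' η)).card : ℝ) ∂coinLaw ≤
      (1 - 1 / (8 * (G.n.size + 2 : ℝ))) * (missing G s lam Y).card := by
  set A := missing G s lam Y with hA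
  set L : ℝ := G.n.size + 2 with hL
  have hLpos : 0 < L := by positivity
  let lvl : ℕ → ℕ := fun v => (sideSize G s lam Y v).size + 1
  let E : ℕ → Set (ℕ → Bool) := fun v => {η | G.Isolated s (sample G s Y η c (lvl v)) v}
  have hpt : ∀ η, ((missing G s lam (Y' η)).card : ℝ) ≤
      A.card - ∑ v ∈ A, (E v).indicator (fun _ => (sideSize G s lam Y v : ℝ) / L) η := by
    intro η
    have h1 := sum_isolated_le (lam := lam) (Y := Y) (Y' := Y' η)
      (r := fun i => sample G s Y η c i) (lvl := lvl) (L := G.n.size + 2) hG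
      (fun v _ => by
        have : (sideSize G s lam Y v).size ≤ G.n.size := Nat.size_le_size
          ((Finset.card_le_card Finset.inter_subset_right).trans (card_missing_le Y))
        simp only [lvl]
        omega) (hY' η)
    have h2 : (missing G s lam (Y' η)).card + (A.filter (· ∈ Y' η)).card = A.card := by
      rw [← Finset.card_filter_add_card_filter_not (s := A) (· ∈ Y' η), add_comm]
      congr 2
      ext v
      simp only [hA, mem_missing, Finset.mem_filter]
      exact ⟨fun h => ⟨⟨h.1, fun hv => h.2 (hmono η hv)⟩, h.2⟩, fun h => ⟨h.1.1, h.2⟩⟩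
    have h3 : ∑ v ∈ A, (E v).indicator (fun _ => (sideSize G s lam Y v : ℝ) / L) η =
        (∑ v ∈ A, (if G.Isolated s (sample G s Y η c (lvl v)) v then sideSize G s lam Y v
          else 0 : ℕ) : ℕ) / L := by
      rw [Nat.cast_sum, Finset.sum_div]
      refine Finset.sum_congr rfl fun v _ => ?_
      by_cases h : G.Isolated s (sample G s Y η c (lvl v)) v <;> simp [E, Set.indicator, h]
    have h4 : ((∑ v ∈ A, (if G.Isolated s (sample G s Y η c (lvl v)) v then sideSize G s lam Y v
          else 0 : ℕ) : ℕ) : ℝ) / L ≤ (A.filter (· ∈ Y' η)).card := by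
      rw [div_le_iff₀ hLpos, mul_comm, hL]
      exact_mod_cast h1
    have h5 : ((missing G s lam (Y' η)).card : ℝ) + (A.filter (· ∈ Y' η)).card = A.card := by
      exact_mod_cast h2
    linarith
  have hEm : ∀ v, MeasurableSet (E v) := fun v => hiso _ v
  have hind : ∀ v ∈ A, Integrable
      ((E v).indicator fun _ => (sideSize G s lam Y v : ℝ) / L) coinLaw := fun v _ =>
    (integrable_const _).indicator (hEm v)
  have hint : Integrable (fun η => ((missing G s lam (Y' η)).card : ℝ)) coinLaw :=
    Integrable.of_bound hmeas.aestronglyMeasurable G.n (Filter.Eventually.of_forall fun η => by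
      rw [Real.norm_natCast]
      exact_mod_cast card_missing_le _)
  have hsub : Integrable (fun η => ∑ v ∈ A,
      (E v).indicator (fun _ => (sideSize G s lam Y v : ℝ) / L) η) coinLaw :=
    integrable_finsetSum A hind
  refine (integral_mono hint ((integrable_const (A.card : ℝ)).sub hsub) hpt).trans ?_
  have hsplit : ∫ η, ((A.card : ℝ) - ∑ v ∈ A,
      (E v).indicator (fun _ => (sideSize G s lam Y v : ℝ) / L) η) ∂coinLaw =
      A.card - ∑ v ∈ A, coinLaw.real (E v) * ((sideSize G s lam Y v : ℝ) / L) := by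
    rw [integral_sub (integrable_const _) hsub, integral_const, integral_finsetSum A hind]
    congr 1
    · simp
    · exact Finset.sum_congr rfl fun v _ => by
        rw [integral_indicator_const _ (hEm v), smul_eq_mul]
  refine hsplit.le.trans ?_
  have hsum : (A.card : ℝ) * (1 / (8 * L)) ≤
      ∑ v ∈ A, coinLaw.real (E v) * ((sideSize G s lam Y v : ℝ) / L) := by
    rw [← nsmul_eq_mul]
    refine Finset.card_nsmul_le_sum _ _ _ fun v hv => ?_
    have hk : (0 : ℝ) < sideSize G s lam Y v := by
      obtain ⟨⟨hvn, hvs, -⟩, -⟩ := mem_missing.1 hv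
      exact_mod_cast Finset.card_pos.2
        ⟨v, Finset.mem_inter.2 ⟨(WGraph.minSide_spec hG hvn hvs).2.1, hv⟩⟩
    calc 1 / (8 * L) = 1 / (8 * (sideSize G s lam Y v : ℝ)) * ((sideSize G s lam Y v : ℝ) / L) := by
          field_simp
      _ ≤ _ := mul_le_mul_of_nonneg_right (isolated_prob hG hv c) (by positivity)
  linarith

theorem one_sub_pow_le {L : ℝ} (hL : 1 ≤ L) (a : ℕ) {N : ℕ} (hN : 8 * L * a ≤ N) :
    (1 - 1 / (8 * L)) ^ N ≤ (1 / 2) ^ a := by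
  have h1 : 1 - 1 / (8 * L) ≤ Real.exp (-(1 / (8 * L))) := by
    have := Real.add_one_le_exp (-(1 / (8 * L)))
    linarith
  have h0 : 0 ≤ 1 - 1 / (8 * L) := by
    rw [sub_nonneg, div_le_one (by positivity)]
    linarith
  have h2 : Real.exp (-1) ≤ 1 / 2 := by
    rw [Real.exp_neg, inv_eq_one_div]
    refine one_div_le_one_div_of_le (by norm_num) ?_
    have := Real.add_one_le_exp 1
    linarith
  calc (1 - 1 / (8 * L)) ^ N ≤ Real.exp (-(1 / (8 * L))) ^ N := by gcongr
    _ = Real.exp (N * -(1 / (8 * L))) := (Real.exp_nat_mul _ _).symm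
    _ ≤ Real.exp (a * -1) := by
        refine Real.exp_le_exp.2 ?_
        have : (a : ℝ) ≤ N * (1 / (8 * L)) := by
          rw [mul_one_div, le_div_iff₀ (by positivity)]
          linarith
        linarith
    _ = Real.exp (-1) ^ a := Real.exp_nat_mul _ _
    _ ≤ (1 / 2) ^ a := by gcongr

/-- A random process of sets `Y j`, each of which covers the smallest sides of all isolated vertices
in the samples that are drawn in the preceding phase, covers the whole threshold set with high
probability after sufficiently many phases. -/
theorem coinLaw_not_subset_le (hG : G.WF) (hn : 0 < G.n) (Y : ℕ → (ℕ → Bool) → Set ℕ)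
    (hdep : ∀ j ω ω', (∀ i < j * ((G.n.size + 2) * G.n), ω i = ω' i) → Y j ω = Y j ω')
    (hmono : ∀ j ω, Y j ω ⊆ Y (j + 1) ω)
    (hY : ∀ j ω, ∀ i < G.n.size + 2, ∀ v,
      G.Isolated s (sample G s (Y j ω) ω (j * ((G.n.size + 2) * G.n)) i) v →
      G.mincut s v ≤ lam → (G.minSide s v : Set ℕ) ⊆ Y (j + 1) ω)
    {C N : ℕ} (hN : 8 * ((G.n.size + 2) * ((G.n.size + 2) * (C + 1))) ≤ N) :
    coinLaw {ω | ¬ G.cutThresholdSet s lam ⊆ Y N ω} ≤ ENNReal.ofReal (1 / (G.n : ℝ) ^ C) := by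
  set L : ℝ := G.n.size + 2 with hL
  let f : ℕ → (ℕ → Bool) → ℝ := fun j ω => (missing G s lam (Y j ω)).card
  have hmeas : ∀ j, Measurable (f j) := fun j =>
    measurable_of_finite_coins (j * ((G.n.size + 2) * G.n)) fun ω ω' h => by
      simp only [f, hdep j ω ω' h]
  have hbound : ∀ j ω, |f j ω| ≤ G.n := fun j ω => by
    rw [Nat.abs_cast]
    exact_mod_cast card_missing_le _
  have hstep : ∀ j, ∫ ω, f (j + 1) ω ∂coinLaw ≤ (1 - 1 / (8 * L)) * ∫ ω, f j ω ∂coinLaw := by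
    intro j
    set c := j * ((G.n.size + 2) * G.n) with hc
    refine integral_le_of_splice (hmeas j) (hmeas (j + 1)) (hbound j) (hbound (j + 1)) c _
      fun ω => ?_
    have hsp : ∀ η, Y j (splice c ω η) = Y j ω := fun η =>
      hdep j _ _ fun i hi => if_pos hi
    have hsam : ∀ η i, sample G s (Y j ω) (splice c ω η) c i = sample G s (Y j ω) η c i := by
      intro η i
      have : ∀ a b, splice c ω η (c + a + b) = η (c + a + b) := fun a b => if_neg (by omega)
      simp only [sample, this]
    refine integral_missing_le hG (Y j ω) (fun η => Y (j + 1) (splice c ω η)) c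
      (fun η => (hsp η).symm.subset.trans (hmono j _)) (fun η i hi v hv => ?_) ?_ fun i v => ?_
    · have := hY j (splice c ω η) i hi v
      rw [hsp, hsam] at this
      exact this hv
    · exact (hmeas (j + 1)).comp ((measurable_splice c).comp measurable_prodMk_left)
    · refine measurableSet_setOfPred.2 (measurable_of_finite_coins (c + i * G.n + G.n)
        fun η η' h => ?_)
      have : sample G s (Y j ω) η c i = sample G s (Y j ω) η' c i := by
        ext x
        refine and_congr_right fun hx => and_congr_right fun _ => or_congr_right ?_
        refine forall_congr' fun j' => forall_congr' fun hj' => ?_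
        rw [h]
        have := Nat.mul_le_mul_right G.n hj'.le
        omega
      rw [this]
  have hpow : ∀ j, ∫ ω, f j ω ∂coinLaw ≤ (1 - 1 / (8 * L)) ^ j * G.n := by
    have h0 : 0 ≤ 1 - 1 / (8 * L) := by
      rw [sub_nonneg, div_le_one (by positivity), hL]
      have : (0 : ℝ) ≤ G.n.size := by positivity
      linarith
    intro j
    induction j with
    | zero =>
      have := integral_mono (μ := coinLaw) (Integrable.of_bound (hmeas 0).aestronglyMeasurable (G.n : ℝ)
        (Filter.Eventually.of_forall fun ω => hbound 0 ω)) (integrable_const (G.n : ℝ))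
        fun ω => (le_abs_self _).trans (hbound 0 ω)
      simpa using this
    | succ j ih =>
      refine (hstep j).trans ?_
      rw [pow_succ', mul_assoc]
      gcongr
  have hmarkov := mul_meas_ge_le_integral_of_nonneg (μ := coinLaw) (f := f N)
    (Filter.Eventually.of_forall fun ω => Nat.cast_nonneg _)
    (Integrable.of_bound (hmeas N).aestronglyMeasurable (G.n : ℝ)
        (Filter.Eventually.of_forall fun ω => hbound N ω)) 1
  rw [one_mul] at hmarkov
  have hsub : {ω | ¬ G.cutThresholdSet s lam ⊆ Y N ω} ⊆ {ω | 1 ≤ f N ω} := by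
    intro ω hω
    obtain ⟨v, hv, hvY⟩ := Set.not_subset.1 hω
    have : 0 < (missing G s lam (Y N ω)).card := Finset.card_pos.2 ⟨v, mem_missing.2 ⟨hv, hvY⟩⟩
    have h : (1 : ℝ) ≤ (missing G s lam (Y N ω)).card := by exact_mod_cast this
    exact h
  have hfinal : ∫ ω, f N ω ∂coinLaw ≤ 1 / (G.n : ℝ) ^ C := by
    have hnpos : (0 : ℝ) < G.n := by exact_mod_cast hn
    have h1 : (1 - 1 / (8 * L)) ^ N ≤ (1 / 2) ^ ((G.n.size + 2) * (C + 1)) := by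
      refine one_sub_pow_le ?_ _ ?_
      · rw [hL]
        have : (0 : ℝ) ≤ G.n.size := by positivity
        linarith
      · rw [hL]
        have : (8 * ((G.n.size + 2) * ((G.n.size + 2) * (C + 1)) : ℕ) : ℝ) ≤ N := by
          exact_mod_cast hN
        refine le_trans (le_of_eq ?_) this
        push_cast
        ring
    have h2 : ((1 / 2 : ℝ)) ^ (G.n.size + 2) ≤ 1 / G.n := by
      rw [div_pow, one_pow]
      refine one_div_le_one_div_of_le hnpos ?_
      have h3 : G.n ≤ 2 ^ (G.n.size + 2) := (Nat.lt_size_self G.n).le.trans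
        (Nat.pow_le_pow_right (by norm_num) (by omega))
      exact_mod_cast h3
    calc ∫ ω, f N ω ∂coinLaw ≤ (1 - 1 / (8 * L)) ^ N * G.n := hpow N
      _ ≤ (1 / 2) ^ ((G.n.size + 2) * (C + 1)) * G.n := by gcongr
      _ = ((1 / 2) ^ (G.n.size + 2)) ^ (C + 1) * G.n := by rw [pow_mul]
      _ ≤ (1 / G.n) ^ (C + 1) * G.n := by gcongr
      _ = 1 / (G.n : ℝ) ^ C := by
        rw [div_pow, one_pow, pow_succ]
        field_simp
  calc coinLaw {ω | ¬ G.cutThresholdSet s lam ⊆ Y N ω} ≤ coinLaw {ω | 1 ≤ f N ω} :=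
        measure_mono hsub
    _ = ENNReal.ofReal (coinLaw.real {ω | 1 ≤ f N ω}) := (ofReal_measureReal (μ := coinLaw)).symm
    _ ≤ _ := ENNReal.ofReal_le_ofReal (hmarkov.trans hfinal)

end

/-! ### The whole algorithm -/

/-- The expression `e + k`. -/
def IExp.addLit (e : IExp) : ℕ → IExp
  | 0 => e
  | k + 1 => .succ (e.addLit k)

theorem IExp.eval_addLit (e : IExp) (σ : State) (k : ℕ) : (e.addLit k).eval σ = e.eval σ + k := by
  induction k with
  | zero => rfl
  | succ k ih => simp [IExp.addLit, IExp.eval, ih, add_assoc]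

/-- Compute the number of bits of `n`. -/
def countBits : Prog :=
  .iset 6 (.var 0) ;;
  .loop (.ilt (.lit 0) (.var 6)) (.iset 6 (.half (.var 6)) ;; .iset 3 (.succ (.var 3)))

/-- Compute the number of bits of `n`, the number of levels, the table of doubles, and the number
`c * L * L` of phases, where `L` is the number of levels. -/
def setup (c : ℕ) : Prog :=
  countBits ;;
  .iset 4 (.succ (.succ (.var 3))) ;;
  .forLoop 9 (.var 0) (.istore 6 (.succ (.var 9)) (.succ (.succ (.arr 6 (.var 9))))) ;;
  .forLoop 9 (.var 4) (.forLoop 10 (.var 4) (.iset 5 ((IExp.var 5).addLit c)))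

/-- The algorithm with `c * L * L` phases. -/
def thresholdProg (c : ℕ) : Prog := setup c ;; .forLoop 6 (.var 5) phase

/-- The algorithm, cut off after `j` phases. -/
def truncated (c : ℕ) : ℕ → Prog
  | 0 => setup c ;; .iset 6 (.lit 0)
  | j + 1 => truncated c j ;; phase ;; .iset 6 (.succ (.var 6))

theorem size_half {x : ℕ} (hx : 0 < x) : x.size = (x / 2).size + 1 := by
  refine le_antisymm (Nat.size_le.2 ?_) (Nat.lt_size.2 ?_)
  · have := Nat.lt_size_self (x / 2)
    rw [pow_succ]
    omega
  · rcases Nat.eq_zero_or_pos (x / 2).size with h | h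
    · rw [h]
      exact hx
    · have h1 : 2 ^ ((x / 2).size - 1) ≤ x / 2 := Nat.lt_size.1 (by omega)
      have h2 : (x / 2).size = (x / 2).size - 1 + 1 := by omega
      rw [h2, pow_succ]
      omega

section

variable {O : FlowOracle} {ω : ℕ → Bool} {σ : State} {G : WGraph} {s : ℕ} {lam : ℝ}

theorem Run.countBits (h3 : σ.iv 3 = 0) :
    Run O ω countBits σ (3 * (σ.iv 0).size + 2) fun τ => τ.iv 3 = (σ.iv 0).size := by
  refine Run.seq (t₂ := 3 * (σ.iv 0).size + 1) (.straight rfl le_rfl (Q := (· = _)) rfl) ?_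
    (by simp only [Prog.size]; omega)
  rintro _ rfl -
  refine Run.loop (t₁ := 2) (fun τ => τ.iv 3 + (τ.iv 6).size = (σ.iv 0).size)
    (fun τ => (τ.iv 6).size) ?_ (by simp [Prog.run, State.setI, IExp.eval, h3]) ?_
    (by simp [Prog.run, State.setI, IExp.eval]; omega)
  · intro τ hI hb
    have hb' : 0 < τ.iv 6 := by simpa [BExp.Holds, IExp.eval] using hb
    have := size_half hb'
    refine Run.straight rfl le_rfl ?_
    simp [Prog.run, State.setI, IExp.eval]
    omega
  · intro τ hI hb
    have hb' : τ.iv 6 = 0 := by simpa [BExp.Holds, IExp.eval] using hb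
    simpa [hb'] using hI

theorem Run.setup (c : ℕ) :
    Run O ω (setup c) (input G s lam)
      (3 * G.n.size + 3 * G.n + 7 + (G.n.size + 2) * (3 * (G.n.size + 2) + 4)) fun τ =>
      Static G s lam τ ∧ τ.iv 5 = c * ((G.n.size + 2) * (G.n.size + 2)) ∧ marked τ = ∅ ∧
        τ.coins = 0 ∧ τ.calls = [] := by
  have i0 : (input G s lam).iv 0 = G.n := rfl
  refine Run.seq
    (t₂ := 3 * G.n + 5 + (G.n.size + 2) * (3 * (G.n.size + 2) + 4))
    (Run.countBits (by simp [input])) ?_ (by rw [i0]; omega)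
  intro σ₁ h₁ hF₁
  refine Run.seq (t₁ := 1) (t₂ := 3 * G.n + 4 + (G.n.size + 2) * (3 * (G.n.size + 2) + 4))
    (P := fun τ => τ.iv 4 = G.n.size + 2) (.straight rfl le_rfl ?_) ?_ (by omega)
  · simp [Prog.run, State.setI, IExp.eval, h₁, i0]
  intro σ₂ h₂ hF₂
  have j3 : σ₂.iv 3 = G.n.size := (hF₂.iv 3 rfl).trans h₁
  have j6 : σ₂.ia 6 0 = 0 := by
    rw [hF₂.ia 6 rfl, hF₁.ia 6 rfl]
    simp [input]
  refine Run.seq (t₁ := G.n * 3 + 2) (t₂ := 2 + (G.n.size + 2) * (3 * (G.n.size + 2) + 4))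
    (P := fun τ => ∀ i ≤ G.n, τ.ia 6 i = 2 * i) ?_ ?_ (by omega)
  · refine Run.forLoop (t₁ := 1) G.n (fun b τ => ∀ i ≤ b, τ.ia 6 i = 2 * i) rfl
      (fun τ hF => (hF.iv 0 rfl).trans ((hF₂.iv 0 rfl).trans (hF₁.iv 0 rfl))) ?_ ?_
      (fun τ _ h => h) le_rfl
    · intro i hi
      obtain rfl : i = 0 := by omega
      exact j6
    · intro b hb τ hF h9 h
      refine Run.straight rfl le_rfl fun i hi => ?_
      have hb := h b le_rfl
      by_cases hib : i = b + 1
      · simp [Prog.run, State.setI, State.storeI, IExp.eval, h9, hib, hb]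
        omega
      · simpa [Prog.run, State.setI, State.storeI, IExp.eval, h9, hib] using h i (by omega)
  intro σ₃ h₃ hF₃
  have k4 : σ₃.iv 4 = G.n.size + 2 := (hF₃.iv 4 rfl).trans h₂
  have k5 : σ₃.iv 5 = 0 := by
    rw [hF₃.iv 5 rfl, hF₂.iv 5 rfl, hF₁.iv 5 rfl]
    rfl
  have hst : Static G s lam σ₃ := by
    refine ⟨?_, ?_, ?_, (hF₃.iv 3 rfl).trans j3, k4, ?_, ?_, ?_, ?_, h₃⟩
    · rw [hF₃.iv 0 rfl, hF₂.iv 0 rfl, hF₁.iv 0 rfl]; rfl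
    · rw [hF₃.iv 1 rfl, hF₂.iv 1 rfl, hF₁.iv 1 rfl]; rfl
    · rw [hF₃.iv 2 rfl, hF₂.iv 2 rfl, hF₁.iv 2 rfl]; rfl
    · rw [hF₃.rv 0 rfl, hF₂.rv 0 rfl, hF₁.rv 0 rfl]; rfl
    · intro e
      rw [hF₃.ia 0 rfl, hF₂.ia 0 rfl, hF₁.ia 0 rfl]
      simp [input]
    · intro e
      rw [hF₃.ia 1 rfl, hF₂.ia 1 rfl, hF₁.ia 1 rfl]
      simp [input]
    · intro e
      rw [hF₃.ra 0 rfl, hF₂.ra 0 rfl, hF₁.ra 0 rfl]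
      simp [input]
  refine Run.forLoop (t₁ := (G.n.size + 2) * 3 + 2) (G.n.size + 2)
    (fun a τ => τ.iv 5 = c * (a * (G.n.size + 2))) rfl
    (fun τ hF => (hF.iv 4 rfl).trans k4) (by simp [State.setI, k5]) ?_ ?_ ?_
  · intro a ha τ hF h9 h
    refine Run.forLoop (t₁ := 1) (G.n.size + 2)
      (fun b τ => τ.iv 5 = c * (a * (G.n.size + 2) + b)) rfl
      (fun τ' hF' => (hF'.iv 4 rfl).trans ((hF.iv 4 rfl).trans k4)) (by simp [State.setI, h]) ?_ ?_
      le_rfl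
    · intro b hb τ' hF' h10 h'
      refine Run.straight rfl le_rfl ?_
      simp [Prog.run, State.setI, IExp.eval_addLit, IExp.eval, h']
      ring
    · intro τ' hF' h'
      change τ'.iv 5 = _
      rw [h', Nat.succ_mul a]
  · intro τ hF h
    refine ⟨hst.frame hF rfl, h, ?_, ?_, ?_⟩
    · ext x
      simp only [marked, hF.ia 2 rfl, hF₃.ia 2 rfl, hF₂.ia 2 rfl, hF₁.ia 2 rfl]
      simp [input]
    · rw [hF.coins rfl, hF₃.coins rfl, hF₂.coins rfl, hF₁.coins rfl]; rfl
    · rw [hF.calls rfl, hF₃.calls rfl, hF₂.calls rfl, hF₁.calls rfl]; rfl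
  · nlinarith

/-- The state of the memory after `j` phases. -/
structure AfterPhases (G : WGraph) (s : ℕ) (lam : ℝ) (j : ℕ) (τ : State) : Prop where
  static : Static G s lam τ
  counter : τ.iv 6 = j
  coins : τ.coins = j * ((G.n.size + 2) * G.n)
  calls : τ.calls.length = j * ((G.n.size + 2) * (G.n.size + 1)) ∧ ∀ I ∈ τ.calls, GoodCall G I
  sound : marked τ ⊆ G.cutThresholdSet s lam

theorem AfterPhases.init {τ : State} (hσ : Static G s lam τ) (hm : marked τ = ∅) (hc : τ.coins = 0)
    (hl : τ.calls = []) : AfterPhases G s lam 0 (τ.setI 6 0) where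
  static := hσ.frame (Frame.setI τ 6 (.lit 0) 0) rfl
  counter := by simp [State.setI]
  coins := by simpa [State.setI] using hc
  calls := by simp [State.setI, hl]
  sound := by
    change marked τ ⊆ _
    simp [hm]

theorem AfterPhases.step (hO : O.Correct) (hG : G.WF) (hs : s < G.n) {j : ℕ}
    (h : AfterPhases G s lam j σ) :
    Run O ω phase σ ((G.n.size + 3) * ((G.n.size + 1) * (440 * (G.n + G.m)))) fun τ =>
      AfterPhases G s lam (j + 1) (τ.setI 6 (j + 1)) ∧ marked σ ⊆ marked τ ∧
      ∀ i < G.n.size + 2, ∀ v,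
        G.Isolated s (sample G s (marked σ) ω (j * ((G.n.size + 2) * G.n)) i) v →
        G.mincut s v ≤ lam → (G.minSide s v : Set ℕ) ⊆ marked τ := by
  refine (Run.phase hO hG hs h.static fun hm => (h.sound hm).2.1 rfl).mono ?_ le_rfl
  rintro τ ⟨⟨l, hl, hlen, hcalls⟩, hcoins, hmono, hsound, hcompl⟩ hF
  rw [h.coins] at hcompl
  refine ⟨⟨(h.static.frame hF rfl).frame (Frame.setI τ 6 (.lit 0) (j + 1)) rfl, ?_, ?_, ?_, ?_⟩,
    hmono, hcompl⟩
  · simp [State.setI]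
  · change τ.coins = _
    rw [hcoins, h.coins, Nat.succ_mul j]
  · change τ.calls.length = _ ∧ ∀ I ∈ τ.calls, GoodCall G I
    rw [hcalls]
    refine ⟨by rw [List.length_append, hlen, h.calls.1, Nat.succ_mul j], ?_⟩
    simp only [List.mem_append]
    rintro I (hI | hI)
    exacts [h.calls.2 I hI, hl I hI]
  · exact hsound.trans (Set.union_subset h.sound subset_rfl)

theorem Exec.truncated_succ {c j T U : ℕ} {τ : State}
    (h : Exec O ω (truncated c j) (input G s lam) T σ) (h6 : σ.iv 6 = j)
    (h' : Exec O ω phase σ U τ) :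
    Exec O ω (truncated c (j + 1)) (input G s lam) (T + (U + 1)) (τ.setI 6 (j + 1)) := by
  refine .seq h (.seq h' ?_)
  have h7 : τ.iv 6 = j := (h'.frame.iv 6 rfl).trans h6
  have := Exec.iset (O := O) (ω := ω) τ 6 (.succ (.var 6))
  rwa [show (IExp.succ (.var 6)).eval τ = j + 1 by simp [IExp.eval, h7]] at this

theorem exists_exec_truncated (hO : O.Correct) (hG : G.WF) (hs : s < G.n) (ω : ℕ → Bool) (c j : ℕ) :
    ∃ T τ, Exec O ω (truncated c j) (input G s lam) T τ ∧ AfterPhases G s lam j τ := by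
  induction j with
  | zero =>
    obtain ⟨T, τ, he, -, hst, -, hm, hc, hl⟩ := Run.setup (O := O) (ω := ω) (G := G) (s := s)
      (lam := lam) c
    exact ⟨_, _, .seq he (.iset τ 6 (.lit 0)), .init hst hm hc hl⟩
  | succ j ih =>
    obtain ⟨T, τ, he, h⟩ := ih
    obtain ⟨U, τ', he', -, h', -⟩ := h.step (ω := ω) hO hG hs
    exact ⟨_, _, he.truncated_succ h.counter he', h'⟩

/-- The vertices marked after `j` phases. -/
def markedAfter (O : FlowOracle) (G : WGraph) (s : ℕ) (lam : ℝ) (c j : ℕ) (ω : ℕ → Bool) : Set ℕ :=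
  {v | ∃ T τ, Exec O ω (truncated c j) (input G s lam) T τ ∧ v ∈ marked τ}

theorem markedAfter_eq {c j T : ℕ} {τ : State}
    (h : Exec O ω (truncated c j) (input G s lam) T τ) :
    markedAfter O G s lam c j ω = marked τ := by
  ext v
  constructor
  · rintro ⟨T', τ', h', hv⟩
    rwa [(h.det h').2] at hv
  · exact fun hv => ⟨T, τ, h, hv⟩

theorem coinLaw_failure_le (hO : O.Correct) (hG : G.WF) (hs : s < G.n) (c : ℕ) {C N : ℕ}
    (hN : 8 * ((G.n.size + 2) * ((G.n.size + 2) * (C + 1))) ≤ N) :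
    coinLaw {ω | ¬ G.cutThresholdSet s lam ⊆ markedAfter O G s lam c N ω} ≤
      ENNReal.ofReal (1 / (G.n : ℝ) ^ C) := by
  have hstep : ∀ j ω, ∃ Y Y' : Set ℕ, markedAfter O G s lam c j ω = Y ∧
      markedAfter O G s lam c (j + 1) ω = Y' ∧ Y ⊆ Y' ∧ ∀ i < G.n.size + 2, ∀ v,
        G.Isolated s (sample G s Y ω (j * ((G.n.size + 2) * G.n)) i) v →
        G.mincut s v ≤ lam → (G.minSide s v : Set ℕ) ⊆ Y' := by
    intro j ω
    obtain ⟨T, τ, he, h⟩ := exists_exec_truncated (lam := lam) hO hG hs ω c j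
    obtain ⟨U, τ', he', -, -, hmono, hcompl⟩ := h.step (ω := ω) hO hG hs
    exact ⟨_, _, markedAfter_eq he, markedAfter_eq (he.truncated_succ h.counter he'), hmono, hcompl⟩
  refine coinLaw_not_subset_le hG (by omega) (markedAfter O G s lam c) ?_ ?_ ?_ hN
  · intro j ω ω' hω
    obtain ⟨T, τ, he, h⟩ := exists_exec_truncated (lam := lam) hO hG hs ω c j
    rw [markedAfter_eq he, markedAfter_eq (he.congr_tape fun i _ hi => hω i (h.coins ▸ hi))]
  · intro j ω
    obtain ⟨Y, Y', hY, hY', hsub, -⟩ := hstep j ω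
    rwa [hY, hY']
  · intro j ω i hi v hv hl
    obtain ⟨Y, Y', hY, hY', -, hcompl⟩ := hstep j ω
    rw [hY] at hv
    rw [hY']
    exact hcompl i hi v hv hl

theorem Run.thresholdProg (hO : O.Correct) (hG : G.WF) (hs : s < G.n) (ω : ℕ → Bool) (c : ℕ) :
    Run O ω (thresholdProg c) (input G s lam)
      (3 * G.n.size + 3 * G.n + 7 + (G.n.size + 2) * (3 * (G.n.size + 2) + 4) +
        (c * ((G.n.size + 2) * (G.n.size + 2)) *
          ((G.n.size + 3) * ((G.n.size + 1) * (440 * (G.n + G.m))) + 2) + 2)) fun τ =>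
      AfterPhases G s lam (c * ((G.n.size + 2) * (G.n.size + 2)))
        (τ.setI 6 (c * ((G.n.size + 2) * (G.n.size + 2)))) ∧
      marked τ = markedAfter O G s lam c (c * ((G.n.size + 2) * (G.n.size + 2))) ω := by
  obtain ⟨T, σ, he, hT, hst, h5, hm, hc, hl⟩ := Run.setup (O := O) (ω := ω) (G := G) (s := s)
      (lam := lam) c
  refine Run.seq (P := (· = σ)) ⟨T, σ, he, hT, rfl⟩ ?_ le_rfl
  rintro _ rfl -
  refine Run.forLoop (c * ((G.n.size + 2) * (G.n.size + 2))) (fun j τ => AfterPhases G s lam j τ ∧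
    ∃ T, Exec O ω (truncated c j) (input G s lam) T τ) rfl (fun τ hF => (hF.iv 5 rfl).trans h5)
    ⟨.init hst hm hc hl, _, .seq he (.iset _ 6 (.lit 0))⟩ ?_ ?_ le_rfl
  · rintro j hj τ hF h6 ⟨h, T', he'⟩
    obtain ⟨U, τ', heU, hU, h', -⟩ := h.step (ω := ω) hO hG hs
    exact ⟨U, τ', heU, hU, h', _, he'.truncated_succ h.counter heU⟩
  · rintro τ hF ⟨h, T', he'⟩
    refine ⟨?_, (markedAfter_eq he').symm⟩
    have : τ.setI 6 (c * ((G.n.size + 2) * (G.n.size + 2))) = τ := by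
      rw [← h.counter, State.setI, Function.update_eq_self]
    rwa [this]

end

end RAM

theorem size_eq_log_add_one {n : ℕ} (hn : 0 < n) : n.size = Nat.log 2 n + 1 :=
  le_antisymm (Nat.size_le.2 (Nat.lt_pow_succ_log_self one_lt_two n))
    (Nat.lt_size.2 (Nat.pow_log_le_self 2 hn.ne'))

theorem mainTheorem3 (C : ℕ) :
    ∃ (p : RAM.Prog) (c k : ℕ),
      ∀ (O : FlowOracle), O.Correct →
      ∀ (G : WGraph), G.WF →
      ∀ (s : ℕ), s < G.n →
      ∀ (lam : ℝ), 0 ≤ lam →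
        (∀ ω : ℕ → Bool, ∃ (T : ℕ) (τ : RAM.State),
          RAM.Exec O ω p (RAM.input G s lam) T τ ∧
          T ≤ c * (G.n + G.m) * (Nat.log 2 (G.n + G.m) + 1) ^ k ∧
          τ.calls.length ≤ c * (Nat.log 2 G.n + 1) ^ k ∧
          ∀ I ∈ τ.calls, I.Valid ∧ I.n ≤ c * G.n ∧ I.m ≤ c * G.m) ∧
        RAM.coinLaw {ω : ℕ → Bool | ¬ ∃ (T : ℕ) (τ : RAM.State),
          RAM.Exec O ω p (RAM.input G s lam) T τ ∧
          RAM.output G.n τ = G.cutThresholdSet s lam} ≤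
            ENNReal.ofReal (1 / (G.n : ℝ) ^ C) := by
  refine ⟨RAM.thresholdProg (8 * (C + 1)), 300000 * (C + 1), 4, ?_⟩
  intro O hO G hG s hs lam _
  have hn : 0 < G.n := by omega
  refine ⟨fun ω => ?_, ?_⟩
  · obtain ⟨T, τ, he, hT, h, -⟩ := RAM.Run.thresholdProg (lam := lam) hO hG hs ω (8 * (C + 1))
    have hcalls : τ.calls.length = 8 * (C + 1) * ((G.n.size + 2) * (G.n.size + 2)) *
        ((G.n.size + 2) * (G.n.size + 1)) ∧ ∀ I ∈ τ.calls, RAM.GoodCall G I := h.calls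
    have hsize := size_eq_log_add_one hn
    have hlog : Nat.log 2 G.n ≤ Nat.log 2 (G.n + G.m) := Nat.log_mono_right (by omega)
    refine ⟨T, τ, he, hT.trans ?_, ?_, fun I hI => ?_⟩
    · generalize Nat.log 2 (G.n + G.m) = a at *
      have hz : G.n.size ≤ a + 1 := by omega
      generalize G.n.size = z at *
      have hW : 0 < G.n + G.m := by omega
      have hnW : G.n ≤ G.n + G.m := by omega
      generalize G.n + G.m = W at *
      generalize G.n = n at *
      generalize hq : a + 1 = q at *
      have hq1 : 1 ≤ q := by omega
      have e1 : (z + 2) * (z + 2) ≤ 9 * q ^ 2 := by nlinarith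
      have e2 : (z + 3) * (z + 1) ≤ 8 * q ^ 2 := by nlinarith
      have e3 : 1 ≤ q ^ 2 := Nat.one_le_pow _ _ hq1
      have e4 : (z + 3) * ((z + 1) * (440 * W)) + 2 ≤ 3522 * (q ^ 2 * W) := by
        have := Nat.mul_le_mul_right (440 * W) e2
        nlinarith
      have e5 : 8 * (C + 1) * ((z + 2) * (z + 2)) *
          ((z + 3) * ((z + 1) * (440 * W)) + 2) ≤
          8 * (C + 1) * (9 * q ^ 2) * (3522 * (q ^ 2 * W)) := by gcongr
      have e6 : q ≤ q ^ 2 := by nlinarith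
      have e7 : q ^ 2 ≤ q ^ 4 := Nat.pow_le_pow_right hq1 (by norm_num)
      have e8 : 3 * z + 3 * n + 7 + (z + 2) * (3 * (z + 2) + 4) + 2 ≤ 60 * (q ^ 4 * W) := by
        have f1 : q ^ 4 ≤ q ^ 4 * W := Nat.le_mul_of_pos_right _ hW
        have f2 : W ≤ q ^ 4 * W := Nat.le_mul_of_pos_left _ (by omega)
        have f3 : (z + 2) * (3 * (z + 2) + 4) = 3 * ((z + 2) * (z + 2)) + 4 * (z + 2) := by ring
        omega
      have e9 : 8 * (C + 1) * (9 * q ^ 2) * (3522 * (q ^ 2 * W)) =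
          253584 * ((C + 1) * (q ^ 4 * W)) := by ring
      have e10 : q ^ 4 * W ≤ (C + 1) * (q ^ 4 * W) := Nat.le_mul_of_pos_left _ (by omega)
      have e11 : 300000 * (C + 1) * W * q ^ 4 = 300000 * ((C + 1) * (q ^ 4 * W)) := by ring
      omega
    · rw [hcalls.1, hsize]
      generalize hq : Nat.log 2 G.n + 1 = q
      have hq1 : 1 ≤ q := by omega
      calc 8 * (C + 1) * ((q + 2) * (q + 2)) * ((q + 2) * (q + 1)) ≤
            8 * (C + 1) * ((3 * q) * (3 * q)) * ((3 * q) * (2 * q)) := by gcongr <;> omega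
        _ = 432 * ((C + 1) * q ^ 4) := by ring
        _ ≤ 300000 * ((C + 1) * q ^ 4) := Nat.mul_le_mul_right _ (by norm_num)
        _ = 300000 * (C + 1) * q ^ 4 := by ring
    · obtain ⟨h1, h2, h3⟩ := hcalls.2 I hI
      refine ⟨h1, h2.trans (Nat.mul_le_mul_right _ ?_), h3.trans (Nat.mul_le_mul_right _ ?_)⟩ <;>
        omega
  · refine (MeasureTheory.measure_mono ?_).trans (RAM.coinLaw_failure_le (lam := lam) hO hG hs
      (8 * (C + 1)) (N := 8 * (C + 1) * ((G.n.size + 2) * (G.n.size + 2)))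
      (le_of_eq (by ring)))
    intro ω hω hsub
    obtain ⟨T, τ, he, -, h, hm⟩ := RAM.Run.thresholdProg (lam := lam) hO hG hs ω (8 * (C + 1))
    refine hω ⟨T, τ, he, ?_⟩
    rw [← hm] at hsub
    have hsound : RAM.marked τ ⊆ G.cutThresholdSet s lam := h.sound
    exact Set.Subset.antisymm (fun v hv => hsound hv.2) fun v hv => ⟨hv.1, hsub hv⟩
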